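/- Let $X$ be a compact complex manifold of dimension $d\ge 1$ and $D\subset X$ a smooth complex hypersurface. Let $L\to X$ be a holomorphic line bundle with a holomorphic section $s$ such that $D=\{s=0\}$ and such that $s$ vanishes to the same order $o(s)$ at all points of $D$ (automatic if $D$ is connected). Let $\alpha,\beta$ be semi-meromorphic forms on $X$ with poles along $D$, of degrees $k$ and $l$ with $k+l=2d$: they are smooth on $X\setminus D$, and near each point of $D$ they are of the form $\widetilde\alpha/z_1^{m}$, $\widetilde\beta/z_1^{m'}$ with $\widetilde\alpha,\widetilde\beta$ smooth, where $(z_1,\dots,z_d)$ are holomorphic coordinates in which $D=\{z_1=0\}$. For a form $\omega$ of degree $2d$, smooth on $X\setminus D$, choose a finite cover of $X$ by holomorphic charts $z_j=(z_{j,1},\dots,z_{j,d})$ in which $D$ is given by $z_{j,1}=0$ and $\omega=\frac{dz_{j,1}\wedge d\bar z_{j,1}}{z_{j,1}^{m_j}\bar z_{j,1}^{n_j}}\wedge\psi_j\,dz_{j,2}\wedge d\bar z_{j,2}\wedge\dots\wedge dz_{j,d}\wedge d\bar z_{j,d}$ with $\psi_j$ smooth and $m_j,n_j\ge 1$ (if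 such a cover exists), and a subordinate smooth partition of unity $(\rho_j)$. The Aeppli residue $\mathrm{Res}_A(\omega)$ is the class in $H^{d-1,d-1}_A(D)=\ker(\partial\bar\partial)/(\mathrm{im}\,\partial+\mathrm{im}\,\bar\partial)$ of $$\sum_j\frac{1}{(m_j-1)!\,(n_j-1)!}\,\frac{\partial^{m_j+n_j-2}(\rho_j\psi_j)}{\partial z_{j,1}^{m_j-1}\,\partial\bar z_{j,1}^{n_j-1}}\,dz_{j,2}\wedge d\bar z_{j,2}\wedge\dots\wedge dz_{j,d}\wedge d\bar z_{j,d}\,\Big|_D ,$$ and $\int_D\mathrm{Res}_A(\omega)$ is the integral over $D$ of any representative of the class. Then, for every smooth function $\varphi:X\to\mathbb R$ (in particular $\varphi=1$), the residue $\mathrm{Res}_A(\varphi\,\alpha\wedge\bar\beta)$ exists and $\int_D\mathrm{Res}_A(\varphi\,\alpha\wedge\bar\beta)$ depends neither on the representative nor on the choices of charts, partition of unity and exponents. For every smooth metric $|\cdot|$ on $L$ the integral $\int_X|s|^{2\lambda}\,\alpha\wedge\bar\beta$ converges absolutely and is holomorphic in $\lambda$ for $\mathrm{Re}\,\lambda$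 large, it has a meromorphic continuation to $\mathbb C$, and this continuation satisfies, as $\lambda\to 0$, $$\int_X|s|^{2\lambda}\,\alpha\wedge\bar\beta=\lambda^{-1}C_{-1}+C_0+O(|\lambda|),\qquad C_{-1}=-\frac{2\pi i}{o(s)}\int_D\mathrm{Res}_A(\alpha\wedge\bar\beta).$$ In particular $C_{-1}$ does not depend on the metric. The coefficient $C_0=C_0(|\cdot|)$ depends on the metric as follows: for every smooth $\varphi:X\to\mathbb R$, $$C_0\big(|\cdot|\,e^{-\varphi}\big)-C_0\big(|\cdot|\big)=\frac{4\pi i}{o(s)}\int_D\mathrm{Res}_A(\varphi\,\alpha\wedge\bar\beta).$$ (If $D=\emptyset$, both residue integrals are $0$.) -/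

import Mathlib

open Set Filter Topology MeasureTheory Asymptotics
open scoped Manifold ContDiff

noncomputable section

/-- The model space `ℂⁿ` of an `n`-dimensional complex manifold. -/
abbrev Cn (n : ℕ) : Type := Fin n → ℂ

/-- A (not necessarily continuous) complex-valued differential form of degree `k` on an
`n`-dimensional complex manifold `M`: to each point `x` it assigns a real-multilinear alternating
`ℂ`-valued map on the tangent space `TangentSpace 𝓘(ℂ, Cn n) x`, which by definition is the model
space `Cn n` (identified with the tangent space through the preferred chart at `x`). -/
abbrev Form (n : ℕ) (M : Type*) (k : ℕ) : Type _ := M → (Cn n) [⋀^Fin k]→ₗ[ℝ] ℂ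

section Forms

variable {n m k l : ℕ}
variable {M : Type*} [TopologicalSpace M] [ChartedSpace (Cn n) M]
variable {N : Type*} [TopologicalSpace N] [ChartedSpace (Cn m) N]

/-- The differential of a map between complex manifolds, as a linear map of the model spaces. -/
def tangentLin (f : M → N) (x : M) : Cn n →L[ℂ] Cn m :=
  mfderiv 𝓘(ℂ, Cn n) 𝓘(ℂ, Cn m) f x

/-- The pullback `f^* η` of a form. If `e` is a chart, then `pullbackForm e.symm η` is the
expression of `η` in the coordinates `e`. -/
def pullbackForm (f : M → N) (η : Form m N k) : Form n M k :=
  fun x => (η (f x)).compLinearMap ((tangentLin f x).restrictScalars ℝ).toLinearMap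

/-- The form `η` is smooth (`C^∞`) on the open set `U`: its coefficients in every holomorphic
chart are smooth. -/
def IsSmoothFormOn (η : Form n M k) (U : Set M) : Prop :=
  ∀ e ∈ IsManifold.maximalAtlas 𝓘(ℂ, Cn n) ω M, ∀ v : Fin k → Cn n,
    ContDiffOn ℝ ∞ (fun z => pullbackForm e.symm η z v) (e.target ∩ e.symm ⁻¹' U)

/-- Complex conjugation of a form. -/
def conjForm (η : Form n M k) : Form n M k :=
  fun x => Complex.conjAe.toLinearMap.compAlternatingMap (η x)

/-- The wedge product of two forms, normalised by
`(α ∧ β)(v) = ∑ sgn σ • α(v_{σ 1}, …, v_{σ k}) β(v_{σ (k+1)}, …, v_{σ (k+l)})`,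
the sum being over all `(k, l)`-shuffles `σ`. -/
def wedgeForm (α : Form n M k) (β : Form n M l) : Form n M (k + l) :=
  fun x => ((LinearMap.mul' ℝ ℂ).compAlternatingMap
    (AlternatingMap.domCoprod (α x) (β x))).domDomCongr finSumFinEquiv

/-- Transport of a form along an equality of degrees. -/
def castForm (h : k = l) (η : Form n M k) : Form n M l :=
  fun x => (η x).domDomCongr (finCongr h)

/-- The real coordinates `(z₁, z̄₁, z₂, z̄₂, …, zₙ, z̄ₙ)` on `ℂⁿ`. -/
def zzbar (n : ℕ) : Cn n →ₗ[ℝ] (Fin (2 * n) → ℂ) :=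
  LinearMap.pi fun i =>
    (if (i : ℕ) % 2 = 0 then LinearMap.id else Complex.conjAe.toLinearMap) ∘ₗ
      (LinearMap.proj (⟨(i : ℕ) / 2, by omega⟩ : Fin n) : Cn n →ₗ[ℝ] ℂ)

/-- The constant form `dz₁ ∧ dz̄₁ ∧ dz₂ ∧ dz̄₂ ∧ ⋯ ∧ dzₙ ∧ dz̄ₙ` on `ℂⁿ`. -/
def stdForm (n : ℕ) : Form n (Cn n) (2 * n) := fun _ =>
  { toFun := fun v => Matrix.det (Matrix.of fun i => zzbar n (v i))
    map_update_add' := by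
      intro _ v i x y
      have h : ∀ w : Cn n, (Matrix.of fun j => zzbar n (Function.update v i w j)) =
          (Matrix.of fun j => zzbar n (v j)).updateRow i (zzbar n w) := by
        intro w; ext j a
        by_cases hj : j = i
        · subst hj; simp
        · simp [hj]
      have e := Subsingleton.elim ‹DecidableEq (Fin (2 * n))› (instDecidableEqFin _)
      subst e
      rw [h, h, h, map_add, Matrix.det_updateRow_add]
    map_update_smul' := by
      intro _ v i c x
      have h : ∀ w : Cn n, (Matrix.of fun j => zzbar n (Function.update v i w j)) =
          (Matrix.of fun j => zzbar n (v j)).updateRow i (zzbar n w) := by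
        intro w; ext j a
        by_cases hj : j = i
        · subst hj; simp
        · simp [hj]
      have e := Subsingleton.elim ‹DecidableEq (Fin (2 * n))› (instDecidableEqFin _)
      subst e
      have hc : c • zzbar n x = (c : ℂ) • zzbar n x := by
        ext a; simp
      rw [h, h, map_smul, hc, Matrix.det_updateRow_smul, Complex.real_smul]
    map_eq_zero_of_eq' := by
      intro v i j hv hij
      exact Matrix.det_zero_of_row_eq hij (by ext a; simp [hv]) }

/-- The real frame `(∂/∂x₁, ∂/∂y₁, …, ∂/∂xₙ, ∂/∂yₙ)` of `ℂⁿ`, which gives the orientation of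
`ℂⁿ` as a complex vector space. -/
def stdFrame (n : ℕ) : Fin (2 * n) → Cn n := fun i =>
  Pi.single (⟨(i : ℕ) / 2, by omega⟩ : Fin n) (if (i : ℕ) % 2 = 0 then 1 else Complex.I)

/-- `HasFormIntegral η J`: the top-degree form `η` on the compact complex manifold `M` (with its
complex orientation) is absolutely integrable and `∫_M η = J`. That is, for all finite families
of holomorphic charts and all smooth partitions of unity subordinate to them, the pieces of `η` are
Lebesgue integrable in the charts and their integrals add up to `J`. -/
def HasFormIntegral (η : Form n M (2 * n)) (J : ℂ) : Prop :=
  ∀ (r : ℕ) (e : Fin r → OpenPartialHomeomorph M (Cn n))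
    (ρ : SmoothPartitionOfUnity (Fin r) 𝓘(ℝ, Cn n) M),
    (∀ j, e j ∈ IsManifold.maximalAtlas 𝓘(ℂ, Cn n) ω M) →
    ρ.IsSubordinate (fun j => (e j).source) →
    (∀ j, IntegrableOn (fun z => (ρ j ((e j).symm z) : ℂ) *
      pullbackForm (e j).symm η z (stdFrame n)) (e j).target) ∧
    ∑ j, ∫ z in (e j).target, (ρ j ((e j).symm z) : ℂ) *
      pullbackForm (e j).symm η z (stdFrame n) = J

/-- The operator `∂ = ∑ⱼ dzⱼ ∧ ∂/∂zⱼ` on forms on open subsets of `ℂⁿ`, evaluated at the point `z`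
on the vectors `v`: one alternates the `ℂ`-linear part of the derivative. -/
def delFlat (u : Form n (Cn n) k) (z : Cn n) (v : Fin (k + 1) → Cn n) : ℂ :=
  ∑ i : Fin (k + 1), (-1) ^ (i : ℕ) * ((1 / 2 : ℂ) *
    (fderiv ℝ (fun y => u y (i.removeNth v)) z (v i)
      - Complex.I * fderiv ℝ (fun y => u y (i.removeNth v)) z (Complex.I • v i)))

/-- The operator `∂̄ = ∑ⱼ dz̄ⱼ ∧ ∂/∂z̄ⱼ`, as in `delFlat` but with the antilinear part. -/
def delbarFlat (u : Form n (Cn n) k) (z : Cn n) (v : Fin (k + 1) → Cn n) : ℂ :=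
  ∑ i : Fin (k + 1), (-1) ^ (i : ℕ) * ((1 / 2 : ℂ) *
    (fderiv ℝ (fun y => u y (i.removeNth v)) z (v i)
      + Complex.I * fderiv ℝ (fun y => u y (i.removeNth v)) z (Complex.I • v i)))

/-- `IsAeppliExact k θ`: the form `θ` of degree `k` on `M` lies in `im ∂ + im ∂̄`, i.e.
`θ = ∂η + ∂̄ν` for smooth forms `η`, `ν` of degree `k - 1` on `M`. For `θ` of top degree the
bidegrees of `η` and `ν` need not be prescribed: only the `(n-1, n)`-part of `η` contributes
to `∂η`, and only the `(n, n-1)`-part of `ν` to `∂̄ν`. -/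
def IsAeppliExact : (k : ℕ) → Form n M k → Prop
  | 0, θ => θ = 0
  | k + 1, θ => ∃ η ν : Form n M k, IsSmoothFormOn η univ ∧ IsSmoothFormOn ν univ ∧
      ∀ e ∈ IsManifold.maximalAtlas 𝓘(ℂ, Cn n) ω M, ∀ z ∈ e.target, ∀ v : Fin (k + 1) → Cn n,
        pullbackForm e.symm θ z v =
          delFlat (pullbackForm e.symm η) z v + delbarFlat (pullbackForm e.symm ν) z v

end Forms

/-- The Wirtinger derivative `∂/∂z₁` with respect to the first coordinate of `ℂⁿ⁺¹`. -/
def dz1 {n : ℕ} (f : Cn (n + 1) → ℂ) : Cn (n + 1) → ℂ := fun z =>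
  (1 / 2 : ℂ) * (fderiv ℝ f z (Pi.single 0 1) - Complex.I * fderiv ℝ f z (Pi.single 0 Complex.I))

/-- The Wirtinger derivative `∂/∂z̄₁` with respect to the first coordinate of `ℂⁿ⁺¹`. -/
def dz1bar {n : ℕ} (f : Cn (n + 1) → ℂ) : Cn (n + 1) → ℂ := fun z =>
  (1 / 2 : ℂ) * (fderiv ℝ f z (Pi.single 0 1) + Complex.I * fderiv ℝ f z (Pi.single 0 Complex.I))

section Hypersurface

variable {n k : ℕ}
variable {X : Type*} [TopologicalSpace X] [ChartedSpace (Cn (n + 1)) X]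
variable {D : Type*} [TopologicalSpace D] [ChartedSpace (Cn n) D]

/-- A holomorphic chart `(z₁, …, z_d)` of `X` in which the hypersurface `D`, embedded by `ι`, is
given by `z₁ = 0` (the coordinate `z₁` has index `0`). -/
def IsAdaptedChart (ι : D → X) (e : OpenPartialHomeomorph X (Cn (n + 1))) : Prop :=
  e ∈ IsManifold.maximalAtlas 𝓘(ℂ, Cn (n + 1)) ω X ∧
    ∀ x ∈ e.source, x ∈ range ι ↔ e x 0 = 0

/-- `α` is semi-meromorphic with poles along `D` (of any order): it is smooth on `X \ D`, and near
each point of `D` it is `α̃ / z₁ᵐ` for a smooth form `α̃`, where `z₁ = 0` is a local equation of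
`D`. The values of `α` at points of `D` are irrelevant. -/
def IsSemiMeromorphic (ι : D → X) (α : Form (n + 1) X k) : Prop :=
  IsSmoothFormOn α (range ι)ᶜ ∧
    ∀ p : D, ∃ e : OpenPartialHomeomorph X (Cn (n + 1)), IsAdaptedChart ι e ∧ ι p ∈ e.source ∧
      ∃ (m : ℕ) (α' : Form (n + 1) X k), IsSmoothFormOn α' e.source ∧
        ∀ x ∈ e.source, x ∉ range ι → α x = ((e x 0) ^ m)⁻¹ • α' x

/-- The data entering the construction of a representative of the Aeppli residue of `Ω`: finitely
many charts `zⱼ` adapted to `D`, a partition of unity `ρⱼ` subordinate to them, and in each chart an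
expression
`Ω = (dz₁ ∧ dz̄₁) / (z₁ᵐ z̄₁ˡ) ∧ ψ dz₂ ∧ dz̄₂ ∧ ⋯ ∧ dz_d ∧ dz̄_d` with `ψ` smooth and `m, l ≥ 1`. -/
structure ResidueData (ι : D → X) (Ω : Form (n + 1) X (2 * (n + 1))) where
  r : ℕ
  chart : Fin r → OpenPartialHomeomorph X (Cn (n + 1))
  adapted : ∀ j, IsAdaptedChart ι (chart j)
  ρ : SmoothPartitionOfUnity (Fin r) 𝓘(ℝ, Cn (n + 1)) X
  subordinate : ρ.IsSubordinate (fun j => (chart j).source)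
  m : Fin r → ℕ
  l : Fin r → ℕ
  one_le_m : ∀ j, 1 ≤ m j
  one_le_l : ∀ j, 1 ≤ l j
  ψ : Fin r → Cn (n + 1) → ℂ
  smooth : ∀ j, ContDiffOn ℝ ∞ (ψ j) (chart j).target
  eq : ∀ j, ∀ z ∈ (chart j).target, z 0 ≠ 0 →
    pullbackForm (chart j).symm Ω z =
      (ψ j z / ((z 0) ^ m j * (starRingEnd ℂ (z 0)) ^ l j)) • stdForm (n + 1) z

open Classical in
/-- The form
`∑ⱼ 1 / ((m-1)! (l-1)!) ∂^{m+l-2} (ρⱼ ψⱼ) / ∂z₁^{m-1} ∂z̄₁^{l-1} dz₂ ∧ dz̄₂ ∧ ⋯ ∧ dz_d ∧ dz̄_d |_D`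
of degree `2 (d - 1)` on `D`. -/
def ResidueData.form {ι : D → X} {Ω : Form (n + 1) X (2 * (n + 1))} (P : ResidueData ι Ω) :
    Form n D (2 * n) := fun p =>
  ∑ j, if ι p ∈ (P.chart j).source then
    ((1 / (((P.m j - 1).factorial : ℂ) * ((P.l j - 1).factorial : ℂ))) *
      (dz1^[P.m j - 1] (dz1bar^[P.l j - 1]
        (fun z => (P.ρ j ((P.chart j).symm z) : ℂ) * P.ψ j z))) (P.chart j (ι p))) •
      pullbackForm (fun q : D => Fin.tail (P.chart j (ι q))) (stdForm n) p
  else 0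

/-- The form `θ` on `D` represents the Aeppli residue `Res_A(Ω) ∈ H_A^{d-1,d-1}(D)`: modulo
`im ∂ + im ∂̄` it is the residue form of some residue data. (In top degree every form is
`∂∂̄`-closed, and such a `θ` is automatically smooth.) -/
def RepresentsAeppliResidue (ι : D → X) (Ω : Form (n + 1) X (2 * (n + 1)))
    (θ : Form n D (2 * n)) : Prop :=
  ∃ P : ResidueData ι Ω, IsAeppliExact (2 * n) (θ - P.form)

/-- `∫_D Res_A(Ω) = J`: the class `Res_A(Ω)` has representatives, and the integral over `D` of
each one of them equals `J`. -/
def HasAeppliResidueIntegral (ι : D → X) (Ω : Form (n + 1) X (2 * (n + 1))) (J : ℂ) : Prop :=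
  (∃ θ, RepresentsAeppliResidue ι Ω θ) ∧ ∀ θ, RepresentsAeppliResidue ι Ω θ → HasFormIntegral θ J

end Hypersurface

section LineBundle

variable {n : ℕ}
variable {X : Type*} [TopologicalSpace X] [ChartedSpace (Cn (n + 1)) X]
variable (L : X → Type*) [TopologicalSpace (Bundle.TotalSpace ℂ L)] [∀ x, TopologicalSpace (L x)]
  [∀ x, AddCommGroup (L x)] [∀ x, Module ℂ (L x)] [FiberBundle ℂ L] [VectorBundle ℂ ℂ L]

variable (n) in
/-- A smooth (Hermitian) metric on the complex line bundle `L`: a norm on each fibre, such that the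
norms of the local frames are smooth functions. -/
structure LineBundleMetric where
  norm : ∀ x, L x → ℝ
  norm_pos : ∀ x (v : L x), v ≠ 0 → 0 < norm x v
  norm_smul : ∀ x (c : ℂ) (v : L x), norm x (c • v) = ‖c‖ * norm x v
  smooth : ∀ x₀ : X, ContMDiffOn 𝓘(ℝ, Cn (n + 1)) 𝓘(ℝ, ℝ) ∞
    (fun x => norm x ((trivializationAt ℂ L x₀).symm x 1)) (trivializationAt ℂ L x₀).baseSet

variable {L}

/-- The section `s` vanishes along `D` to order exactly `o` at the point `x` of `D`: in an
adapted chart and a local frame it is `z₁ᵒ u` with `u` holomorphic and `u(x) ≠ 0`. -/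
def HasVanishingOrderAt {D : Type*} (ι : D → X) (s : ∀ x, L x) (x : X) (o : ℕ) : Prop :=
  ∃ e : OpenPartialHomeomorph X (Cn (n + 1)), IsAdaptedChart ι e ∧ x ∈ e.source ∧
    ∃ u : X → ℂ, ContMDiffAt 𝓘(ℂ, Cn (n + 1)) 𝓘(ℂ, ℂ) ω u x ∧ u x ≠ 0 ∧
      ∀ᶠ y in 𝓝 x, (trivializationAt ℂ L x (⟨y, s y⟩ : Bundle.TotalSpace ℂ L)).2 =
        (e y 0) ^ o * u y

/-- `F` is the meromorphic continuation to `ℂ` of `λ ↦ ∫_X |s|^{2λ} Ω`, the integral being absolutely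
convergent and holomorphic in `λ` for `Re λ` large. -/
def IsMeromorphicContinuation (h : LineBundleMetric n L) (s : ∀ x, L x)
    (Ω : Form (n + 1) X (2 * (n + 1))) (F : ℂ → ℂ) : Prop :=
  Meromorphic F ∧ ∃ c : ℝ, ∀ t : ℂ, c < t.re → AnalyticAt ℂ F t ∧
    HasFormIntegral (fun x => ((h.norm x (s x) : ℂ) ^ (2 * t)) • Ω x) (F t)

end LineBundle

end

/-! In a chart adapted to `D` one has `|s| = |z₁|ᵒ eᴮ` with `B` smooth, also across `D`. A partition
of unity therefore turns `∫ |s|^{2t} Ω` into a finite sum of integrals over `ℂⁿ⁺¹` of `|z₁|^{2ot}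
z₁^{-m} z̄₁^{-l} G_t(z)`, where `G_t` is smooth with fixed compact support and entire in `t`.

Integrating by parts with `∂/∂z₁` raises the exponent of `z₁` by one at the price of the factor
`-(ot + a + 1)⁻¹`, and likewise for `z̄₁`. Repeating this gives the meromorphic continuation. As
long as both exponents stay at most `-1` the factors are holomorphic at `t = 0` and multiply up to
`1/((m-1)!(l-1)!)`. What remains is `∫ |z₁|^{2ot-2} H_t`. The restriction of `H_t` to `z₁ = 0`
contributes `π/(ot)` times its integral, and the rest is holomorphic near `0`. So the pole is
simple, and at `t = 0` the weight `e^{2tB}` is `1`, so the metric disappears from the residue. Since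
`dz₁ ∧ dz̄₁` is `-2i` times the Lebesgue area form, the constant is `-2πi/o`. This is
`ResidueData.exists_hasPoleContinuation`, resting on `kern_hasPoleContinuation`.

The integral of the residue form does not depend on the data that define it, because any two sets of
data compute the residue at `0` of the same function; a metric on `L` is needed for this, and one
exists. Adding an element of `im ∂ + im ∂̄` changes nothing by Stokes
(`IsAeppliExact.hasFormIntegral_zero`). Residue data exist because two local equations of `D` differ
by a smooth unit, by Hadamard's lemma (`IsAdaptedChart.exists_unit`).

For the constant term, `e^{-2tφ} = 1 - 2tφ + t²φ² E(tφ)` with `E` entire. All three resulting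
integrals have at most simple poles, so the last one does not contribute to `C₀`, and the middle one
contributes `-2` times the residue for `φ Ω`, which is `(4πi/o) ∫_D Res_A(φ Ω)`. -/

noncomputable section

/-! ### Parameter integrals and meromorphic continuation in one complex variable. -/

section Continuation

/-- Holomorphy of an integral depending holomorphically on a parameter, under a local bound on the
integrand only: the derivative is controlled by the Cauchy estimate. -/
lemma analyticAt_integral_of_dominated {A : Type*} [MeasurableSpace A] {μ : Measure A}
    {F : ℂ → A → ℂ} {B : A → ℝ} {t₀ : ℂ} {r : ℝ} (hr : 0 < r)
    (hm : ∀ t ∈ Metric.ball t₀ r, AEStronglyMeasurable (F t) μ)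
    (hd : ∀ᵐ a ∂μ, DifferentiableOn ℂ (fun t => F t a) (Metric.ball t₀ r))
    (hb : ∀ᵐ a ∂μ, ∀ t ∈ Metric.ball t₀ r, ‖F t a‖ ≤ B a)
    (hB : Integrable B μ) :
    AnalyticAt ℂ (fun t => ∫ a, F t a ∂μ) t₀ := by
  have key : DifferentiableOn ℂ (fun t => ∫ a, F t a ∂μ) (Metric.ball t₀ (r / 2)) := by
    intro x hx
    -- Since `r/2 + r/4 + r/8 < r`, discs of radius `r/8` about all the points in use stay in the
    -- domain, and the Cauchy estimate bounds the derivative by `B a / (r / 8)`.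
    have hsub : ∀ y ∈ Metric.ball x (r / 4), Metric.closedBall y (r / 8) ⊆ Metric.ball t₀ r := by
      intro y hy w hw
      simp only [Metric.mem_ball, Metric.mem_closedBall] at *
      linarith [dist_triangle w y t₀, dist_triangle y x t₀]
    have hball : Metric.ball x (r / 4) ⊆ Metric.ball t₀ r := fun y hy =>
      hsub y hy (Metric.mem_closedBall_self (by positivity))
    have hxr : x ∈ Metric.ball t₀ r := hball (Metric.mem_ball_self (by positivity))
    have hder : ∀ᵐ a ∂μ, ∀ y ∈ Metric.ball x (r / 4),
        HasDerivAt (fun t => F t a) (deriv (fun t => F t a) y) y := by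
      filter_upwards [hd] with a ha y hy
      exact (ha.differentiableAt (Metric.isOpen_ball.mem_nhds (hball hy))).hasDerivAt
    -- The derivative is a pointwise limit of difference quotients along a sequence tending to `0`,
    -- hence measurable in `a`.
    have hmeas : AEStronglyMeasurable (fun a => deriv (fun t => F t a) x) μ := by
      let h : ℕ → ℂ := fun k => ((r / 8 * (1 / ((k : ℝ) + 1)) : ℝ) : ℂ)
      have hpos : ∀ k : ℕ, 0 < r / 8 * (1 / ((k : ℝ) + 1)) := fun k => by positivity
      have hlim : Tendsto h atTop (𝓝[≠] 0) := by
        refine tendsto_nhdsWithin_iff.2 ⟨?_, Eventually.of_forall fun k => ?_⟩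
        · have := (tendsto_one_div_add_atTop_nhds_zero_nat (𝕜 := ℝ)).const_mul (r / 8)
          rw [mul_zero] at this
          exact ((Complex.continuous_ofReal.tendsto 0).comp this)
        · simpa [h] using ⟨hr.ne', by exact_mod_cast (Nat.succ_ne_zero k)⟩
      refine aestronglyMeasurable_of_tendsto_ae (u := atTop)
        (f := fun k a => (h k)⁻¹ • (F (x + h k) a - F x a)) (fun k => ?_) ?_
      · suffices hk : x + h k ∈ Metric.ball t₀ r from ((hm _ hk).sub (hm x hxr)).const_smul (h k)⁻¹
        apply hsub x (Metric.mem_ball_self (by positivity))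
        simp only [Metric.mem_closedBall, dist_self_add_left, h, Complex.norm_real]
        rw [Real.norm_of_nonneg (hpos k).le]
        have : 1 / ((k : ℝ) + 1) ≤ 1 := by
          rw [div_le_one (by positivity)]; linarith [Nat.cast_nonneg (α := ℝ) k]
        nlinarith
      · filter_upwards [hder] with a ha
        exact (ha x (Metric.mem_ball_self (by positivity))).tendsto_slope_zero.comp hlim
    have := hasDerivAt_integral_of_dominated_loc_of_deriv_le (μ := μ) (F := F) (x₀ := x)
      (s := Metric.ball x (r / 4)) (bound := fun a => B a / (r / 8))
      (F' := fun y a => deriv (fun t => F t a) y)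
      (Metric.ball_mem_nhds _ (by positivity))
      (by filter_upwards [Metric.ball_mem_nhds x (show 0 < r / 4 by positivity)] with y hy
          exact hm y (hball hy))
      (hB.mono' (hm x hxr) (by filter_upwards [hb] with a ha using ha x hxr))
      hmeas ?_ (hB.div_const _) hder
    · exact this.2.differentiableAt.differentiableWithinAt
    · filter_upwards [hb, hd] with a ha hda y hy
      refine Complex.norm_deriv_le_of_forall_mem_sphere_norm_le (by positivity) ?_
        fun z hz => ha z (hsub y hy (Metric.sphere_subset_closedBall hz))
      refine DifferentiableOn.diffContOnCl (hda.mono ?_)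
      exact (Metric.closure_ball_subset_closedBall).trans (hsub y hy)
  exact key.analyticAt (Metric.ball_mem_nhds _ (by positivity))

/-- The identity theorem for meromorphic functions. -/
lemma MeromorphicOn.eventuallyEq_nhdsNE_of_isPreconnected {F G : ℂ → ℂ} {U : Set ℂ} {x y : ℂ}
    (hF : MeromorphicOn F U) (hG : MeromorphicOn G U) (hU : IsPreconnected U) (hx : x ∈ U)
    (hy : y ∈ U) (h : F =ᶠ[𝓝[≠] x] G) : F =ᶠ[𝓝[≠] y] G := by
  have h0 : meromorphicOrderAt (F - G) x = ⊤ := by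
    rw [meromorphicOrderAt_eq_top_iff]
    filter_upwards [h] with z hz
    simp [hz]
  have h1 : meromorphicOrderAt (F - G) y = ⊤ := by
    by_contra hne
    exact (hF.sub hG).meromorphicOrderAt_ne_top_of_isPreconnected hU hy hx hne h0
  rw [meromorphicOrderAt_eq_top_iff] at h1
  filter_upwards [h1] with z hz
  simpa [sub_eq_zero] using hz

lemma isOpen_lt_re (c : ℝ) : IsOpen {t : ℂ | c < t.re} :=
  isOpen_lt continuous_const Complex.continuous_re

/-- A half plane is connected, so agreement far to the right propagates by the identity theorem.
Only punctured neighbourhoods appear because the value of a meromorphic function at a pole carries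
no information. -/
lemma eventuallyEq_nhdsNE_of_eq_of_large_re {F G : ℂ → ℂ} {c c' : ℝ}
    (hF : MeromorphicOn F {t | c < t.re}) (hG : MeromorphicOn G {t | c < t.re})
    (h : ∀ t : ℂ, c' < t.re → F t = G t) {t : ℂ} (ht : c < t.re) : F =ᶠ[𝓝[≠] t] G := by
  have hx : ((max c c' + 1 : ℝ) : ℂ) ∈ {t : ℂ | c < t.re} := by
    simp only [mem_ofPred_eq, Complex.ofReal_re]; linarith [le_max_left c c']
  refine hF.eventuallyEq_nhdsNE_of_isPreconnected hG (convex_halfSpace_re_gt c).isPreconnected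
    hx ht (eventually_nhdsWithin_of_eventually_nhds ?_)
  have : {t : ℂ | c' < t.re} ∈ 𝓝 ((max c c' + 1 : ℝ) : ℂ) := by
    refine (isOpen_lt_re c').mem_nhds ?_
    simp only [mem_ofPred_eq, Complex.ofReal_re]; linarith [le_max_right c c']
  filter_upwards [this] with t ht using h t ht

/-- Meromorphic continuations to all right half planes glue to one on `ℂ`. -/
lemma exists_meromorphic_of_halfPlanes {f : ℂ → ℂ} {c : ℝ}
    (hf : ∀ t : ℂ, c < t.re → AnalyticAt ℂ f t)
    (h : ∀ n : ℕ, ∃ F : ℂ → ℂ, MeromorphicOn F {t | -(n : ℝ) < t.re} ∧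
      ∃ c' : ℝ, ∀ t : ℂ, c' < t.re → F t = f t) :
    ∃ F : ℂ → ℂ, Meromorphic F ∧ ∀ t : ℂ, c + 1 < t.re → F t = f t := by
  choose G hG c' hc' using h
  -- The half plane used at `t` contains `t` with room to spare, so near `t₀` only finitely many `G
  -- k` occur, each equal to `G N` on a punctured neighbourhood. The switch to `f` is at `c + 1`
  -- rather than `c`: at any `t₀`, either `f` is analytic there or the first branch is not taken
  -- nearby.
  let F : ℂ → ℂ := fun t => if c + 1 < t.re then f t else G (⌈|t.re|⌉₊ + 2) t
  refine ⟨F, fun t₀ => ?_, fun t ht => by simp [F, ht]⟩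
  set N : ℕ := ⌈|t₀.re|⌉₊ + 4 with hN
  have hle : |t₀.re| ≤ ⌈|t₀.re|⌉₊ := Nat.le_ceil _
  have hmem : ∀ n : ℕ, |t₀.re| < n → -(n : ℝ) < t₀.re := fun n hn => by
    linarith [neg_abs_le t₀.re]
  have hNmem : -(N : ℝ) < t₀.re := hmem N (by rw [hN]; push_cast; linarith)
  have h1 : ∀ k ≤ N, ∀ᶠ t in 𝓝[≠] t₀, |t₀.re| < k → G k t = G N t := by
    intro k hk
    by_cases hkt : |t₀.re| < k
    · have hsub : {t : ℂ | -(k : ℝ) < t.re} ⊆ {t : ℂ | -(N : ℝ) < t.re} := fun t ht => by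
        have : (k : ℝ) ≤ N := by exact_mod_cast hk
        simp only [mem_ofPred_eq] at *; linarith
      filter_upwards [eventuallyEq_nhdsNE_of_eq_of_large_re (hG k) ((hG N).mono_set hsub)
        (c' := max (c' k) (c' N)) (fun t ht => by
          rw [hc' k t ((le_max_left _ _).trans_lt ht), hc' N t ((le_max_right _ _).trans_lt ht)])
        (hmem k hkt)] with t ht _ using ht
    · exact Eventually.of_forall fun t h => absurd h hkt
  have h2 : ∀ᶠ t in 𝓝[≠] t₀, c + 1 < t.re → f t = G N t := by
    by_cases hct : c < t₀.re
    · have hcm : max c (-(N : ℝ)) < t₀.re := max_lt hct hNmem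
      filter_upwards [eventuallyEq_nhdsNE_of_eq_of_large_re (F := f) (G := G N)
        (c := max c (-(N : ℝ))) (c' := c' N)
        (fun t ht => (hf t ((le_max_left _ _).trans_lt ht)).meromorphicAt)
        ((hG N).mono_set (by
          intro t ht
          simp only [mem_ofPred_eq] at *
          exact (le_max_right _ _).trans_lt ht))
        (fun t ht => (hc' N t ht).symm) hcm] with t ht _ using ht
    · have : {t : ℂ | t.re < c + 1} ∈ 𝓝 t₀ :=
        (isOpen_lt Complex.continuous_re continuous_const).mem_nhds
          (by simp only [mem_ofPred_eq]; linarith)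
      filter_upwards [mem_nhdsWithin_of_mem_nhds this] with t ht h'
      exact absurd h' (not_lt.2 (le_of_lt ht))
  have h3 : ∀ᶠ t in 𝓝[≠] t₀, ∀ k ∈ Finset.range (N + 1), |t₀.re| < k → G k t = G N t :=
    (Finset.eventually_all _).2 fun k hk => h1 k (by simpa [Nat.lt_succ_iff] using hk)
  have h4 : ∀ᶠ t in 𝓝[≠] t₀, |t.re - t₀.re| < 1 := by
    refine mem_nhdsWithin_of_mem_nhds ((isOpen_lt (by fun_prop) continuous_const).mem_nhds ?_)
    simp
  refine ((hG N) t₀ hNmem).congr ?_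
  filter_upwards [h2, h3, h4] with t ht2 ht3 ht4
  by_cases hct : c + 1 < t.re
  · simp [F, hct, ht2 hct]
  · simp only [F, hct, if_false]
    have ha : |t₀.re| < |t.re| + 1 := by
      have := abs_sub_abs_le_abs_sub t₀.re t.re
      rw [abs_sub_comm] at this
      linarith
    have hb : |t.re| < |t₀.re| + 1 := by
      have := abs_sub_abs_le_abs_sub t.re t₀.re
      linarith
    have hk : |t₀.re| < ((⌈|t.re|⌉₊ + 2 : ℕ) : ℝ) := by
      push_cast; linarith [Nat.le_ceil |t.re|]
    refine (ht3 _ ?_ hk).symm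
    have : ⌈|t.re|⌉₊ ≤ ⌈|t₀.re|⌉₊ + 1 := by
      rw [Nat.ceil_le]; push_cast; linarith
    simp only [Finset.mem_range, hN]; omega

/-- `f`, defined for `Re t` large, is holomorphic there and has a meromorphic continuation to `ℂ`
with at most a simple pole at `0`, of residue `r`. -/
def HasPoleContinuation (f : ℂ → ℂ) (r : ℂ) : Prop :=
  ∃ F R : ℂ → ℂ, Meromorphic F ∧ AnalyticAt ℂ R 0 ∧ R 0 = r ∧
    (∀ᶠ t in 𝓝[≠] (0 : ℂ), F t = R t / t) ∧
    ∃ c : ℝ, ∀ t : ℂ, c < t.re → AnalyticAt ℂ F t ∧ F t = f t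

namespace HasPoleContinuation

variable {f g : ℂ → ℂ} {r r' : ℂ}

lemma congr (hf : HasPoleContinuation f r) {c : ℝ} (h : ∀ t : ℂ, c < t.re → g t = f t) :
    HasPoleContinuation g r := by
  obtain ⟨F, R, hF, hR, hr, h0, c', hc'⟩ := hf
  refine ⟨F, R, hF, hR, hr, h0, max c c', fun t ht => ?_⟩
  rw [h t ((le_max_left _ _).trans_lt ht)]
  exact hc' t ((le_max_right _ _).trans_lt ht)

lemma zero : HasPoleContinuation (fun _ => 0) 0 :=
  ⟨fun _ => 0, fun _ => 0, fun _ => MeromorphicAt.const _ _, analyticAt_const, rfl, by simp, 0,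
    fun _ _ => ⟨analyticAt_const, rfl⟩⟩

lemma add (hf : HasPoleContinuation f r) (hg : HasPoleContinuation g r') :
    HasPoleContinuation (fun t => f t + g t) (r + r') := by
  obtain ⟨F, R, hF, hR, hr, h0, c, hc⟩ := hf
  obtain ⟨G, S, hG, hS, hs, h0', c', hc'⟩ := hg
  refine ⟨fun t => F t + G t, fun t => R t + S t, fun t => (hF t).add (hG t), hR.add hS,
    by simp only [hr, hs], ?_, max c c', fun t ht => ?_⟩
  · filter_upwards [h0, h0'] with t h1 h2
    rw [h1, h2, add_div]
  · obtain ⟨a1, a2⟩ := hc t ((le_max_left _ _).trans_lt ht)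
    obtain ⟨b1, b2⟩ := hc' t ((le_max_right _ _).trans_lt ht)
    exact ⟨a1.add b1, by simp only [a2, b2]⟩

lemma const_mul (hf : HasPoleContinuation f r) (a : ℂ) :
    HasPoleContinuation (fun t => a * f t) (a * r) := by
  obtain ⟨F, R, hF, hR, hr, h0, c, hc⟩ := hf
  refine ⟨fun t => a * F t, fun t => a * R t, fun t => (MeromorphicAt.const a t).mul (hF t),
    analyticAt_const.mul hR, by simp only [hr], ?_, c, fun t ht => ?_⟩
  · filter_upwards [h0] with t h1
    rw [h1, mul_div_assoc]
  · obtain ⟨a1, a2⟩ := hc t ht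
    exact ⟨analyticAt_const.mul a1, by simp only [a2]⟩

lemma sum {ι : Type*} (s : Finset ι) {f : ι → ℂ → ℂ} {r : ι → ℂ}
    (h : ∀ i ∈ s, HasPoleContinuation (f i) (r i)) :
    HasPoleContinuation (fun t => ∑ i ∈ s, f i t) (∑ i ∈ s, r i) := by
  classical
  induction s using Finset.induction_on with
  | empty => simpa using zero
  | insert a s ha ih =>
    simp only [Finset.sum_insert ha]
    exact (h a (Finset.mem_insert_self a s)).add
      (ih fun i hi => h i (Finset.mem_insert_of_mem hi))

end HasPoleContinuation

lemma meromorphic_eventuallyEq_zero {F G : ℂ → ℂ} (hF : Meromorphic F) (hG : Meromorphic G)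
    {c : ℝ} (h : ∀ t : ℂ, c < t.re → F t = G t) : F =ᶠ[𝓝[≠] (0 : ℂ)] G :=
  eventuallyEq_nhdsNE_of_eq_of_large_re (c := -1) (fun t _ => hF t) (fun t _ => hG t) h (by simp)

lemma AnalyticAt.eventuallyEq_of_nhdsNE {R S : ℂ → ℂ} {x : ℂ} (hR : AnalyticAt ℂ R x)
    (hS : AnalyticAt ℂ S x) (h : R =ᶠ[𝓝[≠] x] S) : R =ᶠ[𝓝 x] S :=
  (hR.frequently_eq_iff_eventually_eq hS).1 h.frequently

/-- The residue is determined by the integral for large `Re t` alone. Independence of the residue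
integral from charts, partition of unity and exponents comes from here. -/
lemma HasPoleContinuation.unique {f : ℂ → ℂ} {r r' : ℂ} (h : HasPoleContinuation f r)
    (h' : HasPoleContinuation f r') : r = r' := by
  obtain ⟨F, R, hF, hR, hr, h0, c, hc⟩ := h
  obtain ⟨G, S, hG, hS, hs, h0', c', hc'⟩ := h'
  have h1 : F =ᶠ[𝓝[≠] (0 : ℂ)] G := meromorphic_eventuallyEq_zero hF hG (c := max c c')
    fun t ht => by rw [(hc t ((le_max_left _ _).trans_lt ht)).2,
      (hc' t ((le_max_right _ _).trans_lt ht)).2]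
  have h2 : R =ᶠ[𝓝[≠] (0 : ℂ)] S := by
    filter_upwards [h1, h0, h0', self_mem_nhdsWithin] with t a b d (ht : t ≠ 0)
    rw [b, d] at a
    exact (div_left_inj' ht).1 a
  rw [← hr, ← hs]
  exact (hR.eventuallyEq_of_nhdsNE hS h2).self_of_nhds

end Continuation

/-! ### Convergence of the model integrals `∫ |z₁|^{2ot} z₁^a z̄₁^b G_t`. -/

section LocalAnalysis

variable {n : ℕ}

/-- A family `G_t`, `t ∈ ℂ`, of smooth functions on `ℂⁿ⁺¹` with supports in a fixed compact set,
depending smoothly on all variables and holomorphically on `t`. -/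
structure IsHolFamily (G : ℂ → Cn (n + 1) → ℂ) : Prop where
  smooth : ContDiff ℝ ∞ (fun p : ℂ × Cn (n + 1) => G p.1 p.2)
  hol : ∀ z, Differentiable ℂ (fun t => G t z)
  supp : ∃ K : Set (Cn (n + 1)), IsCompact K ∧ ∀ t, ∀ z ∉ K, G t z = 0

namespace IsHolFamily

variable {G : ℂ → Cn (n + 1) → ℂ}

lemma contDiff_apply (hG : IsHolFamily G) (t : ℂ) : ContDiff ℝ ∞ (G t) :=
  hG.smooth.comp (contDiff_const.prodMk contDiff_id)

lemma smooth_fderiv (hG : IsHolFamily G) (v : Cn (n + 1)) :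
    ContDiff ℝ ∞ (fun p : ℂ × Cn (n + 1) => fderiv ℝ (G p.1) p.2 v) := by
  have h : ContDiff ℝ ∞ (fun p : ℂ × Cn (n + 1) => fderiv ℝ (G p.1) p.2) := by
    refine ContDiff.fderiv (f := fun (p : ℂ × Cn (n + 1)) z => G p.1 z) (m := ∞) (n := ∞)
      (g := fun p => p.2) ?_ contDiff_snd (by simp)
    exact hG.smooth.comp ((contDiff_fst.comp contDiff_fst).prodMk contDiff_snd)
  exact h.clm_apply contDiff_const

/-- Holomorphy in `t` is the Cauchy–Riemann equation, saying that the derivative in the direction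
`i` is `i` times the one in the direction `1`. Differentiating it in `z` and exchanging the second
derivatives shows that `z`-derivatives satisfy it too. -/
lemma hol_fderiv (hG : IsHolFamily G) (v z : Cn (n + 1)) :
    Differentiable ℂ (fun t => fderiv ℝ (G t) z v) := by
  set g : ℂ × Cn (n + 1) → ℂ := fun p => G p.1 p.2 with hg
  have hgd : Differentiable ℝ g := hG.smooth.differentiable (by simp)
  have hgd2 : Differentiable ℝ (fderiv ℝ g) :=
    (hG.smooth.fderiv_right (m := 1) (by norm_cast)).differentiable (by simp)
  have h1 : ∀ t z, fderiv ℝ (G t) z v = fderiv ℝ g (t, z) (0, v) := by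
    intro t z
    have := (hgd (t, z)).hasFDerivAt.comp z ((hasFDerivAt_prodMk_right (𝕜 := ℝ) t z))
    have h' : HasFDerivAt (G t) _ z := this
    rw [h'.fderiv]; simp
  have h2 : ∀ t z τ, fderiv ℝ g (t, z) (τ, 0) = τ * deriv (fun t => G t z) t := by
    intro t z τ
    have := (hgd (t, z)).hasFDerivAt.comp t ((hasFDerivAt_prodMk_left (𝕜 := ℝ) t z))
    have h' : HasFDerivAt (fun t => G t z) _ t := this
    have h'' := ((hG.hol z) t).hasDerivAt.hasFDerivAt.restrictScalars ℝ
    have := congrArg (fun L : ℂ →L[ℝ] ℂ => L τ) (h'.unique h'')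
    simpa using this
  intro t
  have hsymm : ∀ x y, fderiv ℝ (fderiv ℝ g) (t, z) x y = fderiv ℝ (fderiv ℝ g) (t, z) y x :=
    fun x y => second_derivative_symmetric (f := g) (fun y => (hgd y).hasFDerivAt)
      (hgd2 (t, z)).hasFDerivAt x y
  have h3 : HasFDerivAt (fun t => fderiv ℝ (G t) z v)
      ((ContinuousLinearMap.apply ℝ ℂ ((0 : ℂ), v)).comp ((fderiv ℝ (fderiv ℝ g) (t, z)).comp
        (ContinuousLinearMap.inl ℝ ℂ (Cn (n + 1))))) t := by
    have : HasFDerivAt (fun t => fderiv ℝ g (t, z)) _ t :=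
      (hgd2 (t, z)).hasFDerivAt.comp t ((hasFDerivAt_prodMk_left (𝕜 := ℝ) t z))
    simp_rw [h1]
    exact (ContinuousLinearMap.apply ℝ ℂ ((0 : ℂ), v)).hasFDerivAt.comp t this
  have h4 : ∀ τ, HasFDerivAt (fun z => fderiv ℝ g (t, z) (τ, 0))
      ((ContinuousLinearMap.apply ℝ ℂ (τ, (0 : Cn (n + 1)))).comp
        ((fderiv ℝ (fderiv ℝ g) (t, z)).comp (ContinuousLinearMap.inr ℝ ℂ (Cn (n + 1))))) z := by
    intro τ
    have : HasFDerivAt (fun z => fderiv ℝ g (t, z)) _ z :=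
      (hgd2 (t, z)).hasFDerivAt.comp z ((hasFDerivAt_prodMk_right (𝕜 := ℝ) t z))
    exact (ContinuousLinearMap.apply ℝ ℂ (τ, (0 : Cn (n + 1)))).hasFDerivAt.comp z this
  have h5 : fderiv ℝ (fderiv ℝ g) (t, z) (Complex.I, 0) (0, v) =
      Complex.I * fderiv ℝ (fderiv ℝ g) (t, z) (1, 0) (0, v) := by
    rw [hsymm, hsymm (1, 0)]
    have e1 := (h4 Complex.I).fderiv
    have e2 := (h4 1).fderiv
    have e3 : (fun z => fderiv ℝ g (t, z) (Complex.I, 0)) =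
        fun z => Complex.I • fderiv ℝ g (t, z) (1, 0) := by
      ext z; rw [h2, h2]; simp
    have e4 := congrArg (fun L : Cn (n + 1) →L[ℝ] ℂ => L v) e1
    have e5 := congrArg (fun L : Cn (n + 1) →L[ℝ] ℂ => L v) e2
    rw [e3, fderiv_fun_const_smul (h4 1).differentiableAt] at e4
    simp only [_root_.smul_apply, ContinuousLinearMap.comp_apply,
      ContinuousLinearMap.inr_apply, ContinuousLinearMap.apply_apply, smul_eq_mul] at e4 e5
    rw [← e4, ← e5]
  rw [differentiableAt_complex_iff_differentiableAt_real]
  refine ⟨h3.differentiableAt, ?_⟩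
  rw [h3.fderiv]
  simpa using h5

lemma fderiv_eq_zero {K : Set (Cn (n + 1))} (hK : IsCompact K)
    (h : ∀ t, ∀ z ∉ K, G t z = 0) (t : ℂ) {z : Cn (n + 1)} (hz : z ∉ K) :
    fderiv ℝ (G t) z = 0 := by
  have : G t =ᶠ[𝓝 z] fun _ => 0 := by
    filter_upwards [hK.isClosed.isOpen_compl.mem_nhds hz] with y hy using h t y hy
  rw [this.fderiv_eq]; simp

lemma dz1 (hG : IsHolFamily G) : IsHolFamily (fun t => dz1 (G t)) where
  smooth := contDiff_const.mul ((hG.smooth_fderiv _).sub (contDiff_const.mul (hG.smooth_fderiv _)))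
  hol z := ((hG.hol_fderiv _ z).sub ((hG.hol_fderiv _ z).const_mul _)).const_mul _
  supp := by
    obtain ⟨K, hK, h⟩ := hG.supp
    exact ⟨K, hK, fun t z hz => by simp [_root_.dz1, fderiv_eq_zero hK h t hz]⟩

lemma dz1bar (hG : IsHolFamily G) : IsHolFamily (fun t => dz1bar (G t)) where
  smooth := contDiff_const.mul ((hG.smooth_fderiv _).add (contDiff_const.mul (hG.smooth_fderiv _)))
  hol z := ((hG.hol_fderiv _ z).add ((hG.hol_fderiv _ z).const_mul _)).const_mul _
  supp := by
    obtain ⟨K, hK, h⟩ := hG.supp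
    exact ⟨K, hK, fun t z hz => by simp [_root_.dz1bar, fderiv_eq_zero hK h t hz]⟩

lemma exists_bound (hG : IsHolFamily G) (t₀ : ℂ) (r : ℝ) :
    ∃ C R : ℝ, 0 ≤ C ∧ 0 < R ∧ (∀ t, ∀ z, R < ‖z‖ → G t z = 0) ∧
      ∀ t ∈ Metric.closedBall t₀ r, ∀ z, ‖G t z‖ ≤ C := by
  obtain ⟨K, hK, h⟩ := hG.supp
  obtain ⟨R, hR, hKR⟩ := hK.isBounded.exists_pos_norm_le
  obtain ⟨C, hC⟩ := ((isCompact_closedBall t₀ r).prod hK).exists_bound_of_continuousOn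
    (f := fun p : ℂ × Cn (n + 1) => G p.1 p.2) hG.smooth.continuous.continuousOn
  refine ⟨max C 0, R, le_max_right _ _, hR, fun t z hz => h t z fun hzK => ?_, fun t ht z => ?_⟩
  · linarith [hKR z hzK]
  · by_cases hz : z ∈ K
    · exact (hC (t, z) ⟨ht, hz⟩).trans (le_max_left _ _)
    · simp [h t z hz]

end IsHolFamily

/-- The kernel `|z|^{2ot} z^a z̄^b`. -/
def kern (o : ℕ) (a b : ℤ) (t z : ℂ) : ℂ :=
  (‖z‖ : ℂ) ^ (2 * (o : ℂ) * t) * z ^ a * (starRingEnd ℂ z) ^ b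

lemma norm_kern (o : ℕ) (a b : ℤ) (t : ℂ) {z : ℂ} (hz : z ≠ 0) :
    ‖kern o a b t z‖ = ‖z‖ ^ (2 * o * t.re + a + b) := by
  have h0 : 0 < ‖z‖ := norm_pos_iff.2 hz
  rw [kern, norm_mul, norm_mul, Complex.norm_cpow_eq_rpow_re_of_pos h0, norm_zpow, norm_zpow,
    RCLike.norm_conj, Real.rpow_add h0, Real.rpow_add h0, Real.rpow_intCast, Real.rpow_intCast]
  congr 3
  simp

lemma measurable_kern (o : ℕ) (a b : ℤ) (t : ℂ) : Measurable (kern o a b t) := by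
  unfold kern
  have h1 : Measurable fun z : ℂ => (‖z‖ : ℂ) ^ (2 * (o : ℂ) * t) :=
    (Complex.measurable_ofReal.comp measurable_norm).pow_const _
  have h2 : Measurable fun z : ℂ => z ^ a := measurable_id.pow_const a
  have h3 : Measurable fun z : ℂ => (starRingEnd ℂ z) ^ b :=
    (Complex.continuous_conj.measurable).pow_const b
  exact (h1.mul h2).mul h3

lemma differentiable_kern (o : ℕ) (a b : ℤ) {z : ℂ} (hz : z ≠ 0) :
    Differentiable ℂ (fun t => kern o a b t z) := by
  unfold kern
  intro t
  have : DifferentiableAt ℂ (fun t : ℂ => (‖z‖ : ℂ) ^ (2 * (o : ℂ) * t)) t :=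
    DifferentiableAt.const_cpow (by fun_prop) (Or.inl (by simpa using hz))
  exact (this.mul_const _).mul_const _

lemma ae_ne_zero (n : ℕ) : ∀ᵐ z : Cn (n + 1), z 0 ≠ 0 := by
  have : volume {z : Cn (n + 1) | z 0 = 0} = 0 :=
    Measure.pi_hyperplane (fun _ : Fin (n + 1) => (volume : Measure ℂ)) 0 0
  exact measure_eq_zero_iff_ae_notMem.1 this

/-- Polar coordinates in the plane contribute one power of the radius, which is why the threshold is
`-2`. -/
lemma integrable_indicator_norm_rpow {p : ℝ} (hp : -2 < p) (R : ℝ) :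
    Integrable ((Metric.ball (0 : ℂ) R).indicator fun z => ‖z‖ ^ p) := by
  rw [integrable_indicator_iff Metric.isOpen_ball.measurableSet,
    integrableOn_fun_norm_addHaar (μ := (volume : Measure ℂ)) (f := fun y => y ^ p)]
  have h : IntegrableOn (fun y : ℝ => y ^ (p + 1)) (Ioo 0 R) := by
    rcases le_or_gt R 0 with h | h
    · simp [Ioo_eq_empty (not_lt.2 h)]
    · have := (intervalIntegral.intervalIntegrable_rpow' (a := 0) (b := R)
        (show -1 < p + 1 by linarith)).1
      exact this.mono_set Ioo_subset_Ioc_self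
  refine h.congr_fun (fun y hy => ?_) measurableSet_Ioo
  have : Module.finrank ℝ ℂ - 1 = 1 := by rw [Complex.finrank_real_complex]
  beta_reduce
  rw [this, pow_one, smul_eq_mul, Real.rpow_add hy.1, Real.rpow_one, mul_comm]

/-- The norm of `Cn` is the sup norm, so the ball is a product of discs and the function splits into
one-variable factors. -/
lemma integrable_norm_rpow_bounded {p : ℝ} (hp : -2 < p) (R : ℝ) :
    Integrable (fun z : Cn (n + 1) => (Metric.ball (0 : Cn (n + 1)) R).indicator
      (fun z => ‖z 0‖ ^ p) z) := by
  rcases le_or_gt R 0 with hR | hR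
  · simp [Metric.ball_eq_empty.2 hR]
  have h : ∀ i : Fin (n + 1), Integrable ((Metric.ball (0 : ℂ) R).indicator
      (fun z => if i = 0 then ‖z‖ ^ p else 1)) := by
    intro i
    by_cases hi : i = 0
    · simpa [hi] using integrable_indicator_norm_rpow hp R
    · simp only [hi, if_false]
      rw [integrable_indicator_iff Metric.isOpen_ball.measurableSet]
      exact integrableOn_const Metric.isBounded_ball.measure_lt_top.ne
  refine (Integrable.fintype_prod h).congr (Eventually.of_forall fun z => ?_)
  by_cases hz : z ∈ Metric.ball (0 : Cn (n + 1)) R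
  · have hzi : ∀ i, z i ∈ Metric.ball (0 : ℂ) R := by
      intro i
      simp only [mem_ball_zero_iff] at hz ⊢
      exact (norm_le_pi_norm z i).trans_lt hz
    beta_reduce
    rw [indicator_of_mem hz]
    simp only [indicator_of_mem (hzi _)]
    simp
  · beta_reduce
    rw [indicator_of_notMem hz]
    have : ∃ i, z i ∉ Metric.ball (0 : ℂ) R := by
      by_contra! hall
      simp only [mem_ball_zero_iff] at hz hall
      exact hz ((pi_norm_lt_iff hR).2 hall)
    obtain ⟨i, hi⟩ := this
    exact Finset.prod_eq_zero (Finset.mem_univ i) (indicator_of_notMem hi _)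

/-- Convergence and holomorphy of `∫ |z₁|^{2ot} z₁^a z̄₁^b H_t(z)` as long as the integrand is
dominated by an integrable power of `|z₁|`. -/
lemma kern_integral_analyticAt (o : ℕ) (a b : ℤ) (q : ℕ) {H : ℂ → Cn (n + 1) → ℂ}
    {t₀ : ℂ} {C R : ℝ} (hC : 0 ≤ C) (hm : ∀ t, Measurable (H t))
    (hd : ∀ z, Differentiable ℂ fun t => H t z)
    (hs : ∀ t, ∀ z, R < ‖z‖ → H t z = 0)
    (hb : ∀ t ∈ Metric.closedBall t₀ 1, ∀ z, ‖H t z‖ ≤ C * ‖z 0‖ ^ q)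
    (h : -2 < 2 * o * t₀.re + a + b + q) :
    Integrable (fun z => kern o a b t₀ (z 0) * H t₀ z) ∧
      AnalyticAt ℂ (fun t => ∫ z, kern o a b t (z 0) * H t z) t₀ := by
  set x₀ : ℝ := 2 * o * t₀.re + a + b + q with hx₀
  -- On this disc the exponent of `|z₁|` moves by at most half of its distance `x₀ + 2` to the
  -- threshold `-2`. The bound `1` keeps `t` where `hb` applies.
  set δ : ℝ := min 1 ((x₀ + 2) / (4 * (o + 1))) with hδ
  have ho : (0 : ℝ) < o + 1 := by positivity
  have hδ0 : 0 < δ := lt_min one_pos (div_pos (by linarith) (by positivity))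
  have hδ1 : 2 * o * δ ≤ (x₀ + 2) / 2 := by
    have h1 : δ ≤ (x₀ + 2) / (4 * (o + 1)) := min_le_right _ _
    rw [le_div_iff₀ (by positivity)] at h1
    nlinarith [Nat.cast_nonneg (α := ℝ) o]
  set p₁ : ℝ := x₀ - (x₀ + 2) / 2
  set p₂ : ℝ := x₀ + (x₀ + 2) / 2
  -- Two powers are needed: the smaller exponent dominates where `|z₁| ≤ 1`, the larger one where
  -- `|z₁| ≥ 1`.
  let B : Cn (n + 1) → ℝ := fun z =>
    C * ((Metric.ball (0 : Cn (n + 1)) (R + 1)).indicator (fun z => ‖z 0‖ ^ p₁) z +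
      (Metric.ball (0 : Cn (n + 1)) (R + 1)).indicator (fun z => ‖z 0‖ ^ p₂) z)
  have hB : Integrable B := ((integrable_norm_rpow_bounded (by simp only [p₁]; linarith) _).add
    (integrable_norm_rpow_bounded (by simp only [p₂]; linarith) _)).const_mul C
  have hmeas : ∀ t, Measurable fun z : Cn (n + 1) => kern o a b t (z 0) * H t z := fun t =>
    ((measurable_kern o a b t).comp (measurable_pi_apply 0)).mul (hm t)
  have hbound : ∀ᵐ z : Cn (n + 1), ∀ t ∈ Metric.ball t₀ δ,
      ‖kern o a b t (z 0) * H t z‖ ≤ B z := by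
    filter_upwards [ae_ne_zero n] with z hz t ht
    have hz0 : 0 < ‖z 0‖ := norm_pos_iff.2 hz
    by_cases hzR : R < ‖z‖
    · rw [hs t z hzR, mul_zero, norm_zero]
      refine mul_nonneg hC (add_nonneg ?_ ?_) <;>
      exact indicator_nonneg (fun y _ => Real.rpow_nonneg (norm_nonneg _) _) _
    have hzB : z ∈ Metric.ball (0 : Cn (n + 1)) (R + 1) := by
      rw [mem_ball_zero_iff]; linarith [not_lt.1 hzR]
    have hre : |t.re - t₀.re| ≤ δ := by
      have h1 := Complex.abs_re_le_norm (t - t₀)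
      rw [Metric.mem_ball, dist_eq_norm] at ht
      rw [Complex.sub_re] at h1
      linarith
    rw [abs_le] at hre
    have ho' : (0 : ℝ) ≤ 2 * o := by positivity
    have hx1 : p₁ ≤ 2 * o * t.re + a + b + q := by
      simp only [p₁, hx₀] at *; nlinarith [mul_le_mul_of_nonneg_left hre.1 ho']
    have hx2 : 2 * o * t.re + a + b + q ≤ p₂ := by
      simp only [p₂, hx₀] at *; nlinarith [mul_le_mul_of_nonneg_left hre.2 ho']
    simp only [B, indicator_of_mem hzB]
    rw [norm_mul, norm_kern o a b t hz]
    have h1 := hb t (Metric.ball_subset_closedBall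
      (Metric.ball_subset_ball (min_le_left _ _) ht)) z
    calc ‖z 0‖ ^ (2 * o * t.re + a + b) * ‖H t z‖
        ≤ ‖z 0‖ ^ (2 * o * t.re + a + b) * (C * ‖z 0‖ ^ q) :=
          mul_le_mul_of_nonneg_left h1 (Real.rpow_nonneg hz0.le _)
      _ = C * ‖z 0‖ ^ (2 * o * t.re + a + b + q) := by
          rw [Real.rpow_add hz0 _ (q : ℝ), Real.rpow_natCast]; ring
      _ ≤ _ := by
          refine mul_le_mul_of_nonneg_left ?_ hC
          rcases le_total ‖z 0‖ 1 with h1 | h1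
          · exact (Real.rpow_le_rpow_of_exponent_ge hz0 h1 hx1).trans
              (le_add_of_nonneg_right (Real.rpow_nonneg hz0.le _))
          · exact (Real.rpow_le_rpow_of_exponent_le h1 hx2).trans
              (le_add_of_nonneg_left (Real.rpow_nonneg hz0.le _))
  refine ⟨hB.mono' (hmeas t₀).aestronglyMeasurable ?_, ?_⟩
  · filter_upwards [hbound] with z hz using hz t₀ (Metric.mem_ball_self hδ0)
  · refine analyticAt_integral_of_dominated hδ0 (fun t _ => (hmeas t).aestronglyMeasurable)
      ?_ hbound hB
    filter_upwards [ae_ne_zero n] with z hz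
    exact ((differentiable_kern o a b hz).mul (hd z)).differentiableOn

lemma IsHolFamily.kern_integral {G : ℂ → Cn (n + 1) → ℂ} (hG : IsHolFamily G) (o : ℕ) (a b : ℤ)
    {t : ℂ} (h : -2 < 2 * o * t.re + a + b) :
    Integrable (fun z => kern o a b t (z 0) * G t z) ∧
      AnalyticAt ℂ (fun t => ∫ z, kern o a b t (z 0) * G t z) t := by
  obtain ⟨C, R, hC, -, hs, hb⟩ := hG.exists_bound t 1
  exact kern_integral_analyticAt o a b 0 hC (fun t => (hG.contDiff_apply t).continuous.measurable)
    hG.hol hs (by simpa using hb) (by simpa using h)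

end LocalAnalysis

/-! ### Integration by parts and continuation to half planes. -/

section LocalAnalysis

variable {n : ℕ}

/-- Written as a power of `z z̄`, which is positive and so lies in the slit plane, the kernel can be
differentiated in `z` and `z̄` by the power rule. -/
lemma kern_eq_cpow (o : ℕ) (a b : ℤ) (t : ℂ) {z : ℂ} (hz : z ≠ 0) :
    kern o a b t z = (z * starRingEnd ℂ z) ^ ((o : ℂ) * t) * z ^ a * (starRingEnd ℂ z) ^ b := by
  have h0 : (‖z‖ : ℂ) ≠ 0 := by simpa using hz
  rw [kern, Complex.mul_conj', sq,
    Complex.mul_cpow_ofReal_nonneg (norm_nonneg _) (norm_nonneg _), ← Complex.cpow_add _ _ h0]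
  congr 3
  ring

lemma kern_zero (o : ℕ) (a b : ℤ) {t : ℂ} (h : (o : ℂ) * t ≠ 0) : kern o a b t 0 = 0 := by
  rw [kern, norm_zero, Complex.ofReal_zero, Complex.zero_cpow, zero_mul, zero_mul]
  rw [mul_assoc]
  exact mul_ne_zero two_ne_zero h

/-- With total exponent above `1` the kernel is `o(|z|)` at the origin, so it is differentiable
there as well, with derivative `0`. Integration by parts then has no boundary term along `z₁ = 0`.
The condition on `o t` excludes the convention `0 ^ 0 = 1`. -/
lemma kern_hasFDerivAt (o : ℕ) (a b : ℤ) {t : ℂ} (h0 : (o : ℂ) * t ≠ 0)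
    (h : 1 < 2 * o * t.re + a + b) (z : ℂ) :
    HasFDerivAt (𝕜 := ℝ) (kern o a b t)
      ((((o : ℂ) * t + a) * kern o (a - 1) b t z) • ContinuousLinearMap.id ℝ ℂ +
        (((o : ℂ) * t + b) * kern o a (b - 1) t z) • (Complex.conjCLE : ℂ →L[ℝ] ℂ)) z := by
  by_cases hz : z = 0
  · subst hz
    suffices hs : HasFDerivAt (𝕜 := ℝ) (kern o a b t) (0 : ℂ →L[ℝ] ℂ) 0 by
      refine hs.congr_fderiv ?_
      ext w; simp [kern_zero o _ _ h0]
    refine HasFDerivAt.of_isLittleO ?_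
    simp only [kern_zero o a b h0, _root_.zero_apply, sub_zero]
    have h1 : (kern o a b t) =O[𝓝 0] fun z : ℂ => ‖z‖ ^ (2 * o * t.re + a + b) := by
      refine IsBigO.of_bound 1 (Eventually.of_forall fun z => ?_)
      by_cases hz : z = 0
      · subst hz
        simp only [kern_zero o a b h0, norm_zero]; positivity
      · rw [norm_kern o a b t hz, one_mul, Real.norm_of_nonneg (by positivity)]
    refine h1.trans_isLittleO ?_
    have h2 : (fun z : ℂ => ‖z‖ ^ (2 * o * t.re + a + b)) =
        fun z : ℂ => ‖z‖ * ‖z‖ ^ (2 * o * t.re + a + b - 1) := by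
      ext z
      have := Real.rpow_add' (norm_nonneg z) (y := 1) (z := 2 * o * t.re + a + b - 1)
        (by intro h; linarith)
      rw [Real.rpow_one] at this
      rw [← this]; congr 1; ring
    rw [h2]
    have h3 : Tendsto (fun z : ℂ => ‖z‖ ^ (2 * o * t.re + a + b - 1)) (𝓝 0) (𝓝 0) := by
      have hc : ContinuousAt (fun z : ℂ => ‖z‖ ^ (2 * o * t.re + a + b - 1)) 0 :=
        (continuous_norm.continuousAt).rpow_const (Or.inr (by linarith))
      have := hc.tendsto
      rwa [norm_zero, Real.zero_rpow (by linarith)] at this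
    have h4 := (isBigO_refl (fun z : ℂ => ‖z‖) (𝓝 0)).mul_isLittleO
      ((isLittleO_one_iff ℝ).2 h3)
    simp only [mul_one] at h4
    exact h4.trans_isBigO (isBigO_norm_left.2 (isBigO_refl _ _))
  · have hcz : starRingEnd ℂ z ≠ 0 := by simpa using hz
    set c : ℂ := (o : ℂ) * t
    have hid : HasFDerivAt (𝕜 := ℝ) (fun w : ℂ => w) (ContinuousLinearMap.id ℝ ℂ) z :=
      hasFDerivAt_id z
    have hconj : HasFDerivAt (𝕜 := ℝ) (fun w : ℂ => starRingEnd ℂ w)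
        (Complex.conjCLE : ℂ →L[ℝ] ℂ) z := (Complex.conjCLE : ℂ →L[ℝ] ℂ).hasFDerivAt
    have hp : z * starRingEnd ℂ z ∈ Complex.slitPlane := by
      rw [Complex.mul_conj]
      left
      simpa using Complex.normSq_pos.2 hz
    have h1 := hid.mul hconj
    have h2' := (((hasDerivAt_id' (z * starRingEnd ℂ z)).cpow_const
        (c := c) hp).hasFDerivAt.restrictScalars ℝ).comp z h1
    have h2 : HasFDerivAt (𝕜 := ℝ) (fun w : ℂ => (w * starRingEnd ℂ w) ^ c) _ z := h2'
    have h3 : HasFDerivAt (𝕜 := ℝ) (fun w : ℂ => w ^ a) _ z :=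
      (hasDerivAt_zpow a z (Or.inl hz)).hasFDerivAt.restrictScalars ℝ
    have h4 : HasFDerivAt (𝕜 := ℝ) (fun w : ℂ => (starRingEnd ℂ w) ^ b) _ z :=
      ((hasDerivAt_zpow b (starRingEnd ℂ z) (Or.inl hcz)).hasFDerivAt.restrictScalars ℝ).comp z
        hconj
    have h5 := (h2.mul h3).mul h4
    have h6 : kern o a b t =ᶠ[𝓝 z] fun w =>
        (w * starRingEnd ℂ w) ^ c * w ^ a * (starRingEnd ℂ w) ^ b := by
      filter_upwards [isOpen_ne.mem_nhds hz] with w hw using kern_eq_cpow o a b t hw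
    refine (h5.congr_of_eventuallyEq h6).congr_fderiv ?_
    ext w
    rw [kern_eq_cpow _ _ _ _ hz, kern_eq_cpow _ _ _ _ hz]
    have e1 : (z * starRingEnd ℂ z) ^ (c - 1) =
        (z * starRingEnd ℂ z) ^ c / (z * starRingEnd ℂ z) := by
      rw [Complex.cpow_sub _ _ (mul_ne_zero hz hcz), Complex.cpow_one]
    simp [e1, zpow_sub_one₀ hz, zpow_sub_one₀ hcz]
    field_simp
    ring

/-- Integration by parts in the first variable. -/
lemma kern_integral_by_parts {G : ℂ → Cn (n + 1) → ℂ} (hG : IsHolFamily G) (o : ℕ) (a b : ℤ)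
    {t : ℂ} (h0 : (o : ℂ) * t ≠ 0) (h : 1 < 2 * o * t.re + a + b) :
    (((o : ℂ) * t + a) * ∫ z, kern o (a - 1) b t (z 0) * G t z =
      -∫ z, kern o a b t (z 0) * dz1 (G t) z) ∧
    (((o : ℂ) * t + b) * ∫ z, kern o a (b - 1) t (z 0) * G t z =
      -∫ z, kern o a b t (z 0) * dz1bar (G t) z) := by
  have hi := (hG.kern_integral o a b (t := t) (by linarith)).1
  have hi1 := (hG.kern_integral o (a - 1) b (t := t) (by push_cast; linarith)).1
  have hi2 := (hG.kern_integral o a (b - 1) (t := t) (by push_cast; linarith)).1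
  have hGd : Differentiable ℝ (G t) := (hG.contDiff_apply t).differentiable (by simp)
  have hk : ∀ z : Cn (n + 1), HasFDerivAt (𝕜 := ℝ) (fun z : Cn (n + 1) => kern o a b t (z 0))
      (((((o : ℂ) * t + a) * kern o (a - 1) b t (z 0)) • ContinuousLinearMap.id ℝ ℂ +
        (((o : ℂ) * t + b) * kern o a (b - 1) t (z 0)) • (Complex.conjCLE : ℂ →L[ℝ] ℂ)).comp
        (ContinuousLinearMap.proj (R := ℝ) 0)) z := fun z =>
    HasFDerivAt.comp (g := kern o a b t) (f := fun z : Cn (n + 1) => z 0) z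
      (kern_hasFDerivAt o a b h0 h (z 0))
      (ContinuousLinearMap.proj (R := ℝ) (φ := fun _ : Fin (n + 1) => ℂ) 0).hasFDerivAt
  have hib : ∀ v : Cn (n + 1), Integrable
      (fun z => kern o a b t (z 0) * fderiv ℝ (G t) z v) := by
    intro v
    have hF : IsHolFamily (fun t z => fderiv ℝ (G t) z v) :=
      ⟨hG.smooth_fderiv v, hG.hol_fderiv v, by
        obtain ⟨K, hK, h⟩ := hG.supp
        exact ⟨K, hK, fun t z hz => by simp [IsHolFamily.fderiv_eq_zero hK h t hz]⟩⟩
    exact (hF.kern_integral o a b (t := t) (by linarith)).1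
  have key : ∀ c : ℂ, ∫ z, kern o a b t (z 0) * fderiv ℝ (G t) z (Pi.single 0 c) =
      -(((o : ℂ) * t + a) * c * ∫ z, kern o (a - 1) b t (z 0) * G t z) -
        (((o : ℂ) * t + b) * starRingEnd ℂ c * ∫ z, kern o a (b - 1) t (z 0) * G t z) := by
    intro c
    have e : ∀ z : Cn (n + 1), fderiv ℝ (fun z : Cn (n + 1) => kern o a b t (z 0)) z
        (Pi.single 0 c) * G t z =
        ((o : ℂ) * t + a) * c * (kern o (a - 1) b t (z 0) * G t z) +
        ((o : ℂ) * t + b) * starRingEnd ℂ c * (kern o a (b - 1) t (z 0) * G t z) := by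
      intro z
      rw [(hk z).fderiv]
      simp
      ring
    rw [integral_mul_fderiv_eq_neg_fderiv_mul_of_integrable
      (f := fun z : Cn (n + 1) => kern o a b t (z 0)) (g := G t) ?_ (hib _) hi
      (fun z _ => (hk z).differentiableAt) (fun z _ => hGd z)]
    · simp_rw [e]
      rw [integral_add (hi1.const_mul _) (hi2.const_mul _), integral_const_mul,
        integral_const_mul]
      ring
    · simp_rw [e]
      exact (hi1.const_mul _).add (hi2.const_mul _)
  -- `ε = -i` gives `∂/∂z₁` and `ε = i` gives `∂/∂z̄₁`. Inserting `key` for `c = 1` and `c = i`,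
  -- each choice cancels one of its two terms.
  have hz1 : ∀ ε : ℂ, ∫ z, kern o a b t (z 0) * ((1 / 2 : ℂ) *
      (fderiv ℝ (G t) z (Pi.single 0 1) + ε * fderiv ℝ (G t) z (Pi.single 0 Complex.I))) =
      (1 / 2 : ℂ) * (∫ z, kern o a b t (z 0) * fderiv ℝ (G t) z (Pi.single 0 1)) +
      (1 / 2 : ℂ) * ε * ∫ z, kern o a b t (z 0) * fderiv ℝ (G t) z (Pi.single 0 Complex.I) := by
    intro ε
    rw [← integral_const_mul, ← integral_const_mul,
      ← integral_add ((hib _).const_mul _) ((hib _).const_mul _)]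
    congr 1; ext z; ring
  have hI : Complex.I * Complex.I = -1 := Complex.I_mul_I
  constructor
  · have := hz1 (-Complex.I)
    simp only [neg_mul, ← sub_eq_add_neg] at this
    unfold dz1
    rw [this, key, key]
    simp only [map_one, Complex.conj_I]
    linear_combination (1 / 2 * ((o : ℂ) * t + a) * (∫ z, kern o (a - 1) b t (z 0) * G t z) -
      1 / 2 * ((o : ℂ) * t + b) * ∫ z, kern o a (b - 1) t (z 0) * G t z) * hI
  · have := hz1 Complex.I
    unfold dz1bar
    rw [this, key, key]
    simp only [map_one, Complex.conj_I]
    linear_combination (-1 / 2 * ((o : ℂ) * t + a) * (∫ z, kern o (a - 1) b t (z 0) * G t z) +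
      1 / 2 * ((o : ℂ) * t + b) * ∫ z, kern o a (b - 1) t (z 0) * G t z) * hI

/-- For `Re t` large everything converges and the affine factors do not vanish, so integration by
parts can be solved for the more singular integral. The recursion is only needed there, since the
identity theorem extends it. -/
lemma kern_integral_eq_dz1 {G : ℂ → Cn (n + 1) → ℂ} (hG : IsHolFamily G) {o : ℕ} (ho : 1 ≤ o)
    (a b : ℤ) : ∃ c : ℝ, ∀ t : ℂ, c < t.re →
      (∫ z, kern o a b t (z 0) * G t z =
        -((o : ℂ) * t + a + 1)⁻¹ * ∫ z, kern o (a + 1) b t (z 0) * dz1 (G t) z) ∧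
      (∫ z, kern o a b t (z 0) * G t z =
        -((o : ℂ) * t + b + 1)⁻¹ * ∫ z, kern o a (b + 1) t (z 0) * dz1bar (G t) z) := by
  refine ⟨|(a : ℝ)| + |(b : ℝ)| + 1, fun t ht => ?_⟩
  have ho' : (1 : ℝ) ≤ o := by exact_mod_cast ho
  have h1 := neg_abs_le (a : ℝ)
  have h2 := neg_abs_le (b : ℝ)
  have h3 := abs_nonneg (a : ℝ)
  have h4 := abs_nonneg (b : ℝ)
  have hot : t.re ≤ o * t.re := by nlinarith
  have hne : ∀ k : ℤ, -|(a : ℝ)| - |(b : ℝ)| ≤ k → (o : ℂ) * t + k ≠ 0 := by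
    intro k hk h
    have := congrArg Complex.re h
    simp at this
    linarith
  have hne0 : (o : ℂ) * t ≠ 0 := by
    have := hne 0 (by push_cast; linarith)
    simpa using this
  constructor
  · have := (kern_integral_by_parts hG o (a + 1) b (t := t) hne0 (by push_cast; linarith)).1
    rw [add_sub_cancel_right] at this
    push_cast at this
    rw [neg_mul, ← mul_neg, ← this, ← add_assoc, inv_mul_cancel_left₀]
    have := hne (a + 1) (by push_cast; linarith)
    push_cast at this
    rwa [← add_assoc] at this
  · have := (kern_integral_by_parts hG o a (b + 1) (t := t) hne0 (by push_cast; linarith)).2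
    rw [add_sub_cancel_right] at this
    push_cast at this
    rw [neg_mul, ← mul_neg, ← this, ← add_assoc, inv_mul_cancel_left₀]
    have := hne (b + 1) (by push_cast; linarith)
    push_cast at this
    rwa [← add_assoc] at this

lemma meromorphicAt_affine_inv (o : ℕ) (c t : ℂ) :
    MeromorphicAt (fun t => -((o : ℂ) * t + c)⁻¹) t := by fun_prop

/-- Meromorphic continuation to half planes by repeated integration by parts. -/
lemma kern_integral_continuation {o : ℕ} (ho : 1 ≤ o) (N : ℕ) :
    ∀ (a b : ℤ) (G : ℂ → Cn (n + 1) → ℂ), IsHolFamily G →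
      ∃ F : ℂ → ℂ, MeromorphicOn F {t | -2 - (N : ℝ) < 2 * o * t.re + a + b} ∧
        ∃ c : ℝ, ∀ t : ℂ, c < t.re → F t = ∫ z, kern o a b t (z 0) * G t z := by
  induction N with
  | zero =>
    intro a b G hG
    exact ⟨_, fun t ht => (hG.kern_integral o a b (by simpa using ht)).2.meromorphicAt, 0,
      fun t _ => rfl⟩
  | succ N ih =>
    intro a b G hG
    -- Raising the exponent of `z₁` alone suffices: each step gains one unit in the condition on `2o
    -- Re t`, and the affine factor adds at most a pole.
    obtain ⟨F, hF, c, hc⟩ := ih (a + 1) b _ hG.dz1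
    obtain ⟨c', hc'⟩ := kern_integral_eq_dz1 hG ho a b
    refine ⟨fun t => -((o : ℂ) * t + (a + 1))⁻¹ * F t, fun t ht => ?_, max c c', fun t ht => ?_⟩
    · refine (meromorphicAt_affine_inv o _ t).mul (hF t ?_)
      simp only [mem_ofPred_eq] at *
      push_cast at *
      linarith
    · beta_reduce
      rw [(hc' t ((le_max_right _ _).trans_lt ht)).1, hc t ((le_max_left _ _).trans_lt ht),
        add_assoc]

end LocalAnalysis

/-! ### The pole of the model integrals at the origin. -/

section LocalAnalysis

variable {n : ℕ}

/-- In polar coordinates this is `2π ∫₀¹ y^{2ot-1} dy`. It is the source of the pole and of the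
constant `π/o`. -/
lemma integral_kern_ball {o : ℕ} (ho : 1 ≤ o) {t : ℂ} (ht : 0 < t.re) :
    ∫ z in Metric.ball (0 : ℂ) 1, kern o (-1) (-1) t z = (Real.pi : ℂ) / ((o : ℂ) * t) := by
  have ho' : (0 : ℝ) < o := by exact_mod_cast ho
  have hre : 0 < o * t.re := by positivity
  have hot : (o : ℂ) * t ≠ 0 := fun h => by
    have := congrArg Complex.re h
    simp at this
    rcases this with h | h
    · omega
    · linarith
  have h1 : ∀ z : ℂ, (Metric.ball (0 : ℂ) 1).indicator (kern o (-1) (-1) t) z =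
      (Iio (1 : ℝ)).indicator
        (fun y : ℝ => (y : ℂ) ^ (2 * (o : ℂ) * t) * ((y : ℂ) ^ 2)⁻¹) ‖z‖ := by
    intro z
    simp only [indicator, mem_ball_zero_iff, mem_Iio]
    refine if_congr Iff.rfl ?_ rfl
    rw [kern, zpow_neg_one, zpow_neg_one, mul_assoc, ← mul_inv, Complex.mul_conj']
  rw [← integral_indicator Metric.isOpen_ball.measurableSet]
  simp_rw [h1]
  rw [integral_fun_norm_addHaar (volume : Measure ℂ), Complex.finrank_real_complex,
    Measure.real, Complex.volume_ball]
  have h2 : ∫ y in Ioi (0 : ℝ), y ^ (2 - 1) • (Iio (1 : ℝ)).indicator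
      (fun y : ℝ => (y : ℂ) ^ (2 * (o : ℂ) * t) * ((y : ℂ) ^ 2)⁻¹) y =
      ∫ y in (0 : ℝ)..1, (y : ℂ) ^ (2 * (o : ℂ) * t - 1) := by
    have e : ∀ y : ℝ, y ^ (2 - 1) • (Iio (1 : ℝ)).indicator
        (fun y : ℝ => (y : ℂ) ^ (2 * (o : ℂ) * t) * ((y : ℂ) ^ 2)⁻¹) y =
        (Iio (1 : ℝ)).indicator
        (fun y : ℝ => y • ((y : ℂ) ^ (2 * (o : ℂ) * t) * ((y : ℂ) ^ 2)⁻¹)) y := by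
      intro y
      simp only [indicator, Nat.add_one_sub_one, pow_one]
      split_ifs <;> simp
    simp_rw [e]
    rw [intervalIntegral.integral_of_le zero_le_one, integral_Ioc_eq_integral_Ioo,
      setIntegral_indicator measurableSet_Iio, Ioi_inter_Iio]
    refine setIntegral_congr_fun measurableSet_Ioo fun y hy => ?_
    have hy0 : (y : ℂ) ≠ 0 := by exact_mod_cast hy.1.ne'
    rw [Complex.cpow_sub _ _ hy0, Complex.cpow_one, Complex.real_smul]
    field_simp
  rw [h2, integral_cpow (Or.inl (by simp; linarith))]
  have hne : 2 * (o : ℂ) * t ≠ 0 := by rw [mul_assoc]; exact mul_ne_zero two_ne_zero hot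
  rw [sub_add_cancel, Complex.ofReal_one, Complex.one_cpow, Complex.ofReal_zero,
    Complex.zero_cpow hne]
  simp
  field_simp

lemma norm_cons_zero_tail (z : Cn (n + 1)) :
    ‖z - (Fin.cons (0 : ℂ) (Fin.tail z) : Cn (n + 1))‖ = ‖z 0‖ := by
  have : z - (Fin.cons (0 : ℂ) (Fin.tail z) : Cn (n + 1)) = Pi.single 0 (z 0) := by
    ext i
    refine Fin.cases ?_ (fun j => ?_) i
    · simp
    · simp [Fin.tail]
  rw [this, Pi.norm_single]

lemma contDiff_cons_zero : ContDiff ℝ ∞ (fun w : Cn n => (Fin.cons (0 : ℂ) w : Cn (n + 1))) := by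
  rw [contDiff_pi]
  intro i
  refine Fin.cases ?_ (fun j => ?_) i
  · simpa using contDiff_const
  · simpa using contDiff_apply ℝ ℂ j

lemma norm_cons_zero (w : Cn n) : ‖(Fin.cons (0 : ℂ) w : Cn (n + 1))‖ = ‖w‖ := by
  apply le_antisymm
  · rw [pi_norm_le_iff_of_nonneg (norm_nonneg _)]
    intro i
    refine Fin.cases ?_ (fun j => ?_) i
    · simp
    · simpa using norm_le_pi_norm w j
  · rw [pi_norm_le_iff_of_nonneg (norm_nonneg _)]
    intro j
    simpa using norm_le_pi_norm (Fin.cons (0 : ℂ) w : Cn (n + 1)) j.succ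

lemma contDiff_tail : ContDiff ℝ ∞ (fun z : Cn (n + 1) => (Fin.tail z : Cn n)) := by
  rw [contDiff_pi]
  exact fun i => contDiff_apply ℝ ℂ i.succ

lemma IsHolFamily.exists_lipschitz {G : ℂ → Cn (n + 1) → ℂ} (hG : IsHolFamily G) (t₀ : ℂ) :
    ∃ C : ℝ, ∀ t ∈ Metric.closedBall t₀ 1, ∀ z w, ‖G t z - G t w‖ ≤ C * ‖z - w‖ := by
  obtain ⟨K, hK, h⟩ := hG.supp
  have hc : ContDiff ℝ ∞ (fun p : ℂ × Cn (n + 1) => fderiv ℝ (G p.1) p.2) := by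
    refine ContDiff.fderiv (f := fun (p : ℂ × Cn (n + 1)) z => G p.1 z) (m := ∞) (n := ∞)
      (g := fun p => p.2) ?_ contDiff_snd (by simp)
    exact hG.smooth.comp ((contDiff_fst.comp contDiff_fst).prodMk contDiff_snd)
  obtain ⟨C, hC⟩ := ((isCompact_closedBall t₀ 1).prod hK).exists_bound_of_continuousOn
    hc.continuous.continuousOn
  refine ⟨max C 0, fun t ht z w => ?_⟩
  refine convex_univ.norm_image_sub_le_of_norm_fderiv_le (𝕜 := ℝ) (f := G t)
    (fun x _ => (hG.contDiff_apply t).differentiable (by simp) x) (fun x _ => ?_)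
    (mem_univ _) (mem_univ _)
  by_cases hx : x ∈ K
  · exact (hC (t, x) ⟨ht, hx⟩).trans (le_max_left _ _)
  · simp [IsHolFamily.fderiv_eq_zero hK h t hx]

lemma IsHolFamily.integral_slice_analyticAt {G : ℂ → Cn (n + 1) → ℂ} (hG : IsHolFamily G)
    (t₀ : ℂ) : AnalyticAt ℂ (fun t => ∫ w : Cn n, G t (Fin.cons 0 w)) t₀ := by
  obtain ⟨C, R, hC, hR, hs, hb⟩ := hG.exists_bound t₀ 1
  refine analyticAt_integral_of_dominated one_pos
    (B := (Metric.closedBall (0 : Cn n) R).indicator fun _ => C)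
    (fun t _ => ((hG.contDiff_apply t).comp contDiff_cons_zero).continuous.aestronglyMeasurable)
    (Eventually.of_forall fun w => (hG.hol _).differentiableOn)
    (Eventually.of_forall fun w t ht => ?_) ?_
  · by_cases hw : w ∈ Metric.closedBall (0 : Cn n) R
    · rw [indicator_of_mem hw]
      exact hb t (Metric.ball_subset_closedBall ht) _
    · rw [indicator_of_notMem hw, hs t _ (by
        rw [norm_cons_zero]; simpa using hw), norm_zero]
  · rw [integrable_indicator_iff measurableSet_closedBall]
    exact integrableOn_const Metric.isBounded_closedBall.measure_lt_top.ne

/-- The integral of a function that splits as a product. -/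
lemma integral_prod_cons (k : ℂ → ℂ) (h : Cn n → ℂ) :
    ∫ z : Cn (n + 1), k (z 0) * h (Fin.tail z) = (∫ x, k x) * ∫ w, h w := by
  have hmp := volume_preserving_piFinSuccAbove (fun _ : Fin (n + 1) => ℂ) 0
  rw [← integral_prod_mul]
  exact hmp.integral_comp (MeasurableEquiv.measurableEmbedding _)
    (fun p : ℂ × Cn n => k p.1 * h p.2)

/-- Subtract from `H` its restriction to `z₁ = 0`, extended constantly in `z₁` over the unit disc.
The difference is `O(|z₁|)`, which improves the convergence to `2o Re t > -1`; the subtracted part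
factors by Fubini into the explicit disc integral. The sharp cutoff does no harm, as only
measurability and the bound matter. -/
lemma kern_integral_near_zero {o : ℕ} (ho : 1 ≤ o) {H : ℂ → Cn (n + 1) → ℂ}
    (hH : IsHolFamily H) :
    ∃ A : ℂ → ℂ, (∀ t : ℂ, -1 < 2 * o * t.re → AnalyticAt ℂ A t) ∧
      ∀ t : ℂ, 0 < t.re → ∫ z, kern o (-1) (-1) t (z 0) * H t z =
        (Real.pi : ℂ) / ((o : ℂ) * t) * (∫ w : Cn n, H t (Fin.cons 0 w)) + A t := by
  classical
  let S : ℂ → Cn (n + 1) → ℂ := fun t z =>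
    (Metric.ball (0 : ℂ) 1).indicator (fun _ => H t (Fin.cons 0 (Fin.tail z))) (z 0)
  let H' : ℂ → Cn (n + 1) → ℂ := fun t z => H t z - S t z
  have hSc : ∀ t, Measurable fun z : Cn (n + 1) => H t (Fin.cons 0 (Fin.tail z)) := fun t =>
    (((hH.contDiff_apply t).comp contDiff_cons_zero).comp contDiff_tail).continuous.measurable
  have hS : ∀ t, Measurable (S t) := by
    intro t
    have : S t = ((fun z : Cn (n + 1) => z 0) ⁻¹' Metric.ball (0 : ℂ) 1).indicator
        fun z : Cn (n + 1) => H t (Fin.cons 0 (Fin.tail z)) := by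
      ext z; simp only [S, indicator, mem_preimage]
    rw [this]
    exact (hSc t).indicator ((measurable_pi_apply 0) Metric.isOpen_ball.measurableSet)
  have hm : ∀ t, Measurable (H' t) := fun t =>
    (hH.contDiff_apply t).continuous.measurable.sub (hS t)
  have hd : ∀ z, Differentiable ℂ fun t => H' t z := by
    intro z
    refine (hH.hol z).sub ?_
    simp only [S, indicator]
    split_ifs
    · exact hH.hol _
    · exact differentiable_const _
  have hana : ∀ t : ℂ, -1 < 2 * o * t.re →
      Integrable (fun z => kern o (-1) (-1) t (z 0) * H' t z) ∧
      AnalyticAt ℂ (fun t => ∫ z, kern o (-1) (-1) t (z 0) * H' t z) t := by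
    intro t ht
    obtain ⟨C, R, hC, hR, hs, hb⟩ := hH.exists_bound t 1
    obtain ⟨C', hC'⟩ := hH.exists_lipschitz t
    refine kern_integral_analyticAt o (-1) (-1) 1 (C := max C C') (R := R + 1)
      (le_max_of_le_left hC) hm hd (fun t z hz => ?_) (fun t ht z => ?_) ?_
    · have h1 : H t z = 0 := hs t z (by linarith)
      have h2 : S t z = 0 := by
        by_cases hz0 : z 0 ∈ Metric.ball (0 : ℂ) 1
        · simp only [S, indicator_of_mem hz0]
          apply hs
          have := norm_cons_zero_tail z
          have h3 := norm_sub_norm_le z (Fin.cons (0 : ℂ) (Fin.tail z) : Cn (n + 1))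
          rw [mem_ball_zero_iff] at hz0
          linarith
        · simp only [S, indicator_of_notMem hz0]
      simp only [H', h1, h2, sub_zero]
    · rw [pow_one]
      by_cases hz0 : z 0 ∈ Metric.ball (0 : ℂ) 1
      · simp only [H', S, indicator_of_mem hz0]
        refine (hC' t ht _ _).trans ?_
        rw [norm_cons_zero_tail]
        exact mul_le_mul_of_nonneg_right (le_max_right _ _) (norm_nonneg _)
      -- Outside the unit disc nothing is subtracted, but there `1 ≤ |z₁|`, so boundedness already
      -- gives the linear bound.
      · simp only [H', S, indicator_of_notMem hz0, sub_zero]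
        rw [mem_ball_zero_iff, not_lt] at hz0
        calc ‖H t z‖ ≤ C := hb t ht z
          _ ≤ max C C' := le_max_left _ _
          _ ≤ max C C' * ‖z 0‖ := le_mul_of_one_le_right (le_max_of_le_left hC) hz0
    · push_cast; linarith
  refine ⟨_, fun t ht => (hana t ht).2, fun t ht => ?_⟩
  have ho' : (0 : ℝ) < o := by exact_mod_cast ho
  have hpos : 0 < 2 * o * t.re := by positivity
  have hi1 := (hH.kern_integral o (-1) (-1) (t := t) (by push_cast; linarith)).1
  have hi2 := (hana t (by linarith)).1
  have e1 : ∀ z : Cn (n + 1), kern o (-1) (-1) t (z 0) * H t z =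
      (Metric.ball (0 : ℂ) 1).indicator (kern o (-1) (-1) t) (z 0) *
        H t (Fin.cons 0 (Fin.tail z)) + kern o (-1) (-1) t (z 0) * H' t z := by
    intro z
    simp only [H', S, indicator]
    split_ifs <;> ring
  have hi3 : Integrable fun z : Cn (n + 1) =>
      (Metric.ball (0 : ℂ) 1).indicator (kern o (-1) (-1) t) (z 0) *
        H t (Fin.cons 0 (Fin.tail z)) := by
    refine (hi1.sub hi2).congr (Eventually.of_forall fun z => ?_)
    simp only [Pi.sub_apply, e1 z, add_sub_cancel_right]
  simp_rw [e1]
  rw [integral_add hi3 hi2, integral_prod_cons _ (fun w => H t (Fin.cons 0 w)),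
    integral_indicator Metric.isOpen_ball.measurableSet, integral_kern_ball ho ht]

/-- `f`, defined for `Re t` large, continues meromorphically to `Re t > c` for some `c < 0`, with at
most a simple pole of residue `r` at `0`. -/
def HasLocalPole (c : ℝ) (f : ℂ → ℂ) (r : ℂ) : Prop :=
  ∃ g R : ℂ → ℂ, MeromorphicOn g {t | c < t.re} ∧ AnalyticAt ℂ R 0 ∧ R 0 = r ∧
    (∀ᶠ t in 𝓝[≠] (0 : ℂ), g t = R t / t) ∧ ∃ c', ∀ t : ℂ, c' < t.re → f t = g t

/-- The factor produced by one integration by parts is holomorphic at `0` with value `1/(k+1)`.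
Iterated, these values build the factorials of the residue. -/
lemma HasLocalPole.affine_inv {c : ℝ} {f g : ℂ → ℂ} {r : ℂ} (h : HasLocalPole c f r) (o k : ℕ)
    {c' : ℝ} (hg : ∀ t : ℂ, c' < t.re → g t = -((o : ℂ) * t - (k + 1))⁻¹ * f t) :
    HasLocalPole c g (r / (k + 1)) := by
  obtain ⟨F, R, hF, hR, hr, h0, d, hd⟩ := h
  have hk : ((k : ℂ) + 1) ≠ 0 := by exact_mod_cast Nat.succ_ne_zero k
  have hana : AnalyticAt ℂ (fun t : ℂ => -((o : ℂ) * t - (k + 1))⁻¹) 0 := by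
    refine AnalyticAt.neg (AnalyticAt.inv (by fun_prop) ?_)
    simpa using fun h => hk (by linear_combination -h)
  refine ⟨fun t => -((o : ℂ) * t - (k + 1))⁻¹ * F t, fun t => -((o : ℂ) * t - (k + 1))⁻¹ * R t,
    fun t ht => MeromorphicAt.mul (by fun_prop) (hF t ht), hana.mul hR, ?_, ?_, max c' d,
    fun t ht => ?_⟩
  · simp only [hr, mul_zero, zero_sub, inv_neg, neg_neg]
    field_simp
  · filter_upwards [h0] with t ht
    rw [ht, mul_div_assoc]
  · rw [hg t ((le_max_left _ _).trans_lt ht), hd t ((le_max_right _ _).trans_lt ht)]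

/-- The exponents are raised to `-1` and no further: the next factor would be `-(ot)⁻¹`, singular at
the origin. The derivatives in `z̄₁` are used up first, then those in `z₁`, which fixes the order of
the iterates. -/
lemma kern_localPole {o : ℕ} (ho : 1 ≤ o) (l m : ℕ) :
    ∀ G : ℂ → Cn (n + 1) → ℂ, IsHolFamily G →
    HasLocalPole (-1 / (2 * o)) (fun t => ∫ z, kern o (-(m + 1)) (-(l + 1)) t (z 0) * G t z)
      ((Real.pi : ℂ) / o / (m.factorial * l.factorial) *
        ∫ w : Cn n, (dz1^[m] (dz1bar^[l] (G 0))) (Fin.cons 0 w)) := by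
  have ho' : (0 : ℝ) < o := by exact_mod_cast ho
  induction l with
  | zero =>
    induction m with
    | zero =>
      intro G hG
      obtain ⟨A, hA, hA'⟩ := kern_integral_near_zero ho hG
      have hre : ∀ t : ℂ, -1 / (2 * (o : ℝ)) < t.re → -1 < 2 * o * t.re := fun t ht => by
        rw [div_lt_iff₀ (by positivity)] at ht; linarith
      have hA0 := hA 0 (by simp)
      refine ⟨fun t => (Real.pi : ℂ) / ((o : ℂ) * t) * (∫ w : Cn n, G t (Fin.cons 0 w)) + A t,
        fun t => (Real.pi : ℂ) / o * (∫ w : Cn n, G t (Fin.cons 0 w)) + t * A t,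
        fun t ht => ?_, ?_, ?_, ?_, 0, fun t ht => ?_⟩
      · exact (MeromorphicAt.mul (by fun_prop)
          (hG.integral_slice_analyticAt t).meromorphicAt).add (hA t (hre t ht)).meromorphicAt
      · exact (analyticAt_const.mul (hG.integral_slice_analyticAt 0)).add (analyticAt_id.mul hA0)
      · simp
      · filter_upwards [self_mem_nhdsWithin] with t (ht : t ≠ 0)
        field_simp
      · simpa using hA' t ht
    | succ m ih =>
      intro G hG
      obtain ⟨c, hc⟩ := kern_integral_eq_dz1 hG ho (-(m + 1 + 1)) (-(0 + 1))
      have := (ih _ hG.dz1).affine_inv o m (c' := c)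
        (g := fun t => ∫ z, kern o (-((m + 1 : ℕ) + 1)) (-((0 : ℕ) + 1)) t (z 0) * G t z)
        (fun t ht => ?_)
      · convert this using 1
        rw [Function.iterate_succ_apply, Nat.factorial_succ]
        push_cast
        field_simp
        rfl
      · have h1 := (hc t ht).1
        rw [show (-((m : ℤ) + 1 + 1) + 1) = -((m : ℤ) + 1) by ring] at h1
        push_cast at h1 ⊢
        rw [h1]
        congr 3
        ring
  | succ l ih =>
    intro G hG
    obtain ⟨c, hc⟩ := kern_integral_eq_dz1 hG ho (-(m + 1)) (-(l + 1 + 1))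
    have := (ih _ hG.dz1bar).affine_inv o l (c' := c)
      (g := fun t => ∫ z, kern o (-(m + 1)) (-((l + 1 : ℕ) + 1)) t (z 0) * G t z)
      (fun t ht => ?_)
    · convert this using 1
      rw [Function.iterate_succ_apply, Nat.factorial_succ]
      push_cast
      field_simp
    · have h1 := (hc t ht).2
      rw [show (-((l : ℤ) + 1 + 1) + 1) = -((l : ℤ) + 1) by ring] at h1
      push_cast at h1 ⊢
      rw [h1]
      congr 3
      ring

/-- Repeated integration by parts in `z₁` gives a continuation to `ℂ` but no control of the order at
`0`; `kern_localPole` gives the pole but only on a half plane. The identity theorem matches the two.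
-/
lemma kern_hasPoleContinuation {o : ℕ} (ho : 1 ≤ o) {m l : ℕ} (hm : 1 ≤ m) (hl : 1 ≤ l)
    {G : ℂ → Cn (n + 1) → ℂ} (hG : IsHolFamily G) :
    HasPoleContinuation (fun t => ∫ z, kern o (-m) (-l) t (z 0) * G t z)
      ((Real.pi : ℂ) / o / ((m - 1).factorial * (l - 1).factorial) *
        ∫ w : Cn n, (dz1^[m - 1] (dz1bar^[l - 1] (G 0))) (Fin.cons 0 w)) := by
  have ho' : (0 : ℝ) < o := by exact_mod_cast ho
  obtain ⟨m, rfl⟩ := Nat.exists_eq_add_of_le' hm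
  obtain ⟨l, rfl⟩ := Nat.exists_eq_add_of_le' hl
  have hf : ∀ t : ℂ, ((m + l : ℕ) : ℝ) / (2 * o) < t.re → AnalyticAt ℂ
      (fun t => ∫ z, kern o (-(m + 1 : ℕ)) (-(l + 1 : ℕ)) t (z 0) * G t z) t := by
    intro t ht
    refine (hG.kern_integral o _ _ ?_).2
    rw [div_lt_iff₀ (by positivity)] at ht
    push_cast at *
    linarith
  obtain ⟨F, hF, hFe⟩ := exists_meromorphic_of_halfPlanes hf fun N => by
    -- With this many steps the condition on `2o Re t` becomes exactly `Re t > -N`.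
    obtain ⟨F, hF, hc⟩ := kern_integral_continuation ho (2 * o * N + m + l) (-(m + 1 : ℕ))
      (-(l + 1 : ℕ)) G hG
    refine ⟨F, hF.mono_set fun t ht => ?_, hc⟩
    simp only [mem_ofPred_eq] at *
    push_cast
    nlinarith
  obtain ⟨g, R, hg, hR, hr, h0, c', hc'⟩ := kern_localPole ho l m G hG
  refine ⟨F, R, hF, hR, by simpa using hr, ?_, ((m + l : ℕ) : ℝ) / (2 * o) + 1, fun t ht => ?_⟩
  · have hneg : -1 / (2 * (o : ℝ)) < (0 : ℂ).re := by
      rw [Complex.zero_re]; exact div_neg_of_neg_of_pos (by norm_num) (by positivity)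
    have := eventuallyEq_nhdsNE_of_eq_of_large_re (F := F) (fun t _ => hF t) hg
      (c' := max c' (((m + l : ℕ) : ℝ) / (2 * o) + 1)) (fun t ht => ?_) hneg
    · filter_upwards [this, h0] with t h1 h2
      rw [h1, h2]
    · rw [hFe t ((le_max_right _ _).trans_lt ht), ← hc' t ((le_max_left _ _).trans_lt ht)]
      simp
  · refine ⟨(hf t (by linarith)).congr ?_, hFe t ht⟩
    filter_upwards [(isOpen_lt_re _).mem_nhds ht] with s hs using (hFe s hs).symm

end LocalAnalysis

/-! ### Linear algebra of top degree forms. -/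

section TopDegree

/-- The real frame `stdFrame` as a basis. -/
def stdBasis (n : ℕ) : Module.Basis (Fin (2 * n)) ℝ (Cn n) :=
  (Pi.basis fun _ : Fin n => Complex.basisOneI).reindex
    ((Equiv.sigmaEquivProd (Fin n) (Fin 2)).trans
      (finProdFinEquiv.trans (finCongr (mul_comm n 2))))

lemma coe_stdBasis (n : ℕ) : ⇑(stdBasis n) = stdFrame n := by
  ext1 i
  obtain ⟨⟨a, b⟩, rfl⟩ := ((finProdFinEquiv (m := n) (n := 2)).trans
    (finCongr (mul_comm n 2))).surjective i
  have h : ((Equiv.sigmaEquivProd (Fin n) (Fin 2)).trans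
      (finProdFinEquiv.trans (finCongr (mul_comm n 2)))).symm
      ((finProdFinEquiv.trans (finCongr (mul_comm n 2))) (a, b)) = ⟨a, b⟩ := by
    rw [Equiv.symm_apply_eq]; rfl
  rw [stdBasis, Module.Basis.reindex_apply, h, Pi.basis_apply, stdFrame]
  have h1 : ((b : ℕ) + 2 * (a : ℕ)) / 2 = a := by omega
  have h2 : ((b : ℕ) + 2 * (a : ℕ)) % 2 = b := by omega
  simp only [Equiv.trans_apply, finCongr_apply, Fin.val_cast, finProdFinEquiv_apply_val, h1, h2]
  fin_cases b <;> simp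

variable {n : ℕ}

/-- An injective choice of `2n` among the `2n` basis vectors is a permutation, so one value on the
frame decides everything. -/
lemma topForm_ext {f g : (Cn n) [⋀^Fin (2 * n)]→ₗ[ℝ] ℂ} (h : f (stdFrame n) = g (stdFrame n)) :
    f = g := by
  refine Module.Basis.ext_alternating (stdBasis n) fun v hv => ?_
  let σ : Equiv.Perm (Fin (2 * n)) := Equiv.ofBijective v (Finite.injective_iff_bijective.1 hv)
  have hσ : (fun i => stdBasis n (v i)) = stdFrame n ∘ σ := by
    ext1 i; rw [coe_stdBasis]; rfl
  rw [hσ, f.map_perm, g.map_perm, h]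

lemma topForm_comp (f : (Cn n) [⋀^Fin (2 * n)]→ₗ[ℝ] ℂ) (A : Cn n →ₗ[ℝ] Cn n) :
    f (A ∘ stdFrame n) = LinearMap.det A • f (stdFrame n) := by
  have h : f = f (stdFrame n) • Complex.ofRealCLM.toLinearMap.compAlternatingMap
      (stdBasis n).det := by
    refine topForm_ext ?_
    simp [← coe_stdBasis, Module.Basis.det_self]
  conv_lhs => rw [h]
  have h2 : (stdBasis n).det (A ∘ stdFrame n) = LinearMap.det A := by
    rw [← coe_stdBasis, Module.Basis.det_comp, Module.Basis.det_self, mul_one]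
  simp only [AlternatingMap.smul_apply, LinearMap.compAlternatingMap_apply, h2]
  simp [mul_comm]

/-- After regrouping the indices the matrix is block diagonal with `n` blocks of determinant `-2i`.
The surplus of one such factor on `X` over `D` turns `π` into `-2πi`. -/
lemma stdForm_stdFrame (n : ℕ) (z : Cn n) : stdForm n z (stdFrame n) = (-2 * Complex.I) ^ n := by
  let e : Fin 2 × Fin n ≃ Fin (2 * n) :=
    (Equiv.prodComm _ _).trans (finProdFinEquiv.trans (finCongr (mul_comm n 2)))
  have hdiv : ∀ p : Fin 2 × Fin n, ((e p : Fin (2 * n)) : ℕ) / 2 = p.2 := by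
    intro p
    simp only [e, Equiv.trans_apply, finCongr_apply, Fin.val_cast, finProdFinEquiv_apply_val,
      Equiv.prodComm_apply, Prod.fst_swap, Prod.snd_swap]
    omega
  have hmod : ∀ p : Fin 2 × Fin n, ((e p : Fin (2 * n)) : ℕ) % 2 = p.1 := by
    intro p
    simp only [e, Equiv.trans_apply, finCongr_apply, Fin.val_cast, finProdFinEquiv_apply_val,
      Equiv.prodComm_apply, Prod.fst_swap, Prod.snd_swap]
    omega
  have h : (Matrix.of fun i => zzbar n (stdFrame n i)).submatrix e e =
      Matrix.blockDiagonal fun _ : Fin n => !![1, 1; Complex.I, -Complex.I] := by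
    ext p q
    obtain ⟨i, k⟩ := p
    obtain ⟨j, l⟩ := q
    have hk : (⟨((e (i, k) : Fin (2 * n)) : ℕ) / 2, by omega⟩ : Fin n) = k :=
      Fin.ext (hdiv (i, k))
    have hl : (⟨((e (j, l) : Fin (2 * n)) : ℕ) / 2, by omega⟩ : Fin n) = l :=
      Fin.ext (hdiv (j, l))
    simp only [Matrix.submatrix_apply, Matrix.of_apply, zzbar, LinearMap.pi_apply,
      LinearMap.comp_apply, LinearMap.proj_apply, stdFrame, hk, hl, hmod, Matrix.blockDiagonal_apply]
    by_cases hkl : k = l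
    · subst hkl
      fin_cases i <;> fin_cases j <;> simp
    · simp [hkl]
  have h2 : stdForm n z (stdFrame n) = (Matrix.of fun i => zzbar n (stdFrame n i)).det := rfl
  rw [h2, ← Matrix.det_submatrix_equiv_self e, h, Matrix.det_blockDiagonal]
  simp only [Matrix.det_fin_two_of, Finset.prod_const, Finset.card_univ, Fintype.card_fin]
  ring

end TopDegree

/-! ### Change of charts and integration of top degree forms. -/

section Forms

variable {n m k l : ℕ}
variable {M : Type*} [TopologicalSpace M] [ChartedSpace (Cn n) M]
variable {N : Type*} [TopologicalSpace N] [ChartedSpace (Cn m) N]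

/-- Partitions of unity, metrics and coefficients of forms are smooth over `ℝ`, while the charts are
holomorphic; this lets both structures use the same charts. -/
lemma contDiffGroupoid_complex_le_real :
    contDiffGroupoid ω 𝓘(ℂ, Cn n) ≤ contDiffGroupoid ∞ 𝓘(ℝ, Cn n) := by
  refine StructureGroupoid.le_iff.2 fun e he => ?_
  rw [contDiffGroupoid, mem_groupoid_of_pregroupoid] at he ⊢
  simp only [contDiffPregroupoid, modelWithCornersSelf_coe, modelWithCornersSelf_coe_symm,
    Function.id_comp, Function.comp_id, preimage_id, range_id, inter_univ] at he ⊢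
  exact ⟨(he.1.restrict_scalars ℝ).of_le le_top, (he.2.restrict_scalars ℝ).of_le le_top⟩

lemma mem_maximalAtlas_real {e : OpenPartialHomeomorph M (Cn n)}
    (he : e ∈ IsManifold.maximalAtlas 𝓘(ℂ, Cn n) ω M) :
    e ∈ IsManifold.maximalAtlas 𝓘(ℝ, Cn n) ∞ M :=
  fun e' he' => ⟨contDiffGroupoid_complex_le_real (he e' he').1,
    contDiffGroupoid_complex_le_real (he e' he').2⟩

lemma isManifold_real [IsManifold 𝓘(ℂ, Cn n) ω M] : IsManifold 𝓘(ℝ, Cn n) ∞ M :=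
  { compatible := fun he he' => contDiffGroupoid_complex_le_real
      (HasGroupoid.compatible (G := contDiffGroupoid ω 𝓘(ℂ, Cn n)) he he') }

lemma ContMDiffOn.contDiffOn_chart {F : Type*} [NormedAddCommGroup F] [NormedSpace ℝ F]
    [IsManifold 𝓘(ℂ, Cn n) ω M] {f : M → F}
    {U : Set M} (hf : ContMDiffOn 𝓘(ℝ, Cn n) 𝓘(ℝ, F) ∞ f U)
    {e : OpenPartialHomeomorph M (Cn n)} (he : e ∈ IsManifold.maximalAtlas 𝓘(ℂ, Cn n) ω M) :
    ContDiffOn ℝ ∞ (fun z => f (e.symm z)) (e.target ∩ e.symm ⁻¹' U) := by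
  have := isManifold_real (M := M) (n := n)
  rw [← contMDiffOn_iff_contDiffOn]
  exact hf.comp ((contMDiffOn_symm_of_mem_maximalAtlas (mem_maximalAtlas_real he)).mono
    inter_subset_left) fun z hz => hz.2

lemma ContMDiff.contDiffOn_chart {F : Type*} [NormedAddCommGroup F] [NormedSpace ℝ F]
    [IsManifold 𝓘(ℂ, Cn n) ω M] {f : M → F} (hf : ContMDiff 𝓘(ℝ, Cn n) 𝓘(ℝ, F) ∞ f)
    {e : OpenPartialHomeomorph M (Cn n)} (he : e ∈ IsManifold.maximalAtlas 𝓘(ℂ, Cn n) ω M) :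
    ContDiffOn ℝ ∞ (fun z => f (e.symm z)) e.target := by
  simpa using (hf.contMDiffOn (s := univ)).contDiffOn_chart he

variable {e e' : OpenPartialHomeomorph M (Cn n)}

lemma mdifferentiableAt_chart_symm [IsManifold 𝓘(ℂ, Cn n) ω M]
    (he : e ∈ IsManifold.maximalAtlas 𝓘(ℂ, Cn n) ω M) {z : Cn n}
    (hz : z ∈ e.target) : MDifferentiableAt 𝓘(ℂ, Cn n) 𝓘(ℂ, Cn n) e.symm z :=
  (contMDiffAt_symm_of_mem_maximalAtlas he hz).mdifferentiableAt (by simp)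

lemma mdifferentiableAt_chart [IsManifold 𝓘(ℂ, Cn n) ω M]
    (he : e ∈ IsManifold.maximalAtlas 𝓘(ℂ, Cn n) ω M) {x : M}
    (hx : x ∈ e.source) : MDifferentiableAt 𝓘(ℂ, Cn n) 𝓘(ℂ, Cn n) e x :=
  (contMDiffAt_of_mem_maximalAtlas he hx).mdifferentiableAt (by simp)

/-- The transition map between two charts. -/
lemma transition_contDiffOn [IsManifold 𝓘(ℂ, Cn n) ω M]
    (he : e ∈ IsManifold.maximalAtlas 𝓘(ℂ, Cn n) ω M)
    (he' : e' ∈ IsManifold.maximalAtlas 𝓘(ℂ, Cn n) ω M) :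
    ContDiffOn ℂ ω (fun z => e' (e.symm z)) (e.target ∩ e.symm ⁻¹' e'.source) := by
  rw [← contMDiffOn_iff_contDiffOn]
  exact (contMDiffOn_of_mem_maximalAtlas he').comp
    ((contMDiffOn_symm_of_mem_maximalAtlas he).mono inter_subset_left) fun z hz => hz.2

lemma isOpen_transition (e e' : OpenPartialHomeomorph M (Cn n)) :
    IsOpen (e.target ∩ e.symm ⁻¹' e'.source) :=
  e.isOpen_inter_preimage_symm e'.open_source

lemma tangentLin_transition [IsManifold 𝓘(ℂ, Cn n) ω M]
    (he : e ∈ IsManifold.maximalAtlas 𝓘(ℂ, Cn n) ω M)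
    (he' : e' ∈ IsManifold.maximalAtlas 𝓘(ℂ, Cn n) ω M) {z : Cn n} (hz : z ∈ e.target)
    (hz' : e.symm z ∈ e'.source) :
    tangentLin (n := n) (m := n) e.symm z =
      (tangentLin (n := n) (m := n) e'.symm (e' (e.symm z))).comp
      (fderiv ℂ (fun z => e' (e.symm z)) z) := by
  have h1 : ∀ᶠ y in 𝓝 z, (e'.symm ∘ fun z => e' (e.symm z)) y = e.symm y := by
    filter_upwards [(isOpen_transition e e').mem_nhds ⟨hz, hz'⟩] with y hy
    exact e'.left_inv hy.2
  have hd : MDifferentiableAt 𝓘(ℂ, Cn n) 𝓘(ℂ, Cn n) (fun z => e' (e.symm z)) z :=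
    (mdifferentiableAt_chart he' hz').comp z (mdifferentiableAt_chart_symm he hz)
  have h2 := mfderiv_comp z (mdifferentiableAt_chart_symm he' (e'.map_source hz')) hd
  rw [EventuallyEq.mfderiv_eq h1, mfderiv_eq_fderiv] at h2
  exact h2

lemma pullbackForm_transition [IsManifold 𝓘(ℂ, Cn n) ω M]
    (he : e ∈ IsManifold.maximalAtlas 𝓘(ℂ, Cn n) ω M)
    (he' : e' ∈ IsManifold.maximalAtlas 𝓘(ℂ, Cn n) ω M) {z : Cn n} (hz : z ∈ e.target)
    (hz' : e.symm z ∈ e'.source) (η : Form n M k) (v : Fin k → Cn n) :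
    pullbackForm e.symm η z v = pullbackForm e'.symm η (e' (e.symm z))
      (fun i => fderiv ℂ (fun z => e' (e.symm z)) z (v i)) := by
  simp only [pullbackForm, AlternatingMap.compLinearMap_apply]
  rw [tangentLin_transition he he' hz hz', e'.left_inv hz']
  rfl

/-- The real determinant of a complex linear map is the squared modulus of the complex one. Hence
transition maps preserve orientation, and the absolute value in the change of variables formula
costs nothing. -/
lemma det_restrictScalars_nonneg (A : Cn n →L[ℂ] Cn n) :
    0 ≤ (A.restrictScalars ℝ).det := by
  have h : (A.restrictScalars ℝ).det = Complex.normSq (LinearMap.det (A : Cn n →ₗ[ℂ] Cn n)) := by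
    have := LinearMap.det_restrictScalars (R := ℝ) (S := ℂ) (f := (A : Cn n →ₗ[ℂ] Cn n))
    rw [Algebra.norm_complex_eq] at this
    exact this
  rw [h]
  exact Complex.normSq_nonneg _

lemma pullbackForm_transition_top [IsManifold 𝓘(ℂ, Cn n) ω M]
    (he : e ∈ IsManifold.maximalAtlas 𝓘(ℂ, Cn n) ω M)
    (he' : e' ∈ IsManifold.maximalAtlas 𝓘(ℂ, Cn n) ω M) {z : Cn n} (hz : z ∈ e.target)
    (hz' : e.symm z ∈ e'.source) (η : Form n M (2 * n)) :
    pullbackForm e.symm η z (stdFrame n) =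
      |((fderiv ℂ (fun z => e' (e.symm z)) z).restrictScalars ℝ).det| •
        pullbackForm e'.symm η (e' (e.symm z)) (stdFrame n) := by
  rw [pullbackForm_transition he he' hz hz', abs_of_nonneg (det_restrictScalars_nonneg _)]
  exact topForm_comp _ ((fderiv ℂ (fun z => e' (e.symm z)) z).restrictScalars ℝ).toLinearMap

lemma image_transition (e e' : OpenPartialHomeomorph M (Cn n)) :
    (fun z => e' (e.symm z)) '' (e.target ∩ e.symm ⁻¹' e'.source) =
      e'.target ∩ e'.symm ⁻¹' e.source := by
  ext w
  constructor
  · rintro ⟨z, ⟨hz, hz'⟩, rfl⟩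
    refine ⟨e'.map_source hz', ?_⟩
    simp only [mem_preimage]
    rw [e'.left_inv hz']
    exact e.map_target hz
  · rintro ⟨hw, hw'⟩
    refine ⟨e (e'.symm w), ⟨e.map_source hw', ?_⟩, ?_⟩
    · simp only [mem_preimage]
      rw [e.left_inv hw']; exact e'.map_target hw
    · simp only
      rw [e.left_inv hw', e'.right_inv hw]

lemma injOn_transition (e e' : OpenPartialHomeomorph M (Cn n)) :
    InjOn (fun z => e' (e.symm z)) (e.target ∩ e.symm ⁻¹' e'.source) := by
  intro z hz w hw h
  exact e.symm.injOn hz.1 hw.1 (e'.injOn hz.2 hw.2 h)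

/-- Change of variables for top degree forms. -/
lemma integral_transition [IsManifold 𝓘(ℂ, Cn n) ω M]
    (he : e ∈ IsManifold.maximalAtlas 𝓘(ℂ, Cn n) ω M)
    (he' : e' ∈ IsManifold.maximalAtlas 𝓘(ℂ, Cn n) ω M) (η : Form n M (2 * n)) (c : M → ℂ) :
    (IntegrableOn (fun z => c (e'.symm z) * pullbackForm e'.symm η z (stdFrame n))
      (e'.target ∩ e'.symm ⁻¹' e.source) ↔
    IntegrableOn (fun z => c (e.symm z) * pullbackForm e.symm η z (stdFrame n))
      (e.target ∩ e.symm ⁻¹' e'.source)) ∧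
    ∫ z in e'.target ∩ e'.symm ⁻¹' e.source,
      c (e'.symm z) * pullbackForm e'.symm η z (stdFrame n) =
    ∫ z in e.target ∩ e.symm ⁻¹' e'.source,
      c (e.symm z) * pullbackForm e.symm η z (stdFrame n) := by
  have hS := (isOpen_transition e e').measurableSet
  have hd : ∀ z ∈ e.target ∩ e.symm ⁻¹' e'.source,
      HasFDerivWithinAt (fun z => e' (e.symm z))
        ((fderiv ℂ (fun z => e' (e.symm z)) z).restrictScalars ℝ)
        (e.target ∩ e.symm ⁻¹' e'.source) z := fun z hz =>
    ((((transition_contDiffOn he he').contDiffAt ((isOpen_transition e e').mem_nhds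
      hz)).differentiableAt (by simp)).hasFDerivAt.restrictScalars ℝ).hasFDerivWithinAt
  have hpt : ∀ z ∈ e.target ∩ e.symm ⁻¹' e'.source,
      |((fderiv ℂ (fun z => e' (e.symm z)) z).restrictScalars ℝ).det| •
        (c (e'.symm (e' (e.symm z))) *
          pullbackForm e'.symm η (e' (e.symm z)) (stdFrame n)) =
      c (e.symm z) * pullbackForm e.symm η z (stdFrame n) := by
    intro z hz
    rw [pullbackForm_transition_top he he' hz.1 hz.2, e'.left_inv hz.2, mul_smul_comm]
  rw [← image_transition]
  constructor
  · rw [integrableOn_image_iff_integrableOn_abs_det_fderiv_smul _ hS hd (injOn_transition e e')]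
    exact integrableOn_congr_fun hpt hS
  · rw [integral_image_eq_integral_abs_det_fderiv_smul _ hS hd (injOn_transition e e')]
    exact setIntegral_congr_fun hS hpt

lemma SmoothPartitionOfUnity.sum_fin_eq_one {r : ℕ}
    (ρ : SmoothPartitionOfUnity (Fin r) 𝓘(ℝ, Cn n) M) (x : M) : ∑ j, (ρ j x : ℂ) = 1 := by
  have := ρ.sum_eq_one (mem_univ x)
  rw [finsum_eq_sum_of_fintype] at this
  exact_mod_cast this

lemma SmoothPartitionOfUnity.eq_zero_of_notMem {r : ℕ}
    {ρ : SmoothPartitionOfUnity (Fin r) 𝓘(ℝ, Cn n) M} {U : Fin r → Set M}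
    (h : ρ.IsSubordinate U) {j : Fin r} {x : M} (hx : x ∉ U j) : ρ j x = 0 := by
  by_contra hne
  exact hx (h j (subset_tsupport _ hne))

/-- A form vanishing off the domain of a chart is integrated in that chart. -/
lemma hasFormIntegral_of_chart [IsManifold 𝓘(ℂ, Cn n) ω M] {η : Form n M (2 * n)}
    (he : e ∈ IsManifold.maximalAtlas 𝓘(ℂ, Cn n) ω M) (h0 : ∀ x ∉ e.source, η x = 0)
    (hi : IntegrableOn (fun z => pullbackForm e.symm η z (stdFrame n)) e.target) :
    HasFormIntegral η (∫ z in e.target, pullbackForm e.symm η z (stdFrame n)) := by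
  intro r e' ρ he' hρ
  have hcont : ∀ j, ContinuousOn (fun z => (ρ j (e.symm z) : ℂ)) e.target := fun j =>
    Complex.continuous_ofReal.comp_continuousOn
      ((ρ j).contMDiff.continuous.comp_continuousOn e.continuousOn_symm)
  have hρi : ∀ j, IntegrableOn
      (fun z => (ρ j (e.symm z) : ℂ) * pullbackForm e.symm η z (stdFrame n)) e.target := by
    intro j
    refine Integrable.bdd_mul (c := 1) hi
      ((hcont j).aestronglyMeasurable e.open_target.measurableSet) (Eventually.of_forall fun z => ?_)
    rw [Complex.norm_real, Real.norm_of_nonneg (ρ.nonneg j _)]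
    exact ρ.le_one j _
  have h1 : ∀ j, ∀ z ∈ (e' j).target \ ((e' j).target ∩ (e' j).symm ⁻¹' e.source),
      (ρ j ((e' j).symm z) : ℂ) * pullbackForm (e' j).symm η z (stdFrame n) = 0 := by
    intro j z hz
    have : η ((e' j).symm z) = 0 := h0 _ fun h => hz.2 ⟨hz.1, h⟩
    simp [pullbackForm, this]
  have h2 : ∀ j, ∀ z ∈ e.target \ (e.target ∩ e.symm ⁻¹' (e' j).source),
      (ρ j (e.symm z) : ℂ) * pullbackForm e.symm η z (stdFrame n) = 0 := by
    intro j z hz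
    rw [SmoothPartitionOfUnity.eq_zero_of_notMem hρ fun h => hz.2 ⟨hz.1, h⟩]
    simp
  -- Both integrals live on the overlap of the two charts: on one side because `η` vanishes off
  -- `e.source`, on the other because `ρ j` vanishes off the domain of `e' j`.
  have h3 : ∀ j, ∫ z in (e' j).target,
      (ρ j ((e' j).symm z) : ℂ) * pullbackForm (e' j).symm η z (stdFrame n) =
      ∫ z in e.target, (ρ j (e.symm z) : ℂ) * pullbackForm e.symm η z (stdFrame n) := by
    intro j
    rw [setIntegral_eq_of_subset_of_forall_sdiff_eq_zero (e' j).open_target.measurableSet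
      inter_subset_left (h1 j), setIntegral_eq_of_subset_of_forall_sdiff_eq_zero
      e.open_target.measurableSet inter_subset_left (h2 j)]
    exact (integral_transition he (he' j) η fun x => (ρ j x : ℂ)).2
  refine ⟨fun j => ?_, ?_⟩
  · refine IntegrableOn.of_forall_sdiff_eq_zero ?_ (e' j).open_target.measurableSet (h1 j)
    exact (integral_transition he (he' j) η fun x => (ρ j x : ℂ)).1.2
      ((hρi j).mono_set inter_subset_left)
  · simp_rw [h3]
    rw [← integral_finsetSum _ fun j _ => hρi j]
    refine setIntegral_congr_fun e.open_target.measurableSet fun z _ => ?_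
    rw [← Finset.sum_mul, ρ.sum_fin_eq_one, one_mul]

lemma HasFormIntegral.add {η θ : Form n M (2 * n)} {J K : ℂ} (h : HasFormIntegral η J)
    (h' : HasFormIntegral θ K) : HasFormIntegral (η + θ) (J + K) := by
  intro r e ρ he hρ
  obtain ⟨h1, h2⟩ := h r e ρ he hρ
  obtain ⟨h1', h2'⟩ := h' r e ρ he hρ
  have e1 : ∀ j, (fun z => (ρ j ((e j).symm z) : ℂ) *
      pullbackForm (e j).symm (η + θ) z (stdFrame n)) = fun z =>
      (ρ j ((e j).symm z) : ℂ) * pullbackForm (e j).symm η z (stdFrame n) +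
      (ρ j ((e j).symm z) : ℂ) * pullbackForm (e j).symm θ z (stdFrame n) := by
    intro j; ext z; simp [pullbackForm, mul_add]
  refine ⟨fun j => by rw [e1]; exact (h1 j).add (h1' j), ?_⟩
  rw [← h2, ← h2', ← Finset.sum_add_distrib]
  exact Finset.sum_congr rfl fun j _ => by rw [e1]; exact integral_add (h1 j) (h1' j)

lemma HasFormIntegral.zero : HasFormIntegral (0 : Form n M (2 * n)) 0 := by
  intro r e ρ he hρ
  simp [pullbackForm]

lemma HasFormIntegral.sum {ι : Type*} (s : Finset ι) {η : ι → Form n M (2 * n)} {J : ι → ℂ}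
    (h : ∀ i ∈ s, HasFormIntegral (η i) (J i)) :
    HasFormIntegral (∑ i ∈ s, η i) (∑ i ∈ s, J i) := by
  classical
  induction s using Finset.induction_on with
  | empty => simpa using HasFormIntegral.zero
  | insert a s ha ih =>
    simp only [Finset.sum_insert ha]
    exact (h a (Finset.mem_insert_self a s)).add
      (ih fun i hi => h i (Finset.mem_insert_of_mem hi))

/-- `HasFormIntegral` quantifies over all subordinate families, so the value is determined only once
one such family is at hand. -/
lemma HasFormIntegral.eq_of_family {η : Form n M (2 * n)} {J K : ℂ} (h : HasFormIntegral η J)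
    (h' : HasFormIntegral η K) {r : ℕ} {e : Fin r → OpenPartialHomeomorph M (Cn n)}
    {ρ : SmoothPartitionOfUnity (Fin r) 𝓘(ℝ, Cn n) M}
    (he : ∀ j, e j ∈ IsManifold.maximalAtlas 𝓘(ℂ, Cn n) ω M)
    (hρ : ρ.IsSubordinate (fun j => (e j).source)) : J = K :=
  (h r e ρ he hρ).2.symm.trans (h' r e ρ he hρ).2

/-- It suffices to integrate a form with one partition of unity. -/
lemma hasFormIntegral_of_family [IsManifold 𝓘(ℂ, Cn n) ω M] {η : Form n M (2 * n)} {r : ℕ}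
    {e : Fin r → OpenPartialHomeomorph M (Cn n)}
    {ρ : SmoothPartitionOfUnity (Fin r) 𝓘(ℝ, Cn n) M}
    (he : ∀ j, e j ∈ IsManifold.maximalAtlas 𝓘(ℂ, Cn n) ω M)
    (hρ : ρ.IsSubordinate (fun j => (e j).source))
    (hi : ∀ j, IntegrableOn (fun z => (ρ j ((e j).symm z) : ℂ) *
      pullbackForm (e j).symm η z (stdFrame n)) (e j).target) :
    HasFormIntegral η (∑ j, ∫ z in (e j).target, (ρ j ((e j).symm z) : ℂ) *
      pullbackForm (e j).symm η z (stdFrame n)) := by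
  -- Each `ρ j • η` vanishes off one chart domain, where `hasFormIntegral_of_chart` handles
  -- arbitrary further families.
  have h1 : η = ∑ j, fun x => (ρ j x : ℂ) • η x := by
    ext1 x
    rw [Finset.sum_apply, ← Finset.sum_smul, ρ.sum_fin_eq_one, one_smul]
  conv => congr; rw [h1]
  exact HasFormIntegral.sum _ fun j _ => hasFormIntegral_of_chart (he j)
    (η := fun x => (ρ j x : ℂ) • η x)
    (fun x hx => by simp [SmoothPartitionOfUnity.eq_zero_of_notMem hρ hx]) (hi j)

end Forms

/-! ### Extension by zero and integrals of derivatives. -/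

section Extension

variable {E F : Type*} [NormedAddCommGroup E] [NormedSpace ℝ E] [NormedAddCommGroup F]
  [NormedSpace ℝ F]

/-- Extension by zero of a smooth function on an open set whose support is closed in the ambient
space. -/
lemma ContDiffOn.contDiff_indicator {f : E → F} {U K : Set E} {r : WithTop ℕ∞}
    (hf : ContDiffOn ℝ r f U)
    (hU : IsOpen U) (hK : IsClosed K) (hKU : K ⊆ U) (h0 : ∀ x ∈ U, x ∉ K → f x = 0) :
    ContDiff ℝ r (U.indicator f) := by
  rw [contDiff_iff_contDiffAt]
  intro x
  by_cases hx : x ∈ U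
  · refine (hf.contDiffAt (hU.mem_nhds hx)).congr_of_eventuallyEq ?_
    filter_upwards [hU.mem_nhds hx] with y hy using indicator_of_mem hy f
  · refine (contDiffAt_const (c := (0 : F))).congr_of_eventuallyEq ?_
    filter_upwards [hK.isOpen_compl.mem_nhds fun h => hx (hKU h)] with y hy
    by_cases hyU : y ∈ U
    · rw [indicator_of_mem hyU, h0 y hyU hy]
    · exact indicator_of_notMem hyU f

lemma hasCompactSupport_indicator {f : E → F} {U K : Set E} (hK : IsCompact K)
    (h0 : ∀ x ∈ U, x ∉ K → f x = 0) : HasCompactSupport (U.indicator f) := by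
  refine HasCompactSupport.intro hK fun x hx => ?_
  by_cases hxU : x ∈ U
  · rw [indicator_of_mem hxU, h0 x hxU hx]
  · exact indicator_of_notMem hxU f

lemma integrableOn_of_support_compact [MeasurableSpace E] [BorelSpace E] {μ : Measure E}
    [IsFiniteMeasureOnCompacts μ] {f : E → F} {U K : Set E}
    (hU : IsOpen U) (hf : ContinuousOn f U) (hK : IsCompact K) (hKU : K ⊆ U)
    (h0 : ∀ x ∈ U, x ∉ K → f x = 0) : IntegrableOn f U μ :=
  IntegrableOn.of_forall_sdiff_eq_zero ((hf.mono hKU).integrableOn_compact hK)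
    hU.measurableSet fun x hx => h0 x hx.1 hx.2

lemma integral_fderiv_eq_zero_of_compactSupport {n : ℕ} {h : Cn n → ℂ} (hh : ContDiff ℝ 1 h)
    (hs : HasCompactSupport h) (v : Cn n) : ∫ z, fderiv ℝ h z v = 0 := by
  have hi : Integrable fun z => fderiv ℝ h z v := by
    refine Continuous.integrable_of_hasCompactSupport ?_ ?_
    · exact (hh.continuous_fderiv one_ne_zero).clm_apply continuous_const
    · exact (hs.fderiv (𝕜 := ℝ)).comp_left (g := fun L : Cn n →L[ℝ] ℂ => L v) rfl
  have := integral_mul_fderiv_eq_neg_fderiv_mul_of_integrable (μ := (volume : Measure (Cn n)))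
    (f := fun _ => (1 : ℂ)) (g := h) (v := v) (by simp) (by simpa using hi)
    (by simpa using hh.continuous.integrable_of_hasCompactSupport hs)
    (fun x _ => differentiableAt_const _) (fun x _ => hh.differentiable one_ne_zero x)
  simpa using this

/-- Outside `U` the function is arbitrary, as for expressions in a chart. Its extension by zero is
smooth with compact support, and has the same derivative on `U`. -/
lemma setIntegral_fderiv_eq_zero {n : ℕ} {f : Cn n → ℂ} {U K : Set (Cn n)} (hU : IsOpen U)
    (hf : ContDiffOn ℝ ∞ f U) (hK : IsCompact K) (hKU : K ⊆ U)
    (h0 : ∀ x ∈ U, x ∉ K → f x = 0) (v : Cn n) :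
    IntegrableOn (fun z => fderiv ℝ f z v) U ∧ ∫ z in U, fderiv ℝ f z v = 0 := by
  have hd0 : ∀ x ∈ U, x ∉ K → fderiv ℝ f x v = 0 := by
    intro x hx hxK
    have : f =ᶠ[𝓝 x] fun _ => 0 := by
      filter_upwards [hU.mem_nhds hx, hK.isClosed.isOpen_compl.mem_nhds hxK] with y hy hy'
        using h0 y hy hy'
    rw [this.fderiv_eq]; simp
  have hc : ContinuousOn (fun z => fderiv ℝ f z v) U :=
    (hf.continuousOn_fderiv_of_isOpen hU (by simp)).clm_apply continuousOn_const
  refine ⟨integrableOn_of_support_compact hU hc hK hKU hd0, ?_⟩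
  have h1 := (hf.contDiff_indicator hU hK.isClosed hKU h0)
  have h2 : ∫ z in U, fderiv ℝ (U.indicator f) z v = ∫ z, fderiv ℝ (U.indicator f) z v := by
    refine setIntegral_eq_integral_of_forall_compl_eq_zero fun x hx => ?_
    have : U.indicator f =ᶠ[𝓝 x] fun _ => 0 := by
      filter_upwards [hK.isClosed.isOpen_compl.mem_nhds fun h => hx (hKU h)] with y hy
      by_cases hyU : y ∈ U
      · rw [indicator_of_mem hyU, h0 y hyU hy]
      · exact indicator_of_notMem hyU f
    rw [this.fderiv_eq]; simp
  rw [← integral_fderiv_eq_zero_of_compactSupport (h1.of_le (by simp))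
    (hasCompactSupport_indicator hK h0) v, ← h2]
  refine setIntegral_congr_fun hU.measurableSet fun z hz => ?_
  have : U.indicator f =ᶠ[𝓝 z] f := by
    filter_upwards [hU.mem_nhds hz] with y hy using indicator_of_mem hy f
  beta_reduce
  rw [this.fderiv_eq]

end Extension

/-! ### Stokes' theorem for `∂` and `∂̄` in top degree. -/

section Stokes

variable {n k : ℕ}
variable {M : Type*} [TopologicalSpace M] [ChartedSpace (Cn n) M]

/-- The differential of a real function at `x`, on the model tangent space. -/
def realDiff (f : M → ℝ) (x : M) : Cn n →L[ℝ] ℝ :=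
  fderiv ℝ (fun w => f ((chartAt (Cn n) x).symm w)) (chartAt (Cn n) x x)

/-- Tangent spaces are identified with the model space through the preferred chart, so the
differential of `e.symm` is that of a transition map. -/
lemma tangentLin_chart_symm [IsManifold 𝓘(ℂ, Cn n) ω M] {e : OpenPartialHomeomorph M (Cn n)}
    (he : e ∈ IsManifold.maximalAtlas 𝓘(ℂ, Cn n) ω M) {z : Cn n} (hz : z ∈ e.target) :
    tangentLin (n := n) (m := n) e.symm z =
      fderiv ℂ (fun y => chartAt (Cn n) (e.symm z) (e.symm y)) z := by
  have h := (mdifferentiableAt_chart_symm he hz).mfderiv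
  simp only [writtenInExtChartAt, mfld_simps, Function.comp_def] at h
  rw [fderivWithin_univ] at h
  exact h

lemma fderiv_comp_chart_symm [IsManifold 𝓘(ℂ, Cn n) ω M] {e : OpenPartialHomeomorph M (Cn n)}
    (he : e ∈ IsManifold.maximalAtlas 𝓘(ℂ, Cn n) ω M) {z : Cn n} (hz : z ∈ e.target)
    {f : M → ℝ} (hf : ContMDiff 𝓘(ℝ, Cn n) 𝓘(ℝ, ℝ) ∞ f) (v : Cn n) :
    fderiv ℝ (fun y => f (e.symm y)) z v =
      realDiff f (e.symm z) (tangentLin (n := n) (m := n) e.symm z v) := by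
  set c := chartAt (Cn n) (e.symm z) with hc
  have hcm : c ∈ IsManifold.maximalAtlas 𝓘(ℂ, Cn n) ω M :=
    IsManifold.chart_mem_maximalAtlas _
  have hzc : e.symm z ∈ c.source := mem_chart_source _ _
  have h1 : HasFDerivAt (fun y => c (e.symm y))
      ((fderiv ℂ (fun y => c (e.symm y)) z).restrictScalars ℝ) z :=
    (((transition_contDiffOn he hcm).contDiffAt ((isOpen_transition e c).mem_nhds
      ⟨hz, hzc⟩)).differentiableAt (by simp)).hasFDerivAt.restrictScalars ℝ
  have h2 : HasFDerivAt (fun w => f (c.symm w)) (realDiff f (e.symm z)) (c (e.symm z)) :=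
    (((hf.contDiffOn_chart hcm).contDiffAt (c.open_target.mem_nhds
      (c.map_source hzc))).differentiableAt (by simp)).hasFDerivAt
  have h3 := h2.comp z h1
  have h4 : (fun y => f (e.symm y)) =ᶠ[𝓝 z] (fun w => f (c.symm w)) ∘ fun y => c (e.symm y) := by
    filter_upwards [(isOpen_transition e c).mem_nhds ⟨hz, hzc⟩] with y hy
    simp only [Function.comp_apply]
    rw [c.left_inv hy.2]
  rw [h4.fderiv_eq, h3.fderiv, tangentLin_chart_symm he hz]
  rfl

lemma realDiff_eq_zero {f : M → ℝ} {x : M} (hx : x ∉ tsupport f) :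
    realDiff (n := n) f x = 0 := by
  have h : (fun w => f ((chartAt (Cn n) x).symm w)) =ᶠ[𝓝 (chartAt (Cn n) x x)] fun _ => 0 := by
    have h1 : ∀ᶠ y in 𝓝 x, f y = 0 := by
      filter_upwards [(isClosed_tsupport f).isOpen_compl.mem_nhds hx] with y hy
      exact image_eq_zero_of_notMem_tsupport hy
    have h2 := (chartAt (Cn n) x).continuousAt_symm (mem_chart_target (Cn n) x)
    rw [ContinuousAt, (chartAt (Cn n) x).left_inv (mem_chart_source _ x)] at h2
    exact h2.eventually h1
  rw [realDiff, h.fderiv_eq]; simp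

lemma sum_realDiff_eq_zero [IsManifold 𝓘(ℂ, Cn n) ω M] {r : ℕ}
    (ρ : SmoothPartitionOfUnity (Fin r) 𝓘(ℝ, Cn n) M) (x : M) :
    ∑ j, realDiff (n := n) (ρ j) x = 0 := by
  simp only [realDiff]
  rw [← fderiv_fun_sum]
  · have : (fun w => ∑ j, ρ j ((chartAt (Cn n) x).symm w)) = fun _ => (1 : ℝ) := by
      ext w
      exact_mod_cast ρ.sum_fin_eq_one ((chartAt (Cn n) x).symm w)
    rw [this]; simp
  · intro j _
    exact (((ρ j).contMDiff.contDiffOn_chart (IsManifold.chart_mem_maximalAtlas x)).contDiffAt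
      ((chartAt (Cn n) x).open_target.mem_nhds (mem_chart_target _ x))).differentiableAt (by simp)

/-- The operators `∂` (`ε = -1`) and `∂̄` (`ε = 1`) in the coordinates of `ℂⁿ`. -/
def dolbeaultFlat (ε : ℂ) (u : Form n (Cn n) k) (z : Cn n) (v : Fin (k + 1) → Cn n) : ℂ :=
  ∑ i : Fin (k + 1), (-1) ^ (i : ℕ) * ((1 / 2 : ℂ) *
    (fderiv ℝ (fun y => u y (i.removeNth v)) z (v i)
      + ε * (Complex.I * fderiv ℝ (fun y => u y (i.removeNth v)) z (Complex.I • v i))))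

lemma delFlat_eq (u : Form n (Cn n) k) (z : Cn n) (v : Fin (k + 1) → Cn n) :
    delFlat u z v = dolbeaultFlat (-1) u z v := by
  simp only [delFlat, dolbeaultFlat, neg_one_mul, sub_eq_add_neg]

lemma delbarFlat_eq (u : Form n (Cn n) k) (z : Cn n) (v : Fin (k + 1) → Cn n) :
    delbarFlat u z v = dolbeaultFlat 1 u z v := by
  simp only [delbarFlat, dolbeaultFlat, one_mul]

/-- The forms `∂f` (`ε = -1`) and `∂̄f` (`ε = 1`) of a real covector. -/
def dolbeaultPart (ε : ℂ) : (Cn n →L[ℝ] ℝ) →ₗ[ℝ] (Cn n →ₗ[ℝ] ℂ) where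
  toFun L := (1 / 2 : ℂ) • (Complex.ofRealCLM.toLinearMap ∘ₗ L.toLinearMap +
    (ε * Complex.I) • (Complex.ofRealCLM.toLinearMap ∘ₗ L.toLinearMap ∘ₗ
      ((LinearMap.lsmul ℂ (Cn n) Complex.I).restrictScalars ℝ)))
  map_add' L L' := by ext v; simp; ring
  map_smul' c L := by ext v; simp; ring

/-- The form `∂f ∧ η` (`ε = -1`) or `∂̄f ∧ η` (`ε = 1`). -/
def dolbeaultWedge (ε : ℂ) (f : M → ℝ) (η : Form n M k) : Form n M (k + 1) := fun x =>
  AlternatingMap.alternatizeUncurryFin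
    ((dolbeaultPart ε (realDiff f x)).smulRight (η x))

lemma dolbeaultWedge_apply (ε : ℂ) (f : M → ℝ) (η : Form n M k) (x : M)
    (v : Fin (k + 1) → Cn n) :
    dolbeaultWedge ε f η x v = ∑ i : Fin (k + 1), (-1) ^ (i : ℕ) * ((1 / 2 : ℂ) *
      ((realDiff f x (v i) : ℂ) + ε * (Complex.I * (realDiff f x (Complex.I • v i) : ℂ))) *
        η x (i.removeNth v)) := by
  simp only [dolbeaultWedge, AlternatingMap.alternatizeUncurryFin_apply, dolbeaultPart]
  refine Finset.sum_congr rfl fun i _ => ?_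
  simp
  left
  ring

variable [IsManifold 𝓘(ℂ, Cn n) ω M] {e : OpenPartialHomeomorph M (Cn n)}

/-- The Leibniz rule. -/
lemma dolbeaultFlat_mul (he : e ∈ IsManifold.maximalAtlas 𝓘(ℂ, Cn n) ω M) {η : Form n M k}
    (hη : IsSmoothFormOn η univ) {f : M → ℝ} (hf : ContMDiff 𝓘(ℝ, Cn n) 𝓘(ℝ, ℝ) ∞ f)
    (ε : ℂ) {z : Cn n} (hz : z ∈ e.target) (v : Fin (k + 1) → Cn n) :
    dolbeaultFlat ε (pullbackForm e.symm fun x => (f x : ℂ) • η x) z v =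
      f (e.symm z) * dolbeaultFlat ε (pullbackForm e.symm η) z v +
        pullbackForm e.symm (dolbeaultWedge ε f η) z v := by
  have h1 : ∀ w : Fin k → Cn n, ∀ y : Cn n,
      fderiv ℝ (fun y => pullbackForm e.symm (fun x => (f x : ℂ) • η x) y w) z y =
      f (e.symm z) * fderiv ℝ (fun y => pullbackForm e.symm η y w) z y +
      (realDiff f (e.symm z) (tangentLin (n := n) (m := n) e.symm z y) : ℂ) *
        pullbackForm e.symm η z w := by
    intro w y
    have hd1 : DifferentiableAt ℝ (fun y => f (e.symm y)) z :=
      ((hf.contDiffOn_chart he).contDiffAt (e.open_target.mem_nhds hz)).differentiableAt (by simp)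
    have hd2 : DifferentiableAt ℝ (fun y => pullbackForm e.symm η y w) z := by
      have := hη e he w
      rw [preimage_univ, inter_univ] at this
      exact (this.contDiffAt (e.open_target.mem_nhds hz)).differentiableAt (by simp)
    have hd3 := Complex.ofRealCLM.hasFDerivAt.comp z hd1.hasFDerivAt
    have hd4 := hd3.mul hd2.hasFDerivAt
    have e1 : (fun y => pullbackForm e.symm (fun x => (f x : ℂ) • η x) y w) =
        (Complex.ofRealCLM ∘ fun y => f (e.symm y)) * fun y => pullbackForm e.symm η y w := by
      ext y; simp [pullbackForm]
    rw [e1, hd4.fderiv, ← fderiv_comp_chart_symm he hz hf]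
    simp [mul_comm]
  simp only [dolbeaultFlat, h1]
  have h2 : pullbackForm e.symm (dolbeaultWedge ε f η) z v =
      dolbeaultWedge ε f η (e.symm z)
        (fun i => tangentLin (n := n) (m := n) e.symm z (v i)) := rfl
  rw [h2, dolbeaultWedge_apply, Finset.mul_sum, ← Finset.sum_add_distrib]
  refine Finset.sum_congr rfl fun i _ => ?_
  have h3 : ∀ y : Cn n, tangentLin (n := n) (m := n) e.symm z (Complex.I • y) =
      Complex.I • tangentLin (n := n) (m := n) e.symm z y := fun y =>
    map_smul (tangentLin (n := n) (m := n) e.symm z) Complex.I y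
  have h4 : pullbackForm e.symm η z (i.removeNth v) = η (e.symm z)
      (i.removeNth fun i => tangentLin (n := n) (m := n) e.symm z (v i)) := rfl
  rw [h3, h4]
  ring

lemma isCompact_image_tsupport [CompactSpace M] {f : M → ℝ} (h : tsupport f ⊆ e.source) :
    IsCompact (e '' tsupport f) ∧ e '' tsupport f ⊆ e.target ∧
      ∀ z ∈ e.target, z ∉ e '' tsupport f → f (e.symm z) = 0 := by
  refine ⟨(isClosed_tsupport f).isCompact.image_of_continuousOn (e.continuousOn.mono h),
    fun z hz => ?_, fun z hz hzK => ?_⟩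
  · obtain ⟨x, hx, rfl⟩ := hz
    exact e.map_source (h hx)
  · refine image_eq_zero_of_notMem_tsupport fun hx => hzK ⟨_, hx, e.right_inv hz⟩

/-- The integral of `f · ∂η`, for `f` supported in the domain of a chart, is that of `- ∂f ∧ η`. -/
lemma integral_dolbeaultFlat [CompactSpace M]
    (he : e ∈ IsManifold.maximalAtlas 𝓘(ℂ, Cn n) ω M)
    {η : Form n M k} (hη : IsSmoothFormOn η univ) {f : M → ℝ}
    (hf : ContMDiff 𝓘(ℝ, Cn n) 𝓘(ℝ, ℝ) ∞ f) (hfe : tsupport f ⊆ e.source)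
    (ε : ℂ) (v : Fin (k + 1) → Cn n) :
    IntegrableOn (fun z => f (e.symm z) * dolbeaultFlat ε (pullbackForm e.symm η) z v) e.target ∧
    IntegrableOn (fun z => pullbackForm e.symm (dolbeaultWedge ε f η) z v) e.target ∧
    ∫ z in e.target, f (e.symm z) * dolbeaultFlat ε (pullbackForm e.symm η) z v =
      -∫ z in e.target, pullbackForm e.symm (dolbeaultWedge ε f η) z v := by
  obtain ⟨hK, hKU, h0⟩ := isCompact_image_tsupport (e := e) hfe
  have hu : ∀ w : Fin k → Cn n, ContDiffOn ℝ ∞ (fun z => pullbackForm e.symm η z w) e.target := fun w => by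
    simpa using hη e he w
  have hfs : ContDiffOn ℝ ∞ (fun z => (f (e.symm z) : ℂ)) e.target :=
    Complex.ofRealCLM.contDiff.comp_contDiffOn (hf.contDiffOn_chart he)
  have hfu : ∀ w : Fin k → Cn n, ContDiffOn ℝ ∞
      (fun z => pullbackForm e.symm (fun x => (f x : ℂ) • η x) z w) e.target := fun w => by
    simpa [pullbackForm] using hfs.mul (hu w)
  have hz0 : ∀ w : Fin k → Cn n, ∀ z ∈ e.target, z ∉ e '' tsupport f →
      pullbackForm e.symm (fun x => (f x : ℂ) • η x) z w = 0 := fun w z hz hzK => by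
    simp [pullbackForm, h0 z hz hzK]
  -- The coefficients of `f η` have compact support in the chart, so all their derivatives integrate
  -- to zero; the Leibniz rule then moves the operator from `η` to `f`.
  have hA := fun (w : Fin k → Cn n) (y : Cn n) =>
    setIntegral_fderiv_eq_zero e.open_target (hfu w) hK hKU (hz0 w) y
  have hA1 : ∀ i : Fin (k + 1), IntegrableOn (fun z => (-1) ^ (i : ℕ) * ((1 / 2 : ℂ) *
      (fderiv ℝ (fun y => pullbackForm e.symm (fun x => (f x : ℂ) • η x) y (i.removeNth v)) z (v i)
      + ε * (Complex.I * fderiv ℝ (fun y => pullbackForm e.symm (fun x => (f x : ℂ) • η x) y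
        (i.removeNth v)) z (Complex.I • v i))))) e.target := fun i =>
    (((hA (i.removeNth v) (v i)).1.add (((hA (i.removeNth v) (Complex.I • v i)).1.const_mul
      Complex.I).const_mul ε)).const_mul (1 / 2 : ℂ)).const_mul ((-1) ^ (i : ℕ))
  have hW : IntegrableOn (fun z => dolbeaultFlat ε
      (pullbackForm e.symm fun x => (f x : ℂ) • η x) z v) e.target :=
    integrable_finsetSum Finset.univ fun i _ => hA1 i
  have hW0 : ∫ z in e.target, dolbeaultFlat ε
      (pullbackForm e.symm fun x => (f x : ℂ) • η x) z v = 0 := by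
    simp only [dolbeaultFlat]
    rw [integral_finsetSum _ fun i _ => hA1 i]
    refine Finset.sum_eq_zero fun i _ => ?_
    rw [integral_const_mul, integral_const_mul, integral_add (hA _ _).1
      (((hA _ _).1.const_mul _).const_mul _), integral_const_mul, integral_const_mul,
      (hA _ _).2, (hA _ _).2]
    simp
  have hI : IntegrableOn
      (fun z => f (e.symm z) * dolbeaultFlat ε (pullbackForm e.symm η) z v) e.target := by
    refine integrableOn_of_support_compact e.open_target (hfs.continuousOn.mul ?_) hK hKU
      fun z hz hzK => by rw [h0 z hz hzK]; simp
    have hc : ∀ w y, ContinuousOn (fun z => fderiv ℝ (fun y => pullbackForm e.symm η y w) z y)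
        e.target := fun w y =>
      ((hu w).continuousOn_fderiv_of_isOpen e.open_target (by simp)).clm_apply continuousOn_const
    unfold dolbeaultFlat
    refine continuousOn_finsetSum _ fun i _ => ?_
    exact continuousOn_const.mul (continuousOn_const.mul
      ((hc _ _).add (continuousOn_const.mul (continuousOn_const.mul (hc _ _)))))
  have hL : ∀ z ∈ e.target, pullbackForm e.symm (dolbeaultWedge ε f η) z v =
      dolbeaultFlat ε (pullbackForm e.symm fun x => (f x : ℂ) • η x) z v -
      f (e.symm z) * dolbeaultFlat ε (pullbackForm e.symm η) z v := fun z hz => by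
    rw [dolbeaultFlat_mul he hη hf ε hz]; ring
  refine ⟨hI, ?_, ?_⟩
  · exact (hW.sub hI).congr_fun (fun z hz => (hL z hz).symm) e.open_target.measurableSet
  · rw [setIntegral_congr_fun e.open_target.measurableSet hL, integral_sub hW hI, hW0]
    simp

lemma sum_dolbeaultWedge_eq_zero {r : ℕ} (ρ : SmoothPartitionOfUnity (Fin r) 𝓘(ℝ, Cn n) M)
    (ε : ℂ) (η : Form n M k) : ∑ j, dolbeaultWedge ε (ρ j) η = 0 := by
  ext x v
  have h0 : ∀ s : Finset (Fin r), (∑ j ∈ s, dolbeaultWedge ε (ρ j) η) x v =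
      ∑ j ∈ s, dolbeaultWedge ε (ρ j) η x v := by
    intro s
    induction s using Finset.induction_on with
    | empty => simp
    | insert a s ha ih => simp only [Finset.sum_insert ha, ← ih]; rfl
  rw [h0]
  simp only [dolbeaultWedge_apply, Pi.zero_apply, AlternatingMap.zero_apply]
  rw [Finset.sum_comm]
  refine Finset.sum_eq_zero fun i _ => ?_
  have h : ∀ y : Cn n, ∑ j, (realDiff (ρ j) x y : ℂ) = 0 := fun y => by
    have := congrArg (fun L : Cn n →L[ℝ] ℝ => L y) (sum_realDiff_eq_zero ρ x)
    simp only [_root_.sum_apply] at this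
    exact_mod_cast this
  rw [← Finset.mul_sum, ← Finset.sum_mul, ← Finset.mul_sum, Finset.sum_add_distrib,
    ← Finset.mul_sum, ← Finset.mul_sum, h, h]
  simp

lemma tsupport_subset_of_isSubordinate {r : ℕ} {ρ : SmoothPartitionOfUnity (Fin r) 𝓘(ℝ, Cn n) M}
    {U : Fin r → Set M} (h : ρ.IsSubordinate U) (j : Fin r) : tsupport (ρ j) ⊆ U j := h j

/-- Stokes' theorem: top degree forms in `im ∂ + im ∂̄` have vanishing integral. -/
lemma IsAeppliExact.hasFormIntegral_zero [CompactSpace M] {θ : Form n M (2 * n)}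
    (h : IsAeppliExact (2 * n) θ) : HasFormIntegral θ 0 := by
  obtain _ | m := n
  · have : θ = 0 := h
    rw [this]; exact HasFormIntegral.zero
  -- The degree `2 * (m + 1)` is a successor only up to unfolding, so the definition has to be
  -- exposed by hand. The same mismatch of degrees calls for `erw` below.
  change IsAeppliExact (2 * m + 1 + 1) θ at h
  obtain ⟨η, ν, hη, hν, h⟩ := h
  intro r e ρ he hρ
  have hη' := fun j => integral_dolbeaultFlat (he j) hη (ρ j).contMDiff
    (tsupport_subset_of_isSubordinate hρ j) (-1) (stdFrame (m + 1))
  have hν' := fun j => integral_dolbeaultFlat (he j) hν (ρ j).contMDiff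
    (tsupport_subset_of_isSubordinate hρ j) 1 (stdFrame (m + 1))
  have e1 : ∀ j, ∀ z ∈ (e j).target, (ρ j ((e j).symm z) : ℂ) *
      pullbackForm (e j).symm θ z (stdFrame (m + 1)) =
      ρ j ((e j).symm z) * dolbeaultFlat (-1) (pullbackForm (e j).symm η) z (stdFrame (m + 1)) +
      ρ j ((e j).symm z) * dolbeaultFlat 1 (pullbackForm (e j).symm ν) z (stdFrame (m + 1)) := by
    intro j z hz
    have := h (e j) (he j) z hz (stdFrame (m + 1))
    rw [delFlat_eq, delbarFlat_eq] at this
    rw [← mul_add, ← this]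
  refine ⟨fun j => ((hη' j).1.add (hν' j).1).congr_fun (fun z hz => (e1 j z hz).symm)
    (e j).open_target.measurableSet, ?_⟩
  -- The integral of `θ` is `-∑ⱼ ∫ W j`. The forms `W j = ∂ρⱼ ∧ η + ∂̄ρⱼ ∧ ν` are globally defined,
  -- and they add up to zero because `∑ⱼ ρⱼ = 1`. Since each `W j` vanishes off one chart domain,
  -- its integral there is its integral over `M`, and the sum may be taken before integrating.
  let W : Fin r → Form (m + 1) M (2 * (m + 1)) := fun j =>
    dolbeaultWedge (-1) (ρ j) η + dolbeaultWedge 1 (ρ j) ν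
  have hW0 : ∑ j, W j = 0 := by
    simp only [W]
    rw [Finset.sum_add_distrib]
    have h1 := sum_dolbeaultWedge_eq_zero ρ (-1) η
    have h2 := sum_dolbeaultWedge_eq_zero ρ 1 ν
    erw [h1, h2]
    exact add_zero _
  have hWp : ∀ j, (fun z => pullbackForm (e j).symm (W j) z (stdFrame (m + 1))) = fun z =>
      pullbackForm (e j).symm (dolbeaultWedge (-1) (ρ j) η) z (stdFrame (m + 1)) +
      pullbackForm (e j).symm (dolbeaultWedge 1 (ρ j) ν) z (stdFrame (m + 1)) := fun j => rfl
  have hWj : ∀ j, HasFormIntegral (W j)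
      (∫ z in (e j).target, pullbackForm (e j).symm (W j) z (stdFrame (m + 1))) := by
    intro j
    refine hasFormIntegral_of_chart (he j) (fun x hx => ?_) ?_
    · have : realDiff (n := m + 1) (ρ j) x = 0 := realDiff_eq_zero fun h' =>
        hx (tsupport_subset_of_isSubordinate hρ j h')
      ext v
      change dolbeaultWedge (-1) (ρ j) η x v + dolbeaultWedge 1 (ρ j) ν x v = 0
      simp [dolbeaultWedge_apply, this]
    · rw [hWp]
      exact (hη' j).2.1.add (hν' j).2.1
  have hsum := HasFormIntegral.sum Finset.univ fun j _ => hWj j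
  rw [hW0] at hsum
  have hzero := hsum.eq_of_family HasFormIntegral.zero he hρ
  have e2 : ∀ j, ∫ z in (e j).target, (ρ j ((e j).symm z) : ℂ) *
      pullbackForm (e j).symm θ z (stdFrame (m + 1)) =
      -∫ z in (e j).target, pullbackForm (e j).symm (W j) z (stdFrame (m + 1)) := by
    intro j
    rw [setIntegral_congr_fun (e j).open_target.measurableSet (e1 j),
      integral_add (hη' j).1 (hν' j).1, (hη' j).2.2, (hν' j).2.2, hWp,
      integral_add (hη' j).2.1 (hν' j).2.1, neg_add]
  simp_rw [e2]
  rw [Finset.sum_neg_distrib, hzero, neg_zero]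

end Stokes

/-! ### Hadamard's lemma: division by the first coordinate. -/

section Hadamard

variable {n : ℕ}

lemma dense_ne_zero (n : ℕ) : Dense {z : Cn (n + 1) | z 0 ≠ 0} :=
  Measure.dense_of_ae (ae_ne_zero n)

/-- The point `z` with its first coordinate multiplied by `t`. -/
def scaleFst (t : ℝ) (z : Cn (n + 1)) : Cn (n + 1) := z + Pi.single 0 (((t : ℂ) - 1) * z 0)

lemma scaleFst_one (z : Cn (n + 1)) : scaleFst 1 z = z := by simp [scaleFst]

lemma scaleFst_apply_zero (t : ℝ) (z : Cn (n + 1)) : scaleFst t z 0 = t * z 0 := by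
  simp [scaleFst]; ring

lemma scaleFst_apply_ne (t : ℝ) (z : Cn (n + 1)) {i : Fin (n + 1)} (hi : i ≠ 0) :
    scaleFst t z i = z i := by
  simp [scaleFst, hi]

lemma contDiff_scaleFst : ContDiff ℝ ∞ (fun p : Cn (n + 1) × ℝ => scaleFst p.2 p.1) := by
  unfold scaleFst
  refine contDiff_fst.add ?_
  have h : ContDiff ℝ ∞ (fun p : Cn (n + 1) × ℝ => ((p.2 : ℂ) - 1) * p.1 0) :=
    ((Complex.ofRealCLM.contDiff.comp contDiff_snd).sub contDiff_const).mul
      ((contDiff_apply ℝ ℂ (0 : Fin (n + 1))).comp contDiff_fst)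
  exact (ContinuousLinearMap.single ℝ (fun _ : Fin (n + 1) => ℂ) 0).contDiff.comp h

lemma scaleFst_mem_ball {a : Cn (n + 1)} (ha : a 0 = 0) {r C t : ℝ} (hC : 1 ≤ C) (ht : |t| ≤ C)
    {z : Cn (n + 1)} (hz : z ∈ Metric.ball a (r / C)) : scaleFst t z ∈ Metric.ball a r := by
  have hC0 : 0 < C := by linarith
  rw [mem_ball_iff_norm] at *
  have hr : 0 < r := by
    have := (norm_nonneg _).trans_lt hz
    exact (div_pos_iff_of_pos_right hC0).1 this
  have hz' : ‖z - a‖ < r := hz.trans_le (div_le_self hr.le hC)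
  rw [pi_norm_lt_iff hr]
  intro i
  by_cases hi : i = 0
  · subst hi
    rw [Pi.sub_apply, scaleFst_apply_zero, ha, sub_zero, norm_mul, Complex.norm_real,
      Real.norm_eq_abs]
    have h0 : ‖z 0‖ < r / C := by
      have := (norm_le_pi_norm (z - a) 0).trans_lt hz
      simpa [ha] using this
    rw [lt_div_iff₀ hC0] at h0
    nlinarith [norm_nonneg (z 0)]
  · rw [Pi.sub_apply, scaleFst_apply_ne t z hi]
    exact (norm_le_pi_norm (z - a) i).trans_lt hz'

/-- A smooth function of parameters, integrated over the unit interval, is smooth. -/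
lemma contDiffOn_unitInterval_integral {P : Type*} [NormedAddCommGroup P] [NormedSpace ℝ P]
    {g : P → ℝ → ℂ} {s : Set P} (hs : IsOpen s)
    (hg : ContDiffOn ℝ ∞ (fun p : P × ℝ => g p.1 p.2) (s ×ˢ (univ : Set ℝ)))
    (h0 : ∀ p ∈ s, ∀ x, 2 ≤ |x| → g p x = 0) :
    ContDiffOn ℝ ∞ (fun p => ∫ t in (0 : ℝ)..1, g p t) s := by
  -- The integral over `[0,1]` is the convolution of the indicator of `[0,1]` with the reflected
  -- function, taken at `0`; smooth dependence on parameters is then that of convolutions with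
  -- uniformly compact support.
  have h1 : ContDiffOn ℝ ∞ (Function.HasUncurry.uncurry fun p (x : ℝ) => g p (-x))
      (s ×ˢ (univ : Set ℝ)) := by
    have h2 : ContDiff ℝ ∞ (fun p : P × ℝ => (p.1, -p.2)) := contDiff_fst.prodMk contDiff_snd.neg
    exact hg.comp h2.contDiffOn fun p hp => ⟨hp.1, mem_univ _⟩
  have hi : LocallyIntegrable ((Icc (0 : ℝ) 1).indicator fun _ => (1 : ℂ)) volume :=
    ((integrable_indicator_iff measurableSet_Icc).2
      (integrableOn_const (by simp))).locallyIntegrable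
  have h3 : ContDiffOn ℝ ((⊤ : ℕ∞) : WithTop ℕ∞) (fun p => convolution
      ((Icc (0 : ℝ) 1).indicator fun _ => (1 : ℂ)) (fun x => g p (-x))
      (ContinuousLinearMap.mul ℝ ℂ) volume 0) s :=
    contDiffOn_convolution_right_with_param_comp (𝕜 := ℝ) (k := Icc (-2) 2)
      (ContinuousLinearMap.mul ℝ ℂ) (v := fun _ => (0 : ℝ)) contDiffOn_const hs isCompact_Icc
      (fun p x hp hx => h0 p hp _ (by
        rw [abs_neg]
        by_contra! h
        exact hx ⟨by linarith [(abs_lt.1 h).1], by linarith [(abs_lt.1 h).2]⟩)) hi h1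
  refine h3.congr fun p _ => ?_
  rw [convolution_def, intervalIntegral.integral_of_le zero_le_one,
    ← integral_Icc_eq_integral_Ioc, ← integral_indicator measurableSet_Icc]
  congr 1
  ext t
  by_cases ht : t ∈ Icc (0 : ℝ) 1
  · simp [indicator_of_mem ht]
  · simp [indicator_of_notMem ht]

/-- Hadamard's lemma: a holomorphic function vanishing on `z₁ = 0` is divisible by `z₁`, with a
smooth quotient. -/
lemma exists_smooth_quotient {f : Cn (n + 1) → ℂ} {U : Set (Cn (n + 1))} (hU : IsOpen U)
    (hf : ContDiffOn ℂ ω f U) {a : Cn (n + 1)} (ha : a ∈ U) (ha0 : a 0 = 0)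
    (h0 : ∀ z ∈ U, z 0 = 0 → f z = 0) :
    ∃ v : Cn (n + 1) → ℂ, ∃ W, IsOpen W ∧ a ∈ W ∧ W ⊆ U ∧ ContDiffOn ℝ ∞ v W ∧
      ∀ z ∈ W, f z = z 0 * v z := by
  obtain ⟨r, hr, hrU⟩ := Metric.isOpen_iff.1 hU a ha
  -- The quotient is `∫₀¹ (∂f/∂z₁)(t z₁, z₂, …) dt`, by the fundamental theorem of calculus along
  -- the segment to `z₁ = 0`. Holomorphy of `f` removes the term with `z̄₁`.
  let h : Cn (n + 1) → ℂ := fun y => fderiv ℂ f y (Pi.single 0 1)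
  have hh : ContDiffOn ℝ ∞ h (Metric.ball a r) := by
    have h1 : ContDiffOn ℂ ∞ (fderiv ℂ f) U := hf.fderiv_of_isOpen hU (by simp)
    exact ((h1.clm_apply contDiffOn_const).restrict_scalars ℝ).mono hrU
  -- The bump is `1` on `[0,1]`, so the integral is unchanged, and supplies compact support in the
  -- scaling variable. Scalings by less than `2` matter, hence the ball of radius `r / 2`.
  let χ : ContDiffBump (0 : ℝ) := ⟨1, 3 / 2, one_pos, by norm_num⟩
  let g : Cn (n + 1) → ℝ → ℂ := fun z x => (χ x : ℂ) * h (scaleFst x z)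
  have hg : ContDiffOn ℝ ∞ (fun p : Cn (n + 1) × ℝ => g p.1 p.2)
      (Metric.ball a (r / 2) ×ˢ (univ : Set ℝ)) := by
    rintro ⟨z, x⟩ ⟨hz, -⟩
    refine ContDiffAt.contDiffWithinAt ?_
    by_cases hx : |x| < 2
    · have h1 : ContDiffAt ℝ ∞ (fun p : Cn (n + 1) × ℝ => (χ p.2 : ℂ)) (z, x) :=
        Complex.ofRealCLM.contDiff.contDiffAt.comp _ (χ.contDiff.contDiffAt.comp _ contDiffAt_snd)
      have h2 : ContDiffAt ℝ ∞ (fun p : Cn (n + 1) × ℝ => scaleFst p.2 p.1) (z, x) :=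
        contDiff_scaleFst.contDiffAt
      have h3 : ContDiffAt ℝ ∞ h (scaleFst x z) :=
        hh.contDiffAt (Metric.isOpen_ball.mem_nhds
          (scaleFst_mem_ball ha0 (by norm_num) hx.le hz))
      have h4 : ContDiffAt ℝ ∞ (fun p : Cn (n + 1) × ℝ => h (scaleFst p.2 p.1)) (z, x) :=
        ContDiffAt.comp (g := h) (z, x) h3 h2
      exact h1.mul h4
    · refine (contDiffAt_const (c := (0 : ℂ))).congr_of_eventuallyEq ?_
      have h1 : ∀ᶠ p : Cn (n + 1) × ℝ in 𝓝 (z, x), 3 / 2 < |p.2| :=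
        (isOpen_lt continuous_const (continuous_abs.comp continuous_snd)).mem_nhds
          (by simp only [mem_ofPred_eq, Function.comp_apply]; linarith [not_lt.1 hx])
      filter_upwards [h1] with p hp
      have : χ p.2 = 0 := χ.zero_of_le_dist (by
        simp only [χ, Real.dist_eq, sub_zero]; exact hp.le)
      change (χ p.2 : ℂ) * _ = 0
      simp [this]
  refine ⟨fun z => ∫ t in (0 : ℝ)..1, h (scaleFst t z), Metric.ball a (r / 2), Metric.isOpen_ball,
    Metric.mem_ball_self (half_pos hr), (Metric.ball_subset_ball (by linarith)).trans hrU, ?_, ?_⟩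
  · have h1 := contDiffOn_unitInterval_integral Metric.isOpen_ball hg
      fun z _ x hx => by
        have : χ x = 0 := χ.zero_of_le_dist (by
          simp only [χ, Real.dist_eq, sub_zero]
          linarith)
        simp [g, this]
    refine h1.congr fun z _ => ?_
    refine intervalIntegral.integral_congr fun t ht => ?_
    rw [uIcc_of_le zero_le_one] at ht
    have : χ t = 1 := χ.one_of_mem_closedBall (by
      simp only [χ, Metric.mem_closedBall, Real.dist_eq, sub_zero, abs_le]
      exact ⟨by linarith [ht.1], ht.2⟩)
    simp [g, this]
  · intro z hz
    replace hz := Metric.ball_subset_ball (show r / 2 ≤ r by linarith) hz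
    have hmem : ∀ t ∈ Icc (0 : ℝ) 1, scaleFst t z ∈ Metric.ball a r := fun t ht =>
      scaleFst_mem_ball ha0 le_rfl (abs_le.2 ⟨by linarith [ht.1], ht.2⟩) (by simpa using hz)
    have hσ : ∀ t : ℝ, HasDerivAt (fun t : ℝ => scaleFst t z) (Pi.single 0 (z 0)) t := by
      intro t
      unfold scaleFst
      refine HasDerivAt.const_add z ?_
      have h1 : HasDerivAt (fun t : ℝ => ((t : ℂ) - 1) * z 0) (z 0) t := by
        simpa using (((hasDerivAt_id t).ofReal_comp).sub_const 1).mul_const (z 0)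
      exact (ContinuousLinearMap.single ℝ (fun _ : Fin (n + 1) => ℂ) 0).hasFDerivAt.comp_hasDerivAt
        t h1
    have hder : ∀ t ∈ uIcc (0 : ℝ) 1, HasDerivAt (fun t : ℝ => f (scaleFst t z))
        (z 0 * h (scaleFst t z)) t := by
      intro t ht
      rw [uIcc_of_le zero_le_one] at ht
      have h1 : HasFDerivAt f ((fderiv ℂ f (scaleFst t z)).restrictScalars ℝ) (scaleFst t z) :=
        ((hf.contDiffAt (hU.mem_nhds (hrU (hmem t ht)))).differentiableAt
          (by simp)).hasFDerivAt.restrictScalars ℝ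
      have h2 := h1.comp_hasDerivAt t (hσ t)
      refine h2.congr_deriv ?_
      have h3 : (Pi.single 0 (z 0) : Cn (n + 1)) = z 0 • Pi.single 0 1 := by
        rw [← Pi.single_smul]; simp
      simp only [ContinuousLinearMap.coe_restrictScalars', h]
      rw [h3, map_smul, smul_eq_mul]
    have hcont : ContinuousOn (fun t : ℝ => z 0 * h (scaleFst t z)) (uIcc 0 1) := by
      rw [uIcc_of_le zero_le_one]
      refine continuousOn_const.mul (hh.continuousOn.comp ?_ hmem)
      exact (contDiff_scaleFst.comp
        (contDiff_const.prodMk contDiff_id)).continuous.continuousOn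
    have := intervalIntegral.integral_eq_sub_of_hasDerivAt hder hcont.intervalIntegrable
    rw [intervalIntegral.integral_const_mul, scaleFst_one] at this
    rw [this, h0 (scaleFst 0 z) (hrU (hmem 0 (by simp))) (by simp [scaleFst_apply_zero]), sub_zero]

end Hadamard

/-! ### Comparison of local equations of the hypersurface. -/

section Adapted

variable {n : ℕ}
variable {X : Type*} [TopologicalSpace X] [ChartedSpace (Cn (n + 1)) X]
  [IsManifold 𝓘(ℂ, Cn (n + 1)) ω X] {D : Type*} {ι : D → X}
  {e e' : OpenPartialHomeomorph X (Cn (n + 1))}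

lemma IsAdaptedChart.exists_smooth_quotient (he : IsAdaptedChart ι e) (he' : IsAdaptedChart ι e')
    {p : X} (hp : p ∈ e.source) (hp' : p ∈ e'.source) (h0 : e p 0 = 0) :
    ∃ v : Cn (n + 1) → ℂ, ∃ W, IsOpen W ∧ e p ∈ W ∧ W ⊆ e.target ∩ e.symm ⁻¹' e'.source ∧
      ContDiffOn ℝ ∞ v W ∧ ∀ z ∈ W, e' (e.symm z) 0 = z 0 * v z := by
  refine _root_.exists_smooth_quotient (f := fun z => e' (e.symm z) 0)
    (isOpen_transition e e')
    ((ContinuousLinearMap.proj (R := ℂ) (φ := fun _ : Fin (n + 1) => ℂ) 0).contDiff.comp_contDiffOn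
      (transition_contDiffOn he.1 he'.1))
    ⟨e.map_source hp, by simpa [e.left_inv hp] using hp'⟩ h0 fun z hz hz0 => ?_
  rw [← he'.2 _ hz.2, he.2 _ (e.map_target hz.1), e.right_inv hz.1, hz0]

/-- The first coordinates of two adapted charts differ by a smooth nonvanishing factor. -/
lemma IsAdaptedChart.exists_unit (he : IsAdaptedChart ι e) (he' : IsAdaptedChart ι e')
    {p : X} (hp : p ∈ e.source) (hp' : p ∈ e'.source) (h0 : e p 0 = 0) :
    ∃ v : Cn (n + 1) → ℂ, ∃ W, IsOpen W ∧ e p ∈ W ∧ W ⊆ e.target ∩ e.symm ⁻¹' e'.source ∧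
      ContDiffOn ℝ ∞ v W ∧ (∀ z ∈ W, v z ≠ 0) ∧ ∀ z ∈ W, e' (e.symm z) 0 = z 0 * v z := by
  obtain ⟨v, W₁, hW₁, hpW₁, hWS, hvW, hvW'⟩ := he.exists_smooth_quotient he' hp hp' h0
  have h0' : e' p 0 = 0 := by rw [← he'.2 _ hp', he.2 _ hp, h0]
  obtain ⟨w, W₂, hW₂, hpW₂, -, hwW, hwW'⟩ := he'.exists_smooth_quotient he hp' hp h0'
  have hv := hvW.contDiffAt (hW₁.mem_nhds hpW₁)
  have hv' : ∀ᶠ z in 𝓝 (e p), e' (e.symm z) 0 = z 0 * v z :=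
    mem_of_superset (hW₁.mem_nhds hpW₁) hvW'
  have hw := hwW.contDiffAt (hW₂.mem_nhds hpW₂)
  have hw' : ∀ᶠ z in 𝓝 (e' p), e (e'.symm z) 0 = z 0 * w z :=
    mem_of_superset (hW₂.mem_nhds hpW₂) hwW'
  suffices hv0 : v (e p) ≠ 0 from
    ⟨v, W₁ ∩ v ⁻¹' {0}ᶜ, hvW.continuousOn.isOpen_inter_preimage hW₁ isOpen_compl_singleton,
      ⟨hpW₁, hv0⟩, inter_subset_left.trans hWS, hvW.mono inter_subset_left,
      fun z hz => hz.2, fun z hz => hvW' z hz.1⟩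
  -- The quotients `v` and `w` of the two first coordinates in either direction satisfy `v · w = 1`
  -- off `z₁ = 0`. That set is dense, so `v (e p) = 0` would give `1 = 0` in the limit.
  intro hv0
  have hS := isOpen_transition e e'
  have hpS : e p ∈ e.target ∩ e.symm ⁻¹' e'.source :=
    ⟨e.map_source hp, by simpa [e.left_inv hp] using hp'⟩
  have hτ : ContinuousAt (fun z => e' (e.symm z)) (e p) :=
    ((transition_contDiffOn he.1 he'.1).continuousOn).continuousAt (hS.mem_nhds hpS)
  have hτp : e' (e.symm (e p)) = e' p := by rw [e.left_inv hp]
  have hne : (𝓝[{z : Cn (n + 1) | z 0 ≠ 0}] (e p)).NeBot :=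
    mem_closure_iff_nhdsWithin_neBot.1 (dense_ne_zero n (e p))
  have h1 : Tendsto (fun z => v z * w (e' (e.symm z))) (𝓝[{z : Cn (n + 1) | z 0 ≠ 0}] (e p))
      (𝓝 0) := by
    have hwc : ContinuousAt (fun z => w (e' (e.symm z))) (e p) := by
      refine ContinuousAt.comp (g := w) ?_ hτ
      rw [hτp]; exact hw.continuousAt
    have : Tendsto (fun z => v z * w (e' (e.symm z))) (𝓝 (e p))
        (𝓝 (v (e p) * w (e' (e.symm (e p))))) := hv.continuousAt.mul hwc
    rw [hv0, zero_mul] at this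
    exact this.mono_left nhdsWithin_le_nhds
  have h2 : ∀ᶠ z in 𝓝[{z : Cn (n + 1) | z 0 ≠ 0}] (e p), v z * w (e' (e.symm z)) = 1 := by
    have hw2 : ∀ᶠ z in 𝓝 (e p), e (e'.symm (e' (e.symm z))) 0 =
        e' (e.symm z) 0 * w (e' (e.symm z)) := by
      have : Tendsto (fun z => e' (e.symm z)) (𝓝 (e p)) (𝓝 (e' p)) := by
        rw [← hτp]; exact hτ
      exact this.eventually hw'
    filter_upwards [nhdsWithin_le_nhds hv', nhdsWithin_le_nhds hw2,
      nhdsWithin_le_nhds (hS.mem_nhds hpS), self_mem_nhdsWithin] with z a b c (d : z 0 ≠ 0)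
    rw [e'.left_inv c.2, e.right_inv c.1, a, mul_assoc] at b
    exact (mul_left_cancel₀ d ((mul_one _).trans b)).symm
  exact one_ne_zero (tendsto_nhds_unique (tendsto_const_nhds.congr' (h2.mono fun z h => h.symm)) h1)

end Adapted

/-! ### Wedge products under pullback and scaling. -/

section Wedge

variable {n m k l : ℕ}
variable {M : Type*} [TopologicalSpace M] [ChartedSpace (Cn n) M]
variable {N : Type*} [TopologicalSpace N] [ChartedSpace (Cn m) N]

/-- The wedge product as a sum over representatives of the shuffles. -/
lemma wedgeForm_apply (α : Form n M k) (β : Form n M l) (x : M) (v : Fin (k + l) → Cn n) :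
    wedgeForm α β x v = ∑ σ : Equiv.Perm.ModSumCongr (Fin k) (Fin l),
      ((Equiv.Perm.sign σ.out : ℤ) : ℂ) *
        (α x (fun i => v (finSumFinEquiv (σ.out (Sum.inl i)))) *
          β x (fun i => v (finSumFinEquiv (σ.out (Sum.inr i))))) := by
  have h : ∀ w, AlternatingMap.domCoprod (α x) (β x) w =
      ∑ σ : Equiv.Perm.ModSumCongr (Fin k) (Fin l),
        AlternatingMap.domCoprod.summand (α x) (β x) σ w := by
    intro w
    rw [AlternatingMap.domCoprod_apply, _root_.sum_apply]
  simp only [wedgeForm, AlternatingMap.domDomCongr_apply, LinearMap.compAlternatingMap_apply]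
  rw [h, map_sum]
  refine Finset.sum_congr rfl fun σ _ => ?_
  conv_lhs => rw [← Quotient.out_eq' σ, AlternatingMap.domCoprod.summand_mk'']
  rw [_root_.smul_apply, Units.smul_def, map_zsmul, zsmul_eq_mul]
  simp [MultilinearMap.domDomCongr_apply, MultilinearMap.domCoprod_apply]

lemma pullbackForm_wedgeForm (f : M → N) (α : Form m N k) (β : Form m N l) :
    pullbackForm (n := n) f (wedgeForm α β) =
      wedgeForm (pullbackForm (n := n) f α) (pullbackForm (n := n) f β) := by
  ext x v
  rw [wedgeForm_apply]
  simp only [pullbackForm, AlternatingMap.compLinearMap_apply]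
  rw [wedgeForm_apply]

lemma wedgeForm_smul_smul {α α' : Form n M k} {β β' : Form n M l} {x : M} {a b : ℂ}
    (hα : α x = a • α' x) (hβ : β x = b • β' x) :
    wedgeForm α β x = (a * b) • wedgeForm α' β' x := by
  ext v
  rw [AlternatingMap.smul_apply, wedgeForm_apply, wedgeForm_apply, hα, hβ, Finset.smul_sum]
  refine Finset.sum_congr rfl fun σ _ => ?_
  simp only [AlternatingMap.smul_apply, smul_eq_mul]
  ring

lemma pullbackForm_smul {f : M → N} {η η' : Form m N k} {x : M} {a : ℂ}
    (h : η (f x) = a • η' (f x)) : pullbackForm (n := n) f η x = a • pullbackForm (n := n) f η' x := by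
  ext v
  simp [pullbackForm, h]

lemma conjForm_smul {β β' : Form n M k} {x : M} {b : ℂ} (h : β x = b • β' x) :
    conjForm β x = starRingEnd ℂ b • conjForm β' x := by
  ext v
  simp [conjForm, h]

/-- The coefficients of a wedge product in a chart are smooth. -/
lemma contDiffOn_pullbackForm_wedgeForm {f : Cn n → M} {α : Form n M k} {β : Form n M l}
    {S : Set (Cn n)} (hα : ∀ v, ContDiffOn ℝ ∞ (fun z => pullbackForm (n := n) f α z v) S)
    (hβ : ∀ v, ContDiffOn ℝ ∞ (fun z => pullbackForm (n := n) f β z v) S)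
    (v : Fin (k + l) → Cn n) :
    ContDiffOn ℝ ∞ (fun z => pullbackForm (n := n) f (wedgeForm α (conjForm β)) z v) S := by
  simp only [pullbackForm_wedgeForm, wedgeForm_apply]
  refine ContDiffOn.sum fun σ _ => contDiffOn_const.mul ((hα _).mul ?_)
  exact Complex.conjCLE.contDiff.comp_contDiffOn (hβ _)

end Wedge

/-! ### Existence of residue data. -/

section Existence

variable {n : ℕ}
variable {X : Type*} [TopologicalSpace X] [ChartedSpace (Cn (n + 1)) X]
  [IsManifold 𝓘(ℂ, Cn (n + 1)) ω X] {D : Type*} {ι : D → X}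

lemma IsAdaptedChart.restr {e : OpenPartialHomeomorph X (Cn (n + 1))} (he : IsAdaptedChart ι e)
    {W : Set (Cn (n + 1))} (hW : IsOpen W) (hWe : W ⊆ e.target) :
    ∃ e' : OpenPartialHomeomorph X (Cn (n + 1)), IsAdaptedChart ι e' ∧
      e'.source = e.source ∩ e ⁻¹' W ∧ e'.target = W ∧ (e' : X → Cn (n + 1)) = e ∧
      (e'.symm : Cn (n + 1) → X) = e.symm := by
  have ho := e.isOpen_inter_preimage hW
  refine ⟨e.restr (e.source ∩ e ⁻¹' W), ⟨restr_mem_maximalAtlas _ he.1 ho, fun x hx => ?_⟩,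
    ?_, ?_, rfl, rfl⟩
  · rw [OpenPartialHomeomorph.restr_source] at hx
    exact he.2 x hx.1
  · rw [OpenPartialHomeomorph.restr_source, ho.interior_eq, ← inter_assoc, inter_self]
  · ext z
    rw [OpenPartialHomeomorph.restr_target, ho.interior_eq]
    constructor
    · rintro ⟨h1, h2⟩
      simpa [e.right_inv h1] using h2.2
    · intro hz
      exact ⟨hWe hz, e.map_target (hWe hz), by simpa [e.right_inv (hWe hz)] using hz⟩

/-- Around a point not on the closed hypersurface there is a chart missing the hypersurface. -/
lemma exists_isAdaptedChart_of_notMem (hD : IsClosed (range ι)) {x : X} (hx : x ∉ range ι) :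
    ∃ e : OpenPartialHomeomorph X (Cn (n + 1)), IsAdaptedChart ι e ∧ x ∈ e.source ∧
      Disjoint e.source (range ι) := by
  let e₀ := chartAt (Cn (n + 1)) x
  -- Off `D` an adapted chart must have a nowhere vanishing first coordinate; translating `x` to
  -- `(1, …, 1)` achieves this near `x`.
  let c : Cn (n + 1) := fun i => 1 - e₀ x i
  let e₁ : OpenPartialHomeomorph X (Cn (n + 1)) :=
    e₀.trans (Homeomorph.addRight c).toOpenPartialHomeomorph
  have hs : e₁.source = e₀.source := by simp [e₁]
  have h0 : ContMDiffOn 𝓘(ℂ, Cn (n + 1)) 𝓘(ℂ, Cn (n + 1)) ω e₁ e₁.source := by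
    have h1 : ContMDiff 𝓘(ℂ, Cn (n + 1)) 𝓘(ℂ, Cn (n + 1)) ω (fun z : Cn (n + 1) => z + c) :=
      (contDiff_id.add contDiff_const).contMDiff
    rw [hs]
    exact h1.comp_contMDiffOn (contMDiffOn_chart (x := x))
  have h1 : ContMDiffOn 𝓘(ℂ, Cn (n + 1)) 𝓘(ℂ, Cn (n + 1)) ω e₁.symm e₁.target := by
    have h1 : ContMDiff 𝓘(ℂ, Cn (n + 1)) 𝓘(ℂ, Cn (n + 1)) ω (fun z : Cn (n + 1) => z + -c) :=
      (contDiff_id.add contDiff_const).contMDiff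
    refine (contMDiffOn_chart_symm (x := x)).comp h1.contMDiffOn fun z hz => ?_
    simpa [e₁] using hz
  have h2 : e₁ ∈ IsManifold.maximalAtlas 𝓘(ℂ, Cn (n + 1)) ω X :=
    e₁.mem_maximalAtlas_of_contMDiffOn h0 h1
  let s : Set X := (e₁.source ∩ e₁ ⁻¹' {z | z 0 ≠ 0}) ∩ (range ι)ᶜ
  have hso : IsOpen s := (e₁.isOpen_inter_preimage
    (isOpen_ne_fun (continuous_apply 0) continuous_const)).inter hD.isOpen_compl
  have hsub : (e₁.restr s).source ⊆ s := by
    rw [OpenPartialHomeomorph.restr_source, hso.interior_eq]; exact inter_subset_right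
  refine ⟨e₁.restr s, ⟨restr_mem_maximalAtlas _ h2 hso, fun y hy => ?_⟩, ?_, ?_⟩
  · exact iff_of_false (hsub hy).2 (hsub hy).1.2
  · have hxs : x ∈ e₁.source := by rw [hs]; exact mem_chart_source _ x
    rw [OpenPartialHomeomorph.restr_source, hso.interior_eq]
    refine ⟨hxs, ⟨hxs, ?_⟩, hx⟩
    simp [e₁, c]
  · exact disjoint_left.2 fun y hy => (hsub hy).2

/-- Residue data exist if they exist locally. -/
lemma ResidueData.nonempty_of_local [T2Space X] [CompactSpace X]
    {Ω : Form (n + 1) X (2 * (n + 1))}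
    (h : ∀ x : X, ∃ e : OpenPartialHomeomorph X (Cn (n + 1)), IsAdaptedChart ι e ∧ x ∈ e.source ∧
      ∃ m l : ℕ, 1 ≤ m ∧ 1 ≤ l ∧ ∃ ψ : Cn (n + 1) → ℂ, ContDiffOn ℝ ∞ ψ e.target ∧
        ∀ z ∈ e.target, z 0 ≠ 0 → pullbackForm (n := n + 1) e.symm Ω z =
          (ψ z / ((z 0) ^ m * (starRingEnd ℂ (z 0)) ^ l)) • stdForm (n + 1) z) :
    Nonempty (ResidueData ι Ω) := by
  choose e he hx m l hm hl ψ hψ heq using h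
  obtain ⟨t, ht⟩ := CompactSpace.elim_nhds_subcover (fun x => (e x).source)
    fun x => (e x).open_source.mem_nhds (hx x)
  have hman := isManifold_real (M := X) (n := n + 1)
  let c : Fin t.card → X := fun j => (t.equivFin.symm j : X)
  obtain ⟨ρ, hρ⟩ := SmoothPartitionOfUnity.exists_isSubordinate 𝓘(ℝ, Cn (n + 1)) (isClosed_univ)
    (fun j => (e (c j)).source) (fun j => (e (c j)).open_source) (by
      rw [← top_eq_univ, ← ht]
      intro y hy
      obtain ⟨x, hxt, hy⟩ := mem_iUnion₂.1 hy
      exact mem_iUnion.2 ⟨t.equivFin ⟨x, hxt⟩, by simpa [c] using hy⟩)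
  exact ⟨⟨t.card, fun j => e (c j), fun j => he _, ρ, hρ, fun j => m (c j), fun j => l (c j),
    fun j => hm _, fun j => hl _, fun j => ψ (c j), fun j => hψ _, fun j => heq _⟩⟩

variable {k l : ℕ}

/-- The local expression of `α ∧ β̄` in an adapted chart. -/
lemma exists_local_expression {e : OpenPartialHomeomorph X (Cn (n + 1))}
    (hkl : k + l = 2 * (n + 1))
    {α α' : Form (n + 1) X k} {β β' : Form (n + 1) X l}
    (hα' : ∀ v, ContDiffOn ℝ ∞ (fun z => pullbackForm (n := n + 1) e.symm α' z v) e.target)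
    (hβ' : ∀ v, ContDiffOn ℝ ∞ (fun z => pullbackForm (n := n + 1) e.symm β' z v) e.target)
    {v : Cn (n + 1) → ℂ} (hv : ContDiffOn ℝ ∞ v e.target) (hv0 : ∀ z ∈ e.target, v z ≠ 0)
    {m m' : ℕ}
    (hα : ∀ z ∈ e.target, z 0 ≠ 0 → α (e.symm z) = ((z 0) ^ m)⁻¹ • α' (e.symm z))
    (hβ : ∀ z ∈ e.target, z 0 ≠ 0 → β (e.symm z) = ((z 0 * v z) ^ m')⁻¹ • β' (e.symm z)) :
    ∃ m l : ℕ, 1 ≤ m ∧ 1 ≤ l ∧ ∃ ψ : Cn (n + 1) → ℂ, ContDiffOn ℝ ∞ ψ e.target ∧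
      ∀ z ∈ e.target, z 0 ≠ 0 →
        pullbackForm (n := n + 1) e.symm (castForm hkl (wedgeForm α (conjForm β))) z =
          (ψ z / ((z 0) ^ m * (starRingEnd ℂ (z 0)) ^ l)) • stdForm (n + 1) z := by
  let W : Cn (n + 1) → ℂ := fun z =>
    pullbackForm (n := n + 1) e.symm (castForm hkl (wedgeForm α' (conjForm β'))) z (stdFrame (n + 1))
  have hW : ContDiffOn ℝ ∞ W e.target :=
    contDiffOn_pullbackForm_wedgeForm hα' hβ' _
  have hz0 : ContDiff ℝ ∞ (fun z : Cn (n + 1) => z 0) := contDiff_apply ℝ ℂ 0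
  -- Residue data ask for exponents at least `1`, so both are raised by one and compensated by `z₁
  -- z̄₁` in the numerator. The denominator is the value of `stdForm` on the frame.
  refine ⟨m + 1, m' + 1, by omega, by omega, fun z => (z 0 * starRingEnd ℂ (z 0) *
    (starRingEnd ℂ (v z) ^ m')⁻¹ * W z) / (-2 * Complex.I) ^ (n + 1), ?_, fun z hz hne => ?_⟩
  · refine ContDiffOn.div_const ?_ _
    refine ((hz0.mul (Complex.conjCLE.contDiff.comp hz0)).contDiffOn.mul ?_).mul hW
    refine ContDiffOn.inv ((Complex.conjCLE.contDiff.comp_contDiffOn hv).pow _) fun z hz => ?_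
    simpa using fun h => absurd h (hv0 z hz)
  · refine topForm_ext ?_
    have h1 := wedgeForm_smul_smul (hα z hz hne) (conjForm_smul (hβ z hz hne))
    have h2 : pullbackForm (n := n + 1) e.symm (castForm hkl (wedgeForm α (conjForm β))) z (stdFrame (n + 1))
        = ((z 0 ^ m)⁻¹ * starRingEnd ℂ (((z 0 * v z) ^ m')⁻¹)) * W z := by
      rw [pullbackForm_smul (a := (z 0 ^ m)⁻¹ * starRingEnd ℂ (((z 0 * v z) ^ m')⁻¹))
        (η' := castForm hkl (wedgeForm α' (conjForm β')))]
      · rfl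
      · ext w
        simp only [castForm, AlternatingMap.domDomCongr_apply, AlternatingMap.smul_apply]
        rw [h1]; rfl
    rw [h2, AlternatingMap.smul_apply, stdForm_stdFrame, smul_eq_mul]
    have h3 : starRingEnd ℂ (z 0) ≠ 0 := by simpa using hne
    have h4 : starRingEnd ℂ (v z) ≠ 0 := by simpa using hv0 z hz
    have h5 : (-2 * Complex.I) ^ (n + 1) ≠ 0 := pow_ne_zero _ (by simp [Complex.I_ne_zero])
    rw [map_inv₀, map_pow, map_mul]
    field_simp
    ring

/-- The poles of `α` and `β` are given in two unrelated adapted charts. The smooth unit between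
their first coordinates rewrites both in one chart, after shrinking. Off `D` the forms are smooth
and no denominator is needed. -/
lemma ResidueData.nonempty [T2Space X] [CompactSpace X] (hD : IsClosed (range ι))
    (hkl : k + l = 2 * (n + 1)) {α : Form (n + 1) X k} {β : Form (n + 1) X l}
    (hα : IsSemiMeromorphic ι α) (hβ : IsSemiMeromorphic ι β) :
    Nonempty (ResidueData ι (castForm hkl (wedgeForm α (conjForm β)))) := by
  refine ResidueData.nonempty_of_local fun x => ?_
  by_cases hx : x ∈ range ι
  · obtain ⟨p, rfl⟩ := hx
    obtain ⟨e, he, hpe, m, α', hα', hαα'⟩ := hα.2 p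
    obtain ⟨e', he', hpe', m', β', hβ', hββ'⟩ := hβ.2 p
    have h0 : e (ι p) 0 = 0 := (he.2 _ hpe).1 (mem_range_self p)
    obtain ⟨v, W, hW, hpW, hWS, hv, hv0, hv'⟩ := he.exists_unit he' hpe hpe' h0
    obtain ⟨e₁, he₁, hs, ht, hc, hcs⟩ := he.restr hW (hWS.trans inter_subset_left)
    have hmem : ∀ z ∈ e₁.target, z 0 ≠ 0 → e.symm z ∉ range ι := by
      intro z hz hne hr
      rw [ht] at hz
      rw [he.2 _ (e.map_target (hWS hz).1), e.right_inv (hWS hz).1] at hr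
      exact hne hr
    refine ⟨e₁, he₁, by rw [hs]; exact ⟨hpe, hpW⟩, exists_local_expression hkl
      (α' := α') (β' := β') (fun v => ?_) (fun v => ?_) (v := v) (by rwa [ht]) (by rwa [ht])
      (m := m) (m' := m') (fun z hz hne => ?_) fun z hz hne => ?_⟩
    · refine (hα' e₁ he₁.1 v).mono fun z hz => ⟨hz, ?_⟩
      rw [ht] at hz
      rw [hcs]; exact e.map_target (hWS hz).1
    · refine (hβ' e₁ he₁.1 v).mono fun z hz => ⟨hz, ?_⟩
      rw [ht] at hz
      rw [hcs]; exact (hWS hz).2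
    · have h1 := hmem z hz hne
      rw [ht] at hz
      rw [hcs, hαα' _ (e.map_target (hWS hz).1) h1, e.right_inv (hWS hz).1]
    · have h1 := hmem z hz hne
      rw [ht] at hz
      rw [hcs, hββ' _ (hWS hz).2 h1, hv' z hz]
  · obtain ⟨e, he, hxe, hdis⟩ := exists_isAdaptedChart_of_notMem (n := n) hD hx
    refine ⟨e, he, hxe, exists_local_expression hkl (α' := α) (β' := β) (fun v => ?_)
      (fun v => ?_) (v := fun _ => 1) contDiffOn_const (fun _ _ => one_ne_zero) (m := 0) (m' := 0)
      (fun z hz hne => by simp) fun z hz hne => by simp⟩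
    · exact (hα.1 e he.1 v).mono fun z hz => ⟨hz, disjoint_left.1 hdis (e.map_target hz)⟩
    · exact (hβ.1 e he.1 v).mono fun z hz => ⟨hz, disjoint_left.1 hdis (e.map_target hz)⟩

/-- Residue data for a smooth multiple of a form. -/
def ResidueData.smul {Ω : Form (n + 1) X (2 * (n + 1))} (P : ResidueData ι Ω) {φ : X → ℂ}
    (hφ : ContMDiff 𝓘(ℝ, Cn (n + 1)) 𝓘(ℝ, ℂ) ∞ φ) :
    ResidueData ι (fun x => φ x • Ω x) where
  r := P.r
  chart := P.chart
  adapted := P.adapted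
  ρ := P.ρ
  subordinate := P.subordinate
  m := P.m
  l := P.l
  one_le_m := P.one_le_m
  one_le_l := P.one_le_l
  ψ j z := φ ((P.chart j).symm z) * P.ψ j z
  smooth j := (hφ.contDiffOn_chart (P.adapted j).1).mul (P.smooth j)
  eq j z hz hne := by
    rw [pullbackForm_smul (η' := Ω) (a := φ ((P.chart j).symm z)) rfl, P.eq j z hz hne, smul_smul,
      mul_div_assoc]

end Existence

/-! ### Locality and smoothness of iterated Wirtinger derivatives. -/

section Wirtinger

variable {n : ℕ}

lemma dz1_eqOn {f g : Cn (n + 1) → ℂ} {U : Set (Cn (n + 1))} (hU : IsOpen U) (h : EqOn f g U) :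
    EqOn (dz1 f) (dz1 g) U := fun z hz => by
  simp only [dz1, (h.eventuallyEq_of_mem (hU.mem_nhds hz)).fderiv_eq]

lemma dz1bar_eqOn {f g : Cn (n + 1) → ℂ} {U : Set (Cn (n + 1))} (hU : IsOpen U) (h : EqOn f g U) :
    EqOn (dz1bar f) (dz1bar g) U := fun z hz => by
  simp only [dz1bar, (h.eventuallyEq_of_mem (hU.mem_nhds hz)).fderiv_eq]

lemma iterate_dz1_dz1bar_eqOn {f g : Cn (n + 1) → ℂ} {U : Set (Cn (n + 1))} (hU : IsOpen U)
    (h : EqOn f g U) (a b : ℕ) :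
    EqOn (dz1^[a] (dz1bar^[b] f)) (dz1^[a] (dz1bar^[b] g)) U := by
  have h1 : EqOn (dz1bar^[b] f) (dz1bar^[b] g) U := by
    induction b with
    | zero => exact h
    | succ b ih =>
      rw [Function.iterate_succ_apply', Function.iterate_succ_apply']
      exact dz1bar_eqOn hU ih
  induction a with
  | zero => exact h1
  | succ a ih =>
    rw [Function.iterate_succ_apply', Function.iterate_succ_apply']
    exact dz1_eqOn hU ih

lemma iterate_dz1_dz1bar_zero (a b : ℕ) :
    dz1^[a] (dz1bar^[b] (fun _ : Cn (n + 1) => (0 : ℂ))) = fun _ => 0 := by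
  have h1 : dz1bar (fun _ : Cn (n + 1) => (0 : ℂ)) = fun _ => 0 := by
    funext z; simp [dz1bar]
  have h2 : dz1 (fun _ : Cn (n + 1) => (0 : ℂ)) = fun _ => 0 := by
    funext z; simp [dz1]
  rw [Function.iterate_fixed h1, Function.iterate_fixed h2]

lemma contDiff_iterate_dz1_dz1bar {f : Cn (n + 1) → ℂ} (hf : ContDiff ℝ ∞ f) (a b : ℕ) :
    ContDiff ℝ ∞ (dz1^[a] (dz1bar^[b] f)) := by
  have h0 : ∀ {g : Cn (n + 1) → ℂ}, ContDiff ℝ ∞ g → ∀ v, ContDiff ℝ ∞ (fun z => fderiv ℝ g z v) :=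
    fun hg v => (hg.fderiv_right (m := ∞) (by simp)).clm_apply contDiff_const
  have h1 : ContDiff ℝ ∞ (dz1bar^[b] f) := by
    induction b with
    | zero => exact hf
    | succ b ih =>
      rw [Function.iterate_succ_apply']
      exact contDiff_const.mul ((h0 ih _).add (contDiff_const.mul (h0 ih _)))
  induction a with
  | zero => exact h1
  | succ a ih =>
    rw [Function.iterate_succ_apply']
    exact contDiff_const.mul ((h0 ih _).sub (contDiff_const.mul (h0 ih _)))

end Wirtinger

/-! ### Charts of the hypersurface and the integral of the residue form. -/

section HypersurfaceCharts

variable {n : ℕ}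
variable {X : Type*} [TopologicalSpace X] [ChartedSpace (Cn (n + 1)) X]
  [IsManifold 𝓘(ℂ, Cn (n + 1)) ω X]
variable {D : Type*} [TopologicalSpace D] [ChartedSpace (Cn n) D] [IsManifold 𝓘(ℂ, Cn n) ω D]
variable {ι : D → X} {e : OpenPartialHomeomorph X (Cn (n + 1))}

lemma IsAdaptedChart.cons_tail (he : IsAdaptedChart ι e) {q : D} (hq : ι q ∈ e.source) :
    (Fin.cons 0 (Fin.tail (e (ι q))) : Cn (n + 1)) = e (ι q) := by
  have h : e (ι q) 0 = 0 := (he.2 _ hq).1 (mem_range_self q)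
  conv_rhs => rw [← Fin.cons_self_tail (e (ι q)), h]

lemma continuous_cons_zero : Continuous (fun w : Cn n => (Fin.cons (0 : ℂ) w : Cn (n + 1))) :=
  contDiff_cons_zero.continuous

lemma contMDiff_cons_zero :
    ContMDiff 𝓘(ℂ, Cn n) 𝓘(ℂ, Cn (n + 1)) ω
      (fun w : Cn n => (Fin.cons (0 : ℂ) w : Cn (n + 1))) := by
  refine ContDiff.contMDiff ?_
  rw [contDiff_pi]
  intro i
  refine Fin.cases ?_ (fun j => ?_) i
  · simpa using contDiff_const
  · simpa using contDiff_apply ℂ ℂ j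

lemma contMDiff_tail :
    ContMDiff 𝓘(ℂ, Cn (n + 1)) 𝓘(ℂ, Cn n) ω
      (fun z : Cn (n + 1) => (Fin.tail z : Cn n)) := by
  refine ContDiff.contMDiff ?_
  rw [contDiff_pi]
  exact fun i => contDiff_apply ℂ ℂ i.succ

/-- The chart of the hypersurface induced by an adapted chart. -/
lemma IsAdaptedChart.exists_chart [Nonempty D]
    (hι : Manifold.IsSmoothEmbedding 𝓘(ℂ, Cn n) 𝓘(ℂ, Cn (n + 1)) ω ι) (he : IsAdaptedChart ι e) :
    ∃ g : OpenPartialHomeomorph D (Cn n), g ∈ IsManifold.maximalAtlas 𝓘(ℂ, Cn n) ω D ∧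
      g.source = ι ⁻¹' e.source ∧ g.target = {w | (Fin.cons 0 w : Cn (n + 1)) ∈ e.target} ∧
      (g : D → Cn n) = (fun q => Fin.tail (e (ι q))) := by
  have hinj : Function.Injective ι := hι.isEmbedding.injective
  have hcont : Continuous ι := hι.isEmbedding.continuous
  have hinv : ∀ w : Cn n, (Fin.cons 0 w : Cn (n + 1)) ∈ e.target →
      ι (Function.invFun ι (e.symm (Fin.cons 0 w))) = e.symm (Fin.cons 0 w) := by
    intro w hw
    refine Function.invFun_eq ?_
    exact (he.2 _ (e.map_target hw)).2 (by rw [e.right_inv hw]; rfl)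
  have ht : IsOpen {w : Cn n | (Fin.cons 0 w : Cn (n + 1)) ∈ e.target} :=
    e.open_target.preimage continuous_cons_zero
  have hc : ContinuousOn (fun w : Cn n => Function.invFun ι (e.symm (Fin.cons 0 w)))
      {w : Cn n | (Fin.cons 0 w : Cn (n + 1)) ∈ e.target} := by
    rw [hι.isEmbedding.continuousOn_iff]
    refine (e.continuousOn_symm.comp continuous_cons_zero.continuousOn fun w hw => hw).congr
      fun w hw => hinv w hw
  let g : OpenPartialHomeomorph D (Cn n) :=
    { toFun := fun q => Fin.tail (e (ι q))
      invFun := fun w => Function.invFun ι (e.symm (Fin.cons 0 w))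
      source := ι ⁻¹' e.source
      target := {w | (Fin.cons 0 w : Cn (n + 1)) ∈ e.target}
      map_source' := fun q hq => by
        rw [mem_ofPred_eq, he.cons_tail hq]; exact e.map_source hq
      map_target' := fun w hw => by
        rw [mem_preimage, hinv w hw]; exact e.map_target hw
      left_inv' := fun q hq => by
        rw [he.cons_tail hq, e.left_inv hq, Function.leftInverse_invFun hinj]
      right_inv' := fun w hw => by
        rw [hinv w hw, e.right_inv hw, Fin.tail_cons]
      open_source := e.open_source.preimage hcont
      open_target := ht
      continuousOn_toFun := contDiff_tail.continuous.comp_continuousOn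
        (e.continuousOn.comp hcont.continuousOn fun q hq => hq)
      continuousOn_invFun := hc }
  refine ⟨g, g.mem_maximalAtlas_of_contMDiffOn ?_ ?_, rfl, rfl, rfl⟩
  · have h1 : ContMDiffOn 𝓘(ℂ, Cn n) 𝓘(ℂ, Cn (n + 1)) ω (fun q => e (ι q)) g.source :=
      (contMDiffOn_of_mem_maximalAtlas he.1).comp hι.contMDiff.contMDiffOn fun q hq => hq
    exact contMDiff_tail.comp_contMDiffOn h1
  · intro w hw
    refine ContMDiffAt.contMDiffWithinAt ?_
    -- A continuous map into `D` is holomorphic as soon as its composite with the immersion `ι` is,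
    -- and that composite is `w ↦ e.symm (0, w)`.
    rw [ContMDiffAt.iff_comp_isImmersionAt (hι.isImmersion.isImmersionAt _)]
    refine ⟨hc.continuousAt (ht.mem_nhds hw), ?_⟩
    have h1 : ContMDiffAt 𝓘(ℂ, Cn n) 𝓘(ℂ, Cn (n + 1)) ω
        (fun w : Cn n => e.symm (Fin.cons 0 w)) w :=
      ContMDiffAt.comp w (contMDiffAt_symm_of_mem_maximalAtlas he.1 hw)
        contMDiff_cons_zero.contMDiffAt
    exact h1.congr_of_eventuallyEq (mem_of_superset (ht.mem_nhds hw) fun w hw => hinv w hw)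

lemma tangentLin_comp_symm {M : Type*} [TopologicalSpace M] [ChartedSpace (Cn n) M]
    [IsManifold 𝓘(ℂ, Cn n) ω M] {g : OpenPartialHomeomorph M (Cn n)}
    (hg : g ∈ IsManifold.maximalAtlas 𝓘(ℂ, Cn n) ω M) {w : Cn n} (hw : w ∈ g.target) (v : Cn n) :
    tangentLin (n := n) (m := n) g (g.symm w) (tangentLin (n := n) (m := n) g.symm w v) = v := by
  have h1 := mfderiv_comp w (mdifferentiableAt_chart hg (g.map_target hw))
    (mdifferentiableAt_chart_symm hg hw)
  have h2 : (g ∘ g.symm) =ᶠ[𝓝 w] id :=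
    mem_of_superset (g.open_target.mem_nhds hw) fun y hy => g.right_inv hy
  rw [h2.mfderiv_eq, mfderiv_id] at h1
  exact (congrArg (fun L => L v) h1).symm

open Classical in
/-- The integral over the hypersurface of a form supported in an adapted chart. -/
lemma IsAdaptedChart.hasFormIntegral_slice [CompactSpace X] [T2Space X]
    (hι : Manifold.IsSmoothEmbedding 𝓘(ℂ, Cn n) 𝓘(ℂ, Cn (n + 1)) ω ι) (he : IsAdaptedChart ι e)
    {a : Cn (n + 1) → ℂ} (ha : ContinuousOn a e.target) {K : Set (Cn (n + 1))} (hK : IsCompact K)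
    (hKe : K ⊆ e.target) (h0 : ∀ z ∉ K, a z = 0) :
    HasFormIntegral (fun p : D => if ι p ∈ e.source then
        a (e (ι p)) • pullbackForm (fun q : D => Fin.tail (e (ι q))) (stdForm n) p else 0)
      ((-2 * Complex.I) ^ n * ∫ w : Cn n, a (Fin.cons 0 w)) := by
  set θ : Form n D (2 * n) := fun p => if ι p ∈ e.source then
    a (e (ι p)) • pullbackForm (fun q : D => Fin.tail (e (ι q))) (stdForm n) p else 0 with hθ
  have hset : ∫ w : Cn n, a (Fin.cons 0 w) =
      ∫ w in {w : Cn n | (Fin.cons 0 w : Cn (n + 1)) ∈ e.target}, a (Fin.cons 0 w) := by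
    symm
    refine setIntegral_eq_integral_of_forall_compl_eq_zero fun w hw => h0 _ fun h => hw (hKe h)
  -- The induced chart needs a point of `D` for its inverse. If `D` is empty, the first coordinate
  -- of an adapted chart never vanishes and both sides are zero.
  rcases isEmpty_or_nonempty D with hD | hD
  · have hemp : {w : Cn n | (Fin.cons 0 w : Cn (n + 1)) ∈ e.target} = ∅ := by
      refine eq_empty_of_forall_notMem fun w hw => ?_
      obtain ⟨p, -⟩ := (he.2 _ (e.map_target hw)).2 (by rw [e.right_inv hw]; rfl)
      exact hD.elim p
    rw [hset, hemp, setIntegral_empty, mul_zero]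
    have : θ = 0 := funext fun p => hD.elim p
    rw [this]
    exact HasFormIntegral.zero
  · obtain ⟨g, hg, hgs, hgt, hgc⟩ := he.exists_chart hι
    have hpull : ∀ w ∈ g.target, pullbackForm g.symm θ w (stdFrame n) =
        a (Fin.cons 0 w) * (-2 * Complex.I) ^ n := by
      intro w hw
      have hsrc : ι (g.symm w) ∈ e.source := by
        have := g.map_target hw
        rwa [hgs] at this
      have hgw : (Fin.cons 0 w : Cn (n + 1)) = e (ι (g.symm w)) := by
        have h1 := g.right_inv hw
        rw [hgc] at h1
        rw [← he.cons_tail hsrc]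
        exact congrArg _ h1.symm
      have hθw : θ (g.symm w) = a (e (ι (g.symm w))) •
          pullbackForm (fun q : D => Fin.tail (e (ι q))) (stdForm n) (g.symm w) := if_pos hsrc
      simp only [pullbackForm, AlternatingMap.compLinearMap_apply, hθw, AlternatingMap.smul_apply,
        smul_eq_mul]
      rw [← hgw, ← hgc, ← stdForm_stdFrame n (g (g.symm w))]
      congr 2
      ext1 i
      exact tangentLin_comp_symm hg hw _
    have hs : ContinuousOn (fun w : Cn n => a (Fin.cons 0 w)) g.target := by
      rw [hgt]
      exact ha.comp continuous_cons_zero.continuousOn fun w hw => hw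
    have hint : IntegrableOn (fun w => pullbackForm g.symm θ w (stdFrame n)) g.target := by
      refine IntegrableOn.congr_fun ?_ (fun w hw => (hpull w hw).symm) g.open_target.measurableSet
      have hK' : IsCompact ((fun w : Cn n => (Fin.cons (0 : ℂ) w : Cn (n + 1))) ⁻¹' K) := by
        refine Metric.isCompact_of_isClosed_isBounded (hK.isClosed.preimage continuous_cons_zero) ?_
        obtain ⟨C, hC⟩ := hK.isBounded.exists_norm_le
        refine isBounded_iff_forall_norm_le.2 ⟨C, fun w hw => ?_⟩
        rw [← norm_cons_zero]
        exact hC _ hw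
      refine integrableOn_of_support_compact g.open_target (hs.mul continuousOn_const) hK'
        (fun w hw => ?_) fun w _ hw => ?_
      · rw [hgt]; exact hKe hw
      · rw [h0 _ hw, zero_mul]
    have := hasFormIntegral_of_chart hg (fun p hp => ?_) hint
    · rw [setIntegral_congr_fun g.open_target.measurableSet hpull, integral_mul_const, mul_comm,
        hgt, ← hset] at this
      exact this
    · rw [hgs] at hp
      exact if_neg hp

/-- The numerator of the local expression of a form, cut off by the partition of unity. -/
def ResidueData.cutoff {Ω : Form (n + 1) X (2 * (n + 1))} (P : ResidueData ι Ω) (j : Fin P.r) :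
    Cn (n + 1) → ℂ :=
  (P.chart j).target.indicator fun z => (P.ρ j ((P.chart j).symm z) : ℂ) * P.ψ j z

/-- The integral over `D` of the residue form. -/
def ResidueData.integral {Ω : Form (n + 1) X (2 * (n + 1))} (P : ResidueData ι Ω) : ℂ :=
  ∑ j, (-2 * Complex.I) ^ n * ((1 / (((P.m j - 1).factorial : ℂ) * ((P.l j - 1).factorial : ℂ))) *
    ∫ w : Cn n, (dz1^[P.m j - 1] (dz1bar^[P.l j - 1] (P.cutoff j))) (Fin.cons 0 w))

lemma ResidueData.contDiffOn_cutoff {Ω : Form (n + 1) X (2 * (n + 1))} (P : ResidueData ι Ω)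
    (j : Fin P.r) : ContDiffOn ℝ ∞ (fun z => (P.ρ j ((P.chart j).symm z) : ℂ) * P.ψ j z)
      (P.chart j).target :=
  (Complex.ofRealCLM.contDiff.comp_contDiffOn
    ((P.ρ j).contMDiff.contDiffOn_chart (P.adapted j).1)).mul (P.smooth j)

/-- Each summand vanishes off one adapted chart, where it is integrated over the slice `z₁ = 0`.
Replacing the numerator by `P.cutoff j` changes no derivative inside the chart and makes it smooth
with compact support on all of `ℂⁿ⁺¹`. -/
lemma ResidueData.hasFormIntegral_form [CompactSpace X] [T2Space X]
    (hι : Manifold.IsSmoothEmbedding 𝓘(ℂ, Cn n) 𝓘(ℂ, Cn (n + 1)) ω ι)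
    {Ω : Form (n + 1) X (2 * (n + 1))} (P : ResidueData ι Ω) :
    HasFormIntegral P.form P.integral := by
  have hform : P.form = ∑ j, (fun p : D => open Classical in
      if ι p ∈ (P.chart j).source then
        ((1 / (((P.m j - 1).factorial : ℂ) * ((P.l j - 1).factorial : ℂ))) *
          (dz1^[P.m j - 1] (dz1bar^[P.l j - 1] (P.cutoff j))) (P.chart j (ι p))) •
        pullbackForm (fun q : D => Fin.tail (P.chart j (ι q))) (stdForm n) p else 0) := by
    funext p
    rw [Finset.sum_apply]
    refine Finset.sum_congr rfl fun j _ => ?_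
    by_cases hp : ι p ∈ (P.chart j).source
    · rw [if_pos hp, if_pos hp]
      rw [iterate_dz1_dz1bar_eqOn (P.chart j).open_target (f := P.cutoff j)
        (fun z hz => indicator_of_mem hz _) _ _ ((P.chart j).map_source hp)]
    · rw [if_neg hp, if_neg hp]
  rw [hform, ResidueData.integral]
  refine HasFormIntegral.sum _ fun j _ => ?_
  obtain ⟨hK, hKU, h0⟩ := isCompact_image_tsupport (e := P.chart j) (P.subordinate j)
  have hcut : ContDiff ℝ ∞ (P.cutoff j) :=
    (P.contDiffOn_cutoff j).contDiff_indicator (P.chart j).open_target hK.isClosed hKU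
      fun z hz hzK => by rw [h0 z hz hzK, Complex.ofReal_zero, zero_mul]
  have h := (P.adapted j).hasFormIntegral_slice hι (a := fun z =>
    (1 / (((P.m j - 1).factorial : ℂ) * ((P.l j - 1).factorial : ℂ))) *
      (dz1^[P.m j - 1] (dz1bar^[P.l j - 1] (P.cutoff j))) z)
    (continuous_const.mul (contDiff_iterate_dz1_dz1bar hcut _ _).continuous).continuousOn hK hKU
    fun z hz => by
      have hzero : EqOn (P.cutoff j) (fun _ => 0) (P.chart j '' tsupport (P.ρ j))ᶜ := by
        intro y hy
        by_cases hyt : y ∈ (P.chart j).target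
        · simp only [ResidueData.cutoff, indicator_of_mem hyt, h0 y hyt hy, Complex.ofReal_zero,
            zero_mul]
        · exact indicator_of_notMem hyt _
      rw [iterate_dz1_dz1bar_eqOn hK.isClosed.isOpen_compl hzero _ _ hz, iterate_dz1_dz1bar_zero,
        mul_zero]
  rw [integral_const_mul] at h
  exact h

end HypersurfaceCharts

/-! ### Metrics on line bundles. -/

section LineBundles

variable {n : ℕ}
variable {X : Type*} [TopologicalSpace X] [ChartedSpace (Cn (n + 1)) X]

/-- Holomorphic functions are smooth in the real sense. -/
lemma ContMDiffAt.real_of_complex {F : Type*} [NormedAddCommGroup F] [NormedSpace ℂ F] {f : X → F}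
    {x : X} (hf : ContMDiffAt 𝓘(ℂ, Cn (n + 1)) 𝓘(ℂ, F) ω f x) :
    ContMDiffAt 𝓘(ℝ, Cn (n + 1)) 𝓘(ℝ, F) ∞ f x := by
  rw [contMDiffAt_iff] at hf ⊢
  refine ⟨hf.1, ?_⟩
  have h := (hf.2.restrict_scalars ℝ).of_le (m := ∞) (by simp)
  simpa only [mfld_simps, Function.comp_def] using h

variable {L : X → Type*} [TopologicalSpace (Bundle.TotalSpace ℂ L)] [∀ x, TopologicalSpace (L x)]
  [∀ x, AddCommGroup (L x)] [∀ x, Module ℂ (L x)] [FiberBundle ℂ L] [VectorBundle ℂ ℂ L]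

lemma trivialization_smul (x₀ : X) {x : X} (hx : x ∈ (trivializationAt ℂ L x₀).baseSet) (c : ℂ)
    (v : L x) : (trivializationAt ℂ L x₀ (⟨x, c • v⟩ : Bundle.TotalSpace ℂ L)).2 =
      c * (trivializationAt ℂ L x₀ (⟨x, v⟩ : Bundle.TotalSpace ℂ L)).2 :=
  map_smul ((trivializationAt ℂ L x₀).linearEquivAt ℂ x hx) c v

lemma trivialization_eq_zero_iff (x₀ : X) {x : X} (hx : x ∈ (trivializationAt ℂ L x₀).baseSet)
    (v : L x) : (trivializationAt ℂ L x₀ (⟨x, v⟩ : Bundle.TotalSpace ℂ L)).2 = 0 ↔ v = 0 :=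
  ((trivializationAt ℂ L x₀).linearEquivAt ℂ x hx).map_eq_zero_iff

lemma eq_smul_frame (x₀ : X) {x : X} (hx : x ∈ (trivializationAt ℂ L x₀).baseSet) (v : L x) :
    v = (trivializationAt ℂ L x₀ (⟨x, v⟩ : Bundle.TotalSpace ℂ L)).2 •
      (trivializationAt ℂ L x₀).symm x (1 : ℂ) := by
  have h := map_smul ((trivializationAt ℂ L x₀).linearEquivAt ℂ x hx).symm
    (trivializationAt ℂ L x₀ (⟨x, v⟩ : Bundle.TotalSpace ℂ L)).2 (1 : ℂ)
  rw [smul_eq_mul, mul_one] at h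
  refine Eq.trans ?_ h
  exact (((trivializationAt ℂ L x₀).linearEquivAt ℂ x hx).symm_apply_apply v).symm

lemma frame_ne_zero (x₀ : X) {x : X} (hx : x ∈ (trivializationAt ℂ L x₀).baseSet) :
    (trivializationAt ℂ L x₀).symm x (1 : ℂ) ≠ 0 := by
  intro h
  have h1 := (trivialization_eq_zero_iff x₀ hx _).2 h
  rw [(trivializationAt ℂ L x₀).apply_mk_symm hx] at h1
  exact one_ne_zero h1

namespace LineBundleMetric

lemma norm_eq (h : LineBundleMetric n L) (x₀ : X) {x : X}
    (hx : x ∈ (trivializationAt ℂ L x₀).baseSet) (v : L x) :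
    h.norm x v = ‖(trivializationAt ℂ L x₀ (⟨x, v⟩ : Bundle.TotalSpace ℂ L)).2‖ *
      h.norm x ((trivializationAt ℂ L x₀).symm x (1 : ℂ)) := by
  conv_lhs => rw [eq_smul_frame x₀ hx v, h.norm_smul]

lemma norm_zero (h : LineBundleMetric n L) (x : X) : h.norm x 0 = 0 := by
  have := h.norm_smul x 0 0
  simpa using this

end LineBundleMetric

variable [ContMDiffVectorBundle ω ℂ L 𝓘(ℂ, Cn (n + 1))]

/-- A holomorphic line bundle on a compact complex manifold has a smooth metric. -/
lemma LineBundleMetric.nonempty [T2Space X] [CompactSpace X]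
    [IsManifold 𝓘(ℂ, Cn (n + 1)) ω X] : Nonempty (LineBundleMetric n L) := by
  have hman := isManifold_real (M := X) (n := n + 1)
  obtain ⟨t, ht⟩ := CompactSpace.elim_nhds_subcover (fun x => (trivializationAt ℂ L x).baseSet)
    fun x => (trivializationAt ℂ L x).open_baseSet.mem_nhds (FiberBundle.mem_baseSet_trivializationAt ℂ L x)
  obtain ⟨ρ, hρ⟩ := SmoothPartitionOfUnity.exists_isSubordinate 𝓘(ℝ, Cn (n + 1)) isClosed_univ
    (fun j : t => (trivializationAt ℂ L (j : X)).baseSet)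
    (fun j => (trivializationAt ℂ L (j : X)).open_baseSet) (by
      rw [← top_eq_univ, ← ht]
      intro y hy
      obtain ⟨x, hxt, hy⟩ := mem_iUnion₂.1 hy
      exact mem_iUnion.2 ⟨⟨x, hxt⟩, hy⟩)
  have hmem : ∀ {j : t} {x : X}, ρ j x ≠ 0 → x ∈ (trivializationAt ℂ L (j : X)).baseSet :=
    fun {j x} h => hρ j (subset_tsupport _ h)
  -- The metric is a convex combination of the absolute values in finitely many trivialisations.
  refine ⟨⟨fun x v => ∑ j, ρ j x *
    ‖(trivializationAt ℂ L (j : X) (⟨x, v⟩ : Bundle.TotalSpace ℂ L)).2‖, ?_, ?_, ?_⟩⟩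
  · intro x v hv
    obtain ⟨j, hj⟩ : ∃ j, ρ j x ≠ 0 := by
      by_contra! h
      have := ρ.sum_eq_one (mem_univ x)
      rw [finsum_eq_sum_of_fintype, Finset.sum_eq_zero fun j _ => h j] at this
      exact zero_ne_one this
    refine Finset.sum_pos' (fun i _ => mul_nonneg (ρ.nonneg i x) (norm_nonneg _))
      ⟨j, Finset.mem_univ j, mul_pos ((ρ.nonneg j x).lt_of_ne' hj) (norm_pos_iff.2 fun h => ?_)⟩
    exact hv ((trivialization_eq_zero_iff _ (hmem hj) v).1 h)
  · intro x c v
    rw [Finset.mul_sum]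
    refine Finset.sum_congr rfl fun j _ => ?_
    by_cases hj : ρ j x = 0
    · simp [hj]
    · rw [trivialization_smul _ (hmem hj), norm_mul]; ring
  · intro x₀ x hx
    refine ContMDiffAt.contMDiffWithinAt ?_
    refine contMDiffAt_finsetSum fun j _ => ?_
    by_cases hj : x ∈ tsupport (ρ j)
    · have hxj := hρ j hj
      refine (ρ j).contMDiff.contMDiffAt.mul ?_
      have ho : (trivializationAt ℂ L x₀).baseSet ∩ (trivializationAt ℂ L (j : X)).baseSet ∈ 𝓝 x :=
        ((trivializationAt ℂ L x₀).open_baseSet.inter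
          (trivializationAt ℂ L (j : X)).open_baseSet).mem_nhds ⟨hx, hxj⟩
      -- The frame of one trivialisation read in another is a nowhere vanishing holomorphic
      -- function, so its absolute value is smooth.
      have h1 : ContMDiffAt 𝓘(ℂ, Cn (n + 1)) 𝓘(ℂ, ℂ →L[ℂ] ℂ) ω
          (fun b : X => ((trivializationAt ℂ L x₀).coordChangeL ℂ
            (trivializationAt ℂ L (j : X)) b : ℂ →L[ℂ] ℂ)) x :=
        (contMDiffOn_coordChangeL (IB := 𝓘(ℂ, Cn (n + 1))) (n := ω) (trivializationAt ℂ L x₀)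
          (trivializationAt ℂ L (j : X))).contMDiffAt ho
      have h2 : ContMDiffAt 𝓘(ℂ, Cn (n + 1)) 𝓘(ℂ, ℂ) ω
          (fun b : X => ((trivializationAt ℂ L x₀).coordChangeL ℂ
            (trivializationAt ℂ L (j : X)) b : ℂ →L[ℂ] ℂ) 1) x :=
        h1.clm_apply contMDiffAt_const
      have h3 : ((trivializationAt ℂ L x₀).coordChangeL ℂ
            (trivializationAt ℂ L (j : X)) x : ℂ →L[ℂ] ℂ) 1 ≠ 0 := by
        intro h0
        have := (((trivializationAt ℂ L x₀).coordChangeL ℂ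
            (trivializationAt ℂ L (j : X)) x)).map_eq_zero_iff.1 h0
        exact one_ne_zero this
      have h4 : ContMDiffAt 𝓘(ℝ, Cn (n + 1)) 𝓘(ℝ, ℝ) ∞
          (fun b : X => ‖((trivializationAt ℂ L x₀).coordChangeL ℂ
            (trivializationAt ℂ L (j : X)) b : ℂ →L[ℂ] ℂ) 1‖) x :=
        ((contDiffAt_norm ℝ h3).contMDiffAt).comp x h2.real_of_complex
      refine h4.congr_of_eventuallyEq (mem_of_superset ho fun b hb => ?_)
      exact congrArg (fun c : ℂ => ‖c‖) ((trivializationAt ℂ L x₀).coordChangeL_apply (R := ℂ) _ hb _).symm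
    · refine (contMDiffAt_const (c := (0 : ℝ))).congr_of_eventuallyEq ?_
      filter_upwards [(isClosed_tsupport (ρ j)).isOpen_compl.mem_nhds hj] with y hy
      rw [image_eq_zero_of_notMem_tsupport hy, zero_mul]

end LineBundles

/-! ### The norm of the section near the hypersurface. -/

section Sections

variable {n : ℕ}
variable {X : Type*} [TopologicalSpace X] [ChartedSpace (Cn (n + 1)) X]
  [IsManifold 𝓘(ℂ, Cn (n + 1)) ω X]
variable {D : Type*} {ι : D → X}
variable {L : X → Type*} [TopologicalSpace (Bundle.TotalSpace ℂ L)] [∀ x, TopologicalSpace (L x)]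
  [∀ x, AddCommGroup (L x)] [∀ x, Module ℂ (L x)] [FiberBundle ℂ L] [VectorBundle ℂ ℂ L]
  [ContMDiffVectorBundle ω ℂ L 𝓘(ℂ, Cn (n + 1))]
variable {s : ∀ x, L x}

/-- An embedding need not have closed image; closedness comes from `D` being the zero set of a
continuous section. Compactness of `D` is deduced from it. -/
lemma isClosed_range_of_zeroLocus
    (hs : ContMDiff 𝓘(ℂ, Cn (n + 1)) (𝓘(ℂ, Cn (n + 1)).prod 𝓘(ℂ, ℂ)) ω
      (fun x => (⟨x, s x⟩ : Bundle.TotalSpace ℂ L)))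
    (hsD : ∀ x, s x = 0 ↔ x ∈ range ι) : IsClosed (range ι) := by
  rw [← isOpen_compl_iff, isOpen_iff_mem_nhds]
  intro x hx
  have h1 := ((Bundle.contMDiffAt_section x).1 (hs x)).continuousAt
  have hb := FiberBundle.mem_baseSet_trivializationAt ℂ L x
  have h2 : (trivializationAt ℂ L x (⟨x, s x⟩ : Bundle.TotalSpace ℂ L)).2 ≠ 0 := fun h =>
    hx ((hsD x).1 ((trivialization_eq_zero_iff x hb _).1 h))
  filter_upwards [h1.eventually_ne h2, (trivializationAt ℂ L x).open_baseSet.mem_nhds hb]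
    with y hy hyb hyD
  exact hy ((trivialization_eq_zero_iff x hyb _).2 ((hsD y).2 hyD))

lemma one_le_of_hasVanishingOrderAt {x : X} {o : ℕ} (hx : s x = 0) (hxD : x ∈ range ι)
    (h : HasVanishingOrderAt (n := n) ι s x o) : 1 ≤ o := by
  obtain ⟨e, he, hxe, u, -, hu0, hu⟩ := h
  have h1 := hu.self_of_nhds
  rw [(trivialization_eq_zero_iff x (FiberBundle.mem_baseSet_trivializationAt ℂ L x) _).2 hx,
    (he.2 x hxe).1 hxD] at h1
  by_contra! ho
  obtain rfl : o = 0 := by omega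
  rw [pow_zero, one_mul] at h1
  exact hu0 h1.symm

variable (h : LineBundleMetric n L)

/-- If `s = z₁ᵒ w` near a point, in a local frame, then `|s| = |z₁|ᵒ eᴮ` with `B` smooth. -/
lemma LineBundleMetric.exists_weight_of_eq {e : OpenPartialHomeomorph X (Cn (n + 1))}
    (he : e ∈ IsManifold.maximalAtlas 𝓘(ℂ, Cn (n + 1)) ω X) {z₁ : Cn (n + 1)} (hz₁ : z₁ ∈ e.target)
    {o : ℕ} {w : Cn (n + 1) → ℂ} (hw : ∀ᶠ z in 𝓝 z₁, ContDiffAt ℝ ∞ w z) (hw0 : w z₁ ≠ 0)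
    (heq : ∀ᶠ z in 𝓝 z₁, (trivializationAt ℂ L (e.symm z₁)
      (⟨e.symm z, s (e.symm z)⟩ : Bundle.TotalSpace ℂ L)).2 = z 0 ^ o * w z) :
    ∃ B : Cn (n + 1) → ℝ, ∀ᶠ z in 𝓝 z₁, ContDiffAt ℝ ∞ B z ∧
      h.norm (e.symm z) (s (e.symm z)) = ‖z 0‖ ^ o * Real.exp (B z) := by
  set t := trivializationAt ℂ L (e.symm z₁) with ht
  let N : X → ℝ := fun x => h.norm x (t.symm x (1 : ℂ))
  have hN : ContDiffOn ℝ ∞ (fun z => N (e.symm z)) (e.target ∩ e.symm ⁻¹' t.baseSet) :=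
    (h.smooth (e.symm z₁)).contDiffOn_chart he
  have ho : IsOpen (e.target ∩ e.symm ⁻¹' t.baseSet) :=
    e.isOpen_inter_preimage_symm t.open_baseSet
  have hmem : e.target ∩ e.symm ⁻¹' t.baseSet ∈ 𝓝 z₁ :=
    ho.mem_nhds ⟨hz₁, FiberBundle.mem_baseSet_trivializationAt ℂ L _⟩
  refine ⟨fun z => Real.log ‖w z‖ + Real.log (N (e.symm z)), ?_⟩
  filter_upwards [hw, heq, hmem, hw.self_of_nhds.continuousAt.eventually_ne hw0]
    with z hwz hz hzm hwz0
  have hN0 : 0 < N (e.symm z) := h.norm_pos _ _ (frame_ne_zero _ hzm.2)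
  refine ⟨((hwz.norm ℝ hwz0).log (norm_ne_zero_iff.2 hwz0)).add
    ((hN.contDiffAt (ho.mem_nhds hzm)).log hN0.ne'), ?_⟩
  rw [h.norm_eq (e.symm z₁) hzm.2, hz, norm_mul, norm_pow, Real.exp_add,
    Real.exp_log (norm_pos_iff.2 hwz0), Real.exp_log hN0, mul_assoc]

/-- The norm of the section in an adapted chart is `|z₁|ᵒ eᴮ` with `B` smooth. -/
lemma LineBundleMetric.exists_weight
    (hs : ContMDiff 𝓘(ℂ, Cn (n + 1)) (𝓘(ℂ, Cn (n + 1)).prod 𝓘(ℂ, ℂ)) ω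
      (fun x => (⟨x, s x⟩ : Bundle.TotalSpace ℂ L)))
    (hsD : ∀ x, s x = 0 ↔ x ∈ range ι)
    {o : ℕ} (ho : ∀ p : D, HasVanishingOrderAt (n := n) ι s (ι p) o)
    {e : OpenPartialHomeomorph X (Cn (n + 1))} (he : IsAdaptedChart ι e) :
    ∃ B : Cn (n + 1) → ℝ, ContDiffOn ℝ ∞ B e.target ∧ ∀ z ∈ e.target,
      h.norm (e.symm z) (s (e.symm z)) = ‖z 0‖ ^ o * Real.exp (B z) := by
  have hloc : ∀ z₁ ∈ e.target, ∃ B : Cn (n + 1) → ℝ, ∀ᶠ z in 𝓝 z₁, ContDiffAt ℝ ∞ B z ∧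
      h.norm (e.symm z) (s (e.symm z)) = ‖z 0‖ ^ o * Real.exp (B z) := by
    intro z₁ hz₁
    have hchart : ∀ {f : X → ℂ}, ContMDiffAt 𝓘(ℂ, Cn (n + 1)) 𝓘(ℂ, ℂ) ω f (e.symm z₁) →
        ∀ᶠ z in 𝓝 z₁, ContDiffAt ℝ ∞ (fun z => f (e.symm z)) z := by
      intro f hf
      have h1 : ContMDiffAt 𝓘(ℂ, Cn (n + 1)) 𝓘(ℂ, ℂ) ω (fun z => f (e.symm z)) z₁ :=
        ContMDiffAt.comp z₁ hf (contMDiffAt_symm_of_mem_maximalAtlas he.1 hz₁)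
      filter_upwards [h1.contDiffAt.eventually (by simp)] with z hz
      exact (hz.restrict_scalars ℝ).of_le (by simp)
    have hcont := e.continuousAt_symm hz₁
    by_cases hD : e.symm z₁ ∈ range ι
    · obtain ⟨p, hp⟩ := hD
      have h0 : e (e.symm z₁) 0 = 0 := (he.2 _ (e.map_target hz₁)).1 ⟨p, hp⟩
      have hop := ho p
      rw [hp] at hop
      obtain ⟨e', he', hpe', u, hu, hu0, hue⟩ := hop
      -- The vanishing order is given in some other adapted chart; the unit between the two first
      -- coordinates is absorbed into the nonvanishing factor.
      obtain ⟨v, W, hW, hpW, hWS, hv, hv0, hv'⟩ :=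
        he.exists_unit he' (e.map_target hz₁) hpe' h0
      rw [e.right_inv hz₁] at hpW
      refine h.exists_weight_of_eq he.1 hz₁ (w := fun z => v z ^ o * u (e.symm z)) ?_
        (mul_ne_zero (pow_ne_zero _ (hv0 _ hpW)) hu0) ?_
      · filter_upwards [hchart hu, hW.mem_nhds hpW] with z hz hzW
        exact ((hv.contDiffAt (hW.mem_nhds hzW)).pow o).mul hz
      · filter_upwards [hcont.eventually hue, hW.mem_nhds hpW] with z hz hzW
        rw [hz, hv' z hzW, mul_pow, mul_assoc]
    · have hz0 : z₁ 0 ≠ 0 := fun h0 => hD ((he.2 _ (e.map_target hz₁)).2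
        (by rw [e.right_inv hz₁, h0]))
      have hev : ∀ᶠ z : Cn (n + 1) in 𝓝 z₁, z 0 ≠ 0 :=
        (continuous_apply 0).continuousAt.eventually_ne hz0
      -- Off `D` both `s` and `z₁` are nonzero, so dividing by `z₁ᵒ` is harmless and gives the same
      -- shape.
      refine h.exists_weight_of_eq he.1 hz₁ (w := fun z => (trivializationAt ℂ L (e.symm z₁)
        (⟨e.symm z, s (e.symm z)⟩ : Bundle.TotalSpace ℂ L)).2 * (z 0 ^ o)⁻¹) ?_ ?_ ?_
      · filter_upwards [hchart ((Bundle.contMDiffAt_section _).1 (hs (e.symm z₁))), hev] with z hz hz0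
        have h1 : ContDiffAt ℝ ∞ (fun z : Cn (n + 1) => z 0 ^ o) z :=
          ((contDiff_apply ℝ ℂ (0 : Fin (n + 1))).pow o).contDiffAt
        exact hz.mul (h1.inv (pow_ne_zero _ hz0))
      · refine mul_ne_zero (fun h1 => hD ((hsD _).1 ?_)) (inv_ne_zero (pow_ne_zero _ hz0))
        exact (trivialization_eq_zero_iff _ (FiberBundle.mem_baseSet_trivializationAt ℂ L _) _).1 h1
      · filter_upwards [hev] with z hz
        field_simp
  choose! B hB using hloc
  -- The local weights glue: where `z₁ ≠ 0` the norm of `s` determines `B`, and by density and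
  -- continuity any two of them agree at common points.
  refine ⟨fun z => B z z, fun z₁ hz₁ => ?_, fun z hz => (hB z hz).self_of_nhds.2⟩
  refine ContDiffAt.contDiffWithinAt ?_
  refine (hB z₁ hz₁).self_of_nhds.1.congr_of_eventuallyEq ?_
  filter_upwards [(hB z₁ hz₁), e.open_target.mem_nhds hz₁, (hB z₁ hz₁).eventually_nhds]
    with z hz hze hzz
  have hne : (𝓝[{z : Cn (n + 1) | z 0 ≠ 0}] z).NeBot :=
    mem_closure_iff_nhdsWithin_neBot.1 (dense_ne_zero n z)
  have h1 : Tendsto (B z₁) (𝓝[{z : Cn (n + 1) | z 0 ≠ 0}] z) (𝓝 (B z₁ z)) :=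
    hz.1.continuousAt.mono_left nhdsWithin_le_nhds
  have h2 : Tendsto (B z) (𝓝[{z : Cn (n + 1) | z 0 ≠ 0}] z) (𝓝 (B z z)) :=
    (hB z hze).self_of_nhds.1.continuousAt.mono_left nhdsWithin_le_nhds
  refine tendsto_nhds_unique h2 (h1.congr' ?_)
  filter_upwards [nhdsWithin_le_nhds hzz, nhdsWithin_le_nhds (hB z hze), self_mem_nhdsWithin]
    with y a b (c : y 0 ≠ 0)
  have := a.2.symm.trans b.2
  exact Real.exp_injective (mul_left_cancel₀ (pow_ne_zero _ (norm_ne_zero_iff.2 c)) this)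

end Sections

/-! ### Scalars, the empty manifold and the zero form. -/

section Integrals

variable {n : ℕ} {M : Type*} [TopologicalSpace M] [ChartedSpace (Cn n) M]

lemma HasFormIntegral.const_smul {η : Form n M (2 * n)} {J : ℂ} (h : HasFormIntegral η J) (a : ℂ) :
    HasFormIntegral (a • η) (a * J) := by
  intro r e ρ he hρ
  obtain ⟨h1, h2⟩ := h r e ρ he hρ
  have e1 : ∀ j, (fun z => (ρ j ((e j).symm z) : ℂ) *
      pullbackForm (e j).symm (a • η) z (stdFrame n)) = fun z =>
      a * ((ρ j ((e j).symm z) : ℂ) * pullbackForm (e j).symm η z (stdFrame n)) := by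
    intro j
    ext z
    simp only [pullbackForm, AlternatingMap.compLinearMap_apply, Pi.smul_apply,
      AlternatingMap.smul_apply, smul_eq_mul]
    ring
  refine ⟨fun j => ?_, ?_⟩
  · rw [e1]; exact (h1 j).const_mul a
  · simp only [e1, integral_const_mul]
    rw [← Finset.mul_sum, h2]

/-- On an empty manifold the empty family of charts is admissible, and its sum is `0`. This serves
the case `D = ∅`. -/
lemma HasFormIntegral.eq_zero_of_isEmpty [IsEmpty M] {η : Form n M (2 * n)} {J : ℂ}
    (h : HasFormIntegral η J) : J = 0 := by
  let ρ : SmoothPartitionOfUnity (Fin 0) 𝓘(ℝ, Cn n) M :=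
    { toFun := fun j => j.elim0
      locallyFinite' := fun x => isEmptyElim x
      nonneg' := fun j => j.elim0
      sum_eq_one' := fun x => isEmptyElim x
      sum_le_one' := fun x => isEmptyElim x }
  have := (h 0 (fun j => j.elim0) ρ (fun j => j.elim0) fun j => j.elim0).2
  simpa using this.symm

lemma isAeppliExact_zero : IsAeppliExact (2 * n) (0 : Form n M (2 * n)) := by
  obtain _ | m := n
  · exact (rfl : (0 : Form 0 M 0) = 0)
  · change ∃ η ν : Form (m + 1) M (2 * m + 1), _
    refine ⟨0, 0, ?_, ?_, ?_⟩
    · intro e _ v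
      simpa [pullbackForm] using contDiffOn_const
    · intro e _ v
      simpa [pullbackForm] using contDiffOn_const
    · intro e _ z _ v
      simp [pullbackForm, delFlat, delbarFlat]

end Integrals

/-! ### Taylor expansions with holomorphic remainder. -/

section Entire

/-- Used with `w = tφ` when the metric changes by `e^{-φ}`. Since the remainder is entire, its
integral is again continued with at most a simple pole. -/
lemma exists_entire_remainder : ∃ E : ℂ → ℂ, Differentiable ℂ E ∧
    ∀ w, Complex.exp (-2 * w) = 1 - 2 * w + w ^ 2 * E w := by
  let f : ℂ → ℂ := fun w => Complex.exp (-2 * w)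
  have hf : Differentiable ℂ f := by fun_prop
  have hd : ∀ {g : ℂ → ℂ}, Differentiable ℂ g → Differentiable ℂ (dslope g 0) := fun {g} hg => by
    rw [← differentiableOn_univ] at hg ⊢
    exact (Complex.differentiableOn_dslope univ_mem).2 hg
  refine ⟨dslope (dslope f 0) 0, hd (hd hf), fun w => ?_⟩
  have h0 : dslope f 0 0 = -2 := by
    rw [dslope_same]
    have : HasDerivAt f (Complex.exp (-2 * 0) * (-2 * 1)) 0 :=
      ((hasDerivAt_id (0 : ℂ)).const_mul (-2)).cexp
    simpa using this.deriv
  have h1 := sub_smul_dslope f 0 w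
  have h2 := sub_smul_dslope (dslope f 0) 0 w
  simp only [sub_zero, smul_eq_mul, h0] at h1 h2
  have hf0 : f 0 = 1 := by simp [f]
  rw [hf0] at h1
  change f w = _
  linear_combination -h1 - w * h2

lemma AnalyticAt.exists_eq_add_mul {R : ℂ → ℂ} (hR : AnalyticAt ℂ R 0) :
    ∃ S : ℂ → ℂ, AnalyticAt ℂ S 0 ∧ S 0 = deriv R 0 ∧ ∀ t, R t = R 0 + t * S t := by
  obtain ⟨p, hp⟩ := hR
  refine ⟨dslope R 0, ⟨_, hp.has_fpower_series_dslope_fslope⟩, dslope_same R 0, fun t => ?_⟩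
  have := sub_smul_dslope R 0 t
  rw [sub_zero, smul_eq_mul] at this
  rw [this]; ring

end Entire

/-! ### Globalisation: the residue at `0` is the integral of the residue form. -/

section ResidueIntegral

variable {n : ℕ}
variable {X : Type*} [TopologicalSpace X] [T2Space X] [CompactSpace X]
  [ChartedSpace (Cn (n + 1)) X] [IsManifold 𝓘(ℂ, Cn (n + 1)) ω X]
variable {D : Type*} [TopologicalSpace D] [ChartedSpace (Cn n) D] [IsManifold 𝓘(ℂ, Cn n) ω D]
variable {ι : D → X} {Ω : Form (n + 1) X (2 * (n + 1))}

/-- A representative is ambiguous in two ways: by an exact form, which Stokes' theorem on the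
compact `D` disposes of, and by the residue data, which is the hypothesis `h`. -/
lemma ResidueData.hasAeppliResidueIntegral
    (hι : Manifold.IsSmoothEmbedding 𝓘(ℂ, Cn n) 𝓘(ℂ, Cn (n + 1)) ω ι) (hD : IsClosed (range ι))
    (P : ResidueData ι Ω) (h : ∀ P' : ResidueData ι Ω, P'.integral = P.integral) :
    HasAeppliResidueIntegral ι Ω P.integral := by
  have hc : CompactSpace D := (⟨hι.isEmbedding, hD⟩ : IsClosedEmbedding ι).compactSpace
  have ht : T2Space D := hι.isEmbedding.t2Space
  refine ⟨⟨P.form, P, ?_⟩, ?_⟩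
  · rw [sub_self]; exact isAeppliExact_zero
  · rintro θ ⟨P', hP'⟩
    have := (hP'.hasFormIntegral_zero).add (P'.hasFormIntegral_form hι)
    rwa [sub_add_cancel, zero_add, h P'] at this

variable {L : X → Type*} [TopologicalSpace (Bundle.TotalSpace ℂ L)] [∀ x, TopologicalSpace (L x)]
  [∀ x, AddCommGroup (L x)] [∀ x, Module ℂ (L x)] [FiberBundle ℂ L] [VectorBundle ℂ ℂ L]
  [ContMDiffVectorBundle ω ℂ L 𝓘(ℂ, Cn (n + 1))]
variable {s : ∀ x, L x}

omit [T2Space X] in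
/-- The local integrand of `∫ |s|^{2t} Q(tφ) Ω`, without the singular factor. -/
lemma ResidueData.isHolFamily (P : ResidueData ι Ω) (j : Fin P.r) {Q : ℂ → ℂ}
    (hQ : Differentiable ℂ Q) {φ : X → ℝ} (hφ : ContMDiff 𝓘(ℝ, Cn (n + 1)) 𝓘(ℝ, ℝ) ∞ φ)
    {B : Cn (n + 1) → ℝ} (hB : ContDiffOn ℝ ∞ B (P.chart j).target) :
    IsHolFamily (fun t => (P.chart j).target.indicator fun z =>
      ((P.ρ j ((P.chart j).symm z) : ℂ) * P.ψ j z) *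
        (Complex.exp (2 * t * B z) * Q (t * φ ((P.chart j).symm z)))) := by
  obtain ⟨hK, hKU, h0⟩ := isCompact_image_tsupport (e := P.chart j) (P.subordinate j)
  refine ⟨?_, fun z => ?_, _, hK, fun t z hz => ?_⟩
  · have hsnd : ∀ {F : Type _} [NormedAddCommGroup F] [NormedSpace ℝ F] {f : Cn (n + 1) → F},
        ContDiffOn ℝ ∞ f (P.chart j).target →
        ContDiffOn ℝ ∞ (fun p : ℂ × Cn (n + 1) => f p.2) (univ ×ˢ (P.chart j).target) :=
      fun hf => hf.comp contDiff_snd.contDiffOn fun p hp => hp.2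
    have hsm : ContDiffOn ℝ ∞ (fun p : ℂ × Cn (n + 1) =>
        ((P.ρ j ((P.chart j).symm p.2) : ℂ) * P.ψ j p.2) *
          (Complex.exp (2 * p.1 * B p.2) * Q (p.1 * φ ((P.chart j).symm p.2))))
        (univ ×ˢ (P.chart j).target) := by
      refine (hsnd (P.contDiffOn_cutoff j)).mul (ContDiffOn.mul ?_ ?_)
      · exact (((contDiff_const.mul contDiff_fst).contDiffOn).mul
          (hsnd (Complex.ofRealCLM.contDiff.comp_contDiffOn hB))).cexp
      · have hQ' : ContDiff ℝ ∞ Q := hQ.contDiff.restrict_scalars ℝ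
        exact hQ'.comp_contDiffOn (contDiff_fst.contDiffOn.mul
          (hsnd (Complex.ofRealCLM.contDiff.comp_contDiffOn
            (hφ.contDiffOn_chart (P.adapted j).1))))
    have := hsm.contDiff_indicator (isOpen_univ.prod (P.chart j).open_target)
      (isClosed_univ.prod hK.isClosed) (prod_mono subset_rfl hKU) fun p hp hpK => by
        have : p.2 ∉ P.chart j '' tsupport (P.ρ j) := fun h => hpK ⟨mem_univ _, h⟩
        rw [h0 p.2 hp.2 this, Complex.ofReal_zero, zero_mul, zero_mul]
    convert this using 1
    ext p
    by_cases hp : p.2 ∈ (P.chart j).target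
    · rw [indicator_of_mem hp, indicator_of_mem (show p ∈ univ ×ˢ _ from ⟨mem_univ _, hp⟩)]
    · rw [indicator_of_notMem hp, indicator_of_notMem fun h => hp h.2]
  · by_cases hz : z ∈ (P.chart j).target
    · simp only [indicator_of_mem hz]
      have h1 : Differentiable ℂ (fun t : ℂ => Q (t * φ ((P.chart j).symm z))) :=
        hQ.comp (differentiable_id.mul_const _)
      fun_prop
    · simp only [indicator_of_notMem hz]
      fun_prop
  · by_cases hzt : z ∈ (P.chart j).target
    · rw [indicator_of_mem hzt, h0 z hzt hz, Complex.ofReal_zero, zero_mul, zero_mul]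
    · exact indicator_of_notMem hzt _

lemma cpow_weight {o : ℕ} {r B : ℝ} (hr : 0 < r) (t : ℂ) :
    ((r ^ o * Real.exp B : ℝ) : ℂ) ^ (2 * t) =
      (r : ℂ) ^ (2 * (o : ℂ) * t) * Complex.exp (2 * t * B) := by
  have h1 : 0 < r ^ o * Real.exp B := by positivity
  rw [Complex.cpow_def_of_ne_zero (by exact_mod_cast h1.ne'),
    Complex.cpow_def_of_ne_zero (by exact_mod_cast hr.ne'), ← Complex.ofReal_log h1.le,
    ← Complex.ofReal_log hr.le, Real.log_mul (pow_pos hr o).ne' (Real.exp_pos B).ne', Real.log_pow,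
    Real.log_exp, ← Complex.exp_add]
  congr 1
  push_cast
  ring

/-- The meromorphic continuation of `∫ |s|^{2t} Q(tφ) Ω` has at most a simple pole at `0`, and its
residue is given by residue data. -/
lemma ResidueData.exists_hasPoleContinuation (P : ResidueData ι Ω) (h : LineBundleMetric n L)
    (hs : ContMDiff 𝓘(ℂ, Cn (n + 1)) (𝓘(ℂ, Cn (n + 1)).prod 𝓘(ℂ, ℂ)) ω
      (fun x => (⟨x, s x⟩ : Bundle.TotalSpace ℂ L)))
    (hsD : ∀ x, s x = 0 ↔ x ∈ range ι)
    {o : ℕ} (ho1 : 1 ≤ o) (ho : ∀ p : D, HasVanishingOrderAt (n := n) ι s (ι p) o)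
    {Q : ℂ → ℂ} (hQ : Differentiable ℂ Q) {φ : X → ℝ}
    (hφ : ContMDiff 𝓘(ℝ, Cn (n + 1)) 𝓘(ℝ, ℝ) ∞ φ) :
    ∃ (f : ℂ → ℂ) (r : ℂ), HasPoleContinuation f r ∧
      (Q 0 = 1 → r = -(2 * (Real.pi : ℂ) * Complex.I / o) * P.integral) ∧
      ∃ c : ℝ, ∀ t : ℂ, c < t.re →
        HasFormIntegral (fun x => ((h.norm x (s x) : ℂ) ^ (2 * t) * Q (t * φ x)) • Ω x) (f t) := by
  choose B hB hBeq using fun j => h.exists_weight hs hsD ho (P.adapted j)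
  -- The factor `Q` is `1` for the integral itself and the entire remainder `E` for the comparison
  -- of two metrics.
  let G : Fin P.r → ℂ → Cn (n + 1) → ℂ := fun j t => (P.chart j).target.indicator fun z =>
    ((P.ρ j ((P.chart j).symm z) : ℂ) * P.ψ j z) *
      (Complex.exp (2 * t * B j z) * Q (t * φ ((P.chart j).symm z)))
  have hG : ∀ j, IsHolFamily (G j) := fun j => P.isHolFamily j hQ hφ (hB j)
  let η : ℂ → Form (n + 1) X (2 * (n + 1)) := fun t x =>
    ((h.norm x (s x) : ℂ) ^ (2 * t) * Q (t * φ x)) • Ω x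
  -- On `z₁ = 0` the values of `Ω` are arbitrary; that set is null, so the identity is only needed
  -- off it.
  have hpt : ∀ j t, ∀ z ∈ (P.chart j).target, z 0 ≠ 0 → (P.ρ j ((P.chart j).symm z) : ℂ) *
      pullbackForm (P.chart j).symm (η t) z (stdFrame (n + 1)) =
      (-2 * Complex.I) ^ (n + 1) * (kern o (-(P.m j : ℤ)) (-(P.l j : ℤ)) t (z 0) * G j t z) := by
    intro j t z hz hz0
    rw [pullbackForm_smul (η := η t) (η' := Ω) (f := (P.chart j).symm) (x := z) rfl,
      P.eq j z hz hz0, AlternatingMap.smul_apply, AlternatingMap.smul_apply, stdForm_stdFrame,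
      hBeq j z hz, cpow_weight (norm_pos_iff.2 hz0), kern]
    simp only [G, indicator_of_mem hz, zpow_neg, zpow_natCast, smul_eq_mul]
    field_simp
  have hae : ∀ j t, ∀ᵐ z ∂(volume.restrict (P.chart j).target),
      (-2 * Complex.I) ^ (n + 1) * (kern o (-(P.m j : ℤ)) (-(P.l j : ℤ)) t (z 0) * G j t z) =
      (P.ρ j ((P.chart j).symm z) : ℂ) *
        pullbackForm (P.chart j).symm (η t) z (stdFrame (n + 1)) := by
    intro j t
    filter_upwards [ae_restrict_of_ae (ae_ne_zero n),
      ae_restrict_mem (P.chart j).open_target.measurableSet] with z hz0 hz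
    exact (hpt j t z hz hz0).symm
  let I : Fin P.r → ℂ → ℂ := fun j t =>
    ∫ z, kern o (-(P.m j : ℤ)) (-(P.l j : ℤ)) t (z 0) * G j t z
  have hI : ∀ j t, ∫ z in (P.chart j).target, (P.ρ j ((P.chart j).symm z) : ℂ) *
      pullbackForm (P.chart j).symm (η t) z (stdFrame (n + 1)) =
      (-2 * Complex.I) ^ (n + 1) * I j t := by
    intro j t
    rw [← integral_congr_ae (hae j t), integral_const_mul]
    congr 1
    refine setIntegral_eq_integral_of_forall_compl_eq_zero fun z hz => ?_
    simp only [G, indicator_of_notMem hz, mul_zero]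
  refine ⟨fun t => ∑ j, (-2 * Complex.I) ^ (n + 1) * I j t, _, HasPoleContinuation.sum _ fun j _ =>
    (kern_hasPoleContinuation ho1 (P.one_le_m j) (P.one_le_l j) (hG j)).const_mul _, fun hQ1 => ?_,
    ∑ j, ((P.m j : ℝ) + P.l j), fun t ht => ?_⟩
  · rw [ResidueData.integral, Finset.mul_sum]
    refine Finset.sum_congr rfl fun j _ => ?_
    -- At `t = 0` the weight of the metric is `1`, which is why the residue does not see the metric.
    have : G j 0 = P.cutoff j := by
      simp only [G, ResidueData.cutoff, mul_zero, zero_mul, Complex.exp_zero, hQ1, mul_one]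
    rw [this, pow_succ]
    ring
  · simp only [← hI]
    refine hasFormIntegral_of_family (fun j => (P.adapted j).1) P.subordinate fun j => ?_
    have hj : ((P.m j : ℝ) + P.l j) < t.re := lt_of_le_of_lt
      (Finset.single_le_sum (f := fun j => ((P.m j : ℝ) + P.l j))
        (fun i _ => by positivity) (Finset.mem_univ j)) ht
    have hint := ((hG j).kern_integral o (-(P.m j : ℤ)) (-(P.l j : ℤ)) (t := t) (by
      push_cast
      have h1 : (1 : ℝ) ≤ o := by exact_mod_cast ho1
      have h2 : 0 ≤ (P.m j : ℝ) := by positivity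
      have h3 : 0 ≤ (P.l j : ℝ) := by positivity
      nlinarith)).1
    exact ((hint.const_mul ((-2 * Complex.I) ^ (n + 1))).integrableOn).congr (hae j t)

/-- The residue integral does not depend on the residue data. -/
lemma ResidueData.integral_eq (P P' : ResidueData ι Ω)
    (hs : ContMDiff 𝓘(ℂ, Cn (n + 1)) (𝓘(ℂ, Cn (n + 1)).prod 𝓘(ℂ, ℂ)) ω
      (fun x => (⟨x, s x⟩ : Bundle.TotalSpace ℂ L)))
    (hsD : ∀ x, s x = 0 ↔ x ∈ range ι)
    {o : ℕ} (ho1 : 1 ≤ o) (ho : ∀ p : D, HasVanishingOrderAt (n := n) ι s (ι p) o) :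
    P.integral = P'.integral := by
  -- The metric is auxiliary: with any one of them, both sets of data compute the residue at `0` of
  -- the same integral.
  obtain ⟨h⟩ := LineBundleMetric.nonempty (n := n) (L := L)
  have hφ : ContMDiff 𝓘(ℝ, Cn (n + 1)) 𝓘(ℝ, ℝ) ∞ (fun _ : X => (0 : ℝ)) := contMDiff_const
  have hQ : Differentiable ℂ (fun _ : ℂ => (1 : ℂ)) := differentiable_const 1
  obtain ⟨f, r, hf, hr, c, hc⟩ := P.exists_hasPoleContinuation h hs hsD ho1 ho hQ hφ
  obtain ⟨f', r', hf', hr', c', hc'⟩ := P'.exists_hasPoleContinuation h hs hsD ho1 ho hQ hφ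
  have h1 := hf.unique (hf'.congr (c := max c c') fun t ht =>
    (hc t ((le_max_left _ _).trans_lt ht)).eq_of_family (hc' t ((le_max_right _ _).trans_lt ht))
      (fun j => (P.adapted j).1) P.subordinate)
  rw [hr rfl, hr' rfl] at h1
  refine mul_left_cancel₀ (neg_ne_zero.2 (div_ne_zero ?_ ?_)) h1
  · simp [Real.pi_ne_zero, Complex.I_ne_zero]
  · exact_mod_cast (by omega : o ≠ 0)

end ResidueIntegral

/-! ### The Laurent expansion and its dependence on the metric. -/

section Continuation

variable {n : ℕ}
variable {X : Type*} [TopologicalSpace X] [T2Space X] [CompactSpace X]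
  [ChartedSpace (Cn (n + 1)) X] [IsManifold 𝓘(ℂ, Cn (n + 1)) ω X]
variable {D : Type*} [TopologicalSpace D] [ChartedSpace (Cn n) D] [IsManifold 𝓘(ℂ, Cn n) ω D]
variable {ι : D → X} {Ω : Form (n + 1) X (2 * (n + 1))}
variable {L : X → Type*} [TopologicalSpace (Bundle.TotalSpace ℂ L)] [∀ x, TopologicalSpace (L x)]
  [∀ x, AddCommGroup (L x)] [∀ x, Module ℂ (L x)] [FiberBundle ℂ L] [VectorBundle ℂ ℂ L]
  [ContMDiffVectorBundle ω ℂ L 𝓘(ℂ, Cn (n + 1))]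
variable {s : ∀ x, L x}

/-- `F = R / t` near `0` continues `t ↦ ∫ |s|^{2t} Ω`, where `R` is analytic with `R 0 = r`. -/
def IsPoleContinuation (h : LineBundleMetric n L) (s : ∀ x, L x)
    (Ω : Form (n + 1) X (2 * (n + 1))) (r : ℂ) (F R : ℂ → ℂ) : Prop :=
  AnalyticAt ℂ R 0 ∧ R 0 = r ∧ (∀ᶠ t in 𝓝[≠] (0 : ℂ), F t = R t / t) ∧
    IsMeromorphicContinuation h s Ω F

lemma ResidueData.exists_isPoleContinuation (P : ResidueData ι Ω) (h : LineBundleMetric n L)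
    (hs : ContMDiff 𝓘(ℂ, Cn (n + 1)) (𝓘(ℂ, Cn (n + 1)).prod 𝓘(ℂ, ℂ)) ω
      (fun x => (⟨x, s x⟩ : Bundle.TotalSpace ℂ L)))
    (hsD : ∀ x, s x = 0 ↔ x ∈ range ι)
    {o : ℕ} (ho1 : 1 ≤ o) (ho : ∀ p : D, HasVanishingOrderAt (n := n) ι s (ι p) o) :
    ∃ F R : ℂ → ℂ,
      IsPoleContinuation h s Ω (-(2 * (Real.pi : ℂ) * Complex.I / o) * P.integral) F R := by
  obtain ⟨f, r, ⟨F, R, hF, hR, hRr, hFR, c, hc⟩, hr, c', hc'⟩ :=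
    P.exists_hasPoleContinuation h hs hsD ho1 ho (differentiable_const 1)
      (contMDiff_const (c := (0 : ℝ)))
  refine ⟨F, R, hR, hRr.trans (hr rfl), hFR, hF, max c c', fun t ht => ?_⟩
  obtain ⟨h1, h2⟩ := hc t ((le_max_left _ _).trans_lt ht)
  have h3 := hc' t ((le_max_right _ _).trans_lt ht)
  simp only [mul_one] at h3
  exact ⟨h1, h2 ▸ h3⟩

/-- Writing `R t = r + t S(t)`, the constant term is `S(0) = R'(0)` and the error is `S(t) - S(0)`.
-/
lemma IsPoleContinuation.isBigO {h : LineBundleMetric n L} {r : ℂ} {F R : ℂ → ℂ}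
    (hF : IsPoleContinuation h s Ω r F R) :
    (fun t : ℂ => F t - (t⁻¹ * r + deriv R 0)) =O[𝓝[≠] 0] (fun t : ℂ => ‖t‖) := by
  obtain ⟨hR, hr, hFR, -⟩ := hF
  obtain ⟨S, hS, hS0, hRS⟩ := hR.exists_eq_add_mul
  have h1 : (fun t => S t - S 0) =O[𝓝[≠] (0 : ℂ)] fun t => t - 0 :=
    hS.differentiableAt.isBigO_sub.mono nhdsWithin_le_nhds
  simp only [sub_zero] at h1
  refine (h1.norm_right).congr' ?_ EventuallyEq.rfl
  filter_upwards [hFR, self_mem_nhdsWithin] with t ht (ht0 : t ≠ 0)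
  rw [ht, hRS t, hr, hS0]
  field_simp
  ring

/-- The dependence of the constant term on the metric. -/
lemma IsPoleContinuation.deriv_sub_deriv {h h' : LineBundleMetric n L} {r : ℂ}
    {F R F' R' : ℂ → ℂ} (hF : IsPoleContinuation h s Ω r F R)
    (hF' : IsPoleContinuation h' s Ω r F' R') (P : ResidueData ι Ω)
    (hs : ContMDiff 𝓘(ℂ, Cn (n + 1)) (𝓘(ℂ, Cn (n + 1)).prod 𝓘(ℂ, ℂ)) ω
      (fun x => (⟨x, s x⟩ : Bundle.TotalSpace ℂ L)))
    (hsD : ∀ x, s x = 0 ↔ x ∈ range ι)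
    {o : ℕ} (ho1 : 1 ≤ o) (ho : ∀ p : D, HasVanishingOrderAt (n := n) ι s (ι p) o)
    {φ : X → ℝ} (hφ : ContMDiff 𝓘(ℝ, Cn (n + 1)) 𝓘(ℝ, ℝ) ∞ φ)
    (Pφ : ResidueData ι (fun x => (φ x : ℂ) • Ω x))
    (hh : ∀ x (v : L x), h'.norm x v = Real.exp (-φ x) * h.norm x v) :
    deriv R' 0 - deriv R 0 = 4 * (Real.pi : ℂ) * Complex.I / (o : ℂ) * Pφ.integral := by
  obtain ⟨E, hE, hexp⟩ := exists_entire_remainder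
  have hφ2 : ContMDiff 𝓘(ℝ, Cn (n + 1)) 𝓘(ℝ, ℂ) ∞ (fun x => ((φ x : ℂ)) ^ 2) := by
    have h1 : ContDiff ℝ ∞ (fun y : ℝ => ((y : ℂ)) ^ 2) := Complex.ofRealCLM.contDiff.pow 2
    exact h1.contMDiff.comp hφ
  obtain ⟨F₁, R₁, hR₁, hr₁, hFR₁, hm₁, c₁, hc₁⟩ :=
    Pφ.exists_isPoleContinuation h hs hsD ho1 ho
  obtain ⟨f₂, r₂, ⟨F₂, R₂, hm₂, hR₂, -, hFR₂, c₂, hc₂⟩, -, c₂', hc₂'⟩ :=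
    (P.smul hφ2).exists_hasPoleContinuation h hs hsD ho1 ho hE hφ
  obtain ⟨hR, hr, hFR, hm, c, hc⟩ := hF
  obtain ⟨hR', hr', hFR', hm', c', hc'⟩ := hF'
  -- Expand `e^{-2tφ}` by `hexp` under the integral sign; `F₁` belongs to `φ Ω`, and `F₂` to `φ² Ω`
  -- with the extra factor `E(tφ)`.
  have hlarge : ∀ t : ℂ, max (max c c') (max c₁ (max c₂ c₂')) < t.re →
      F' t = F t + (-2 * t) * F₁ t + t ^ 2 * F₂ t := by
    intro t ht
    simp only [max_lt_iff] at ht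
    obtain ⟨⟨ht1, ht2⟩, ht3, ht4, ht5⟩ := ht
    have h2 := hc₂' t ht5
    rw [← (hc₂ t ht4).2] at h2
    have h3 := ((hc t ht1).2.add ((hc₁ t ht3).2.const_smul (-2 * t))).add (h2.const_smul (t ^ 2))
    refine (hc' t ht2).2.eq_of_family ?_ (fun j => (P.adapted j).1) P.subordinate
    convert h3 using 1
    ext1 x
    have h4 : ((h'.norm x (s x) : ℂ)) ^ (2 * t) = (h.norm x (s x) : ℂ) ^ (2 * t) *
        Complex.exp (-2 * (t * φ x)) := by
      have hnn : 0 ≤ h.norm x (s x) := by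
        by_cases h0 : s x = 0
        · rw [h0, h.norm_zero]
        · exact (h.norm_pos x _ h0).le
      rw [hh, Complex.ofReal_mul, Complex.mul_cpow_ofReal_nonneg (Real.exp_pos _).le hnn, mul_comm]
      congr 1
      rw [Complex.cpow_def_of_ne_zero (by exact_mod_cast (Real.exp_pos _).ne'),
        ← Complex.ofReal_log (Real.exp_pos _).le, Real.log_exp]
      congr 1
      push_cast
      ring
    simp only [Pi.add_apply, Pi.smul_apply, smul_smul, ← add_smul]
    congr 1
    rw [h4, hexp]
    ring
  have hnear : F' =ᶠ[𝓝[≠] (0 : ℂ)] fun t => F t + (-2 * t) * F₁ t + t ^ 2 * F₂ t :=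
    meromorphic_eventuallyEq_zero hm' (fun t => ((hm t).add
      ((MeromorphicAt.const (-2) t).mul (MeromorphicAt.id t) |>.mul (hm₁ t))).add
        (((MeromorphicAt.id t).pow 2).mul (hm₂ t))) hlarge
  -- After multiplication by `t` the poles are gone. Differentiating at `0` kills the quadratic term
  -- and leaves `-2 R₁(0)`, that is `-2` times the residue for `φ Ω`.
  have hRR : R' =ᶠ[𝓝 (0 : ℂ)] fun t => R t + (-2 * t) * R₁ t + t ^ 2 * R₂ t := by
    refine hR'.eventuallyEq_of_nhdsNE ((hR.add ((analyticAt_const.mul analyticAt_id).mul hR₁)).add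
      ((analyticAt_id.pow 2).mul hR₂)) ?_
    filter_upwards [hnear, hFR, hFR', hFR₁, hFR₂, self_mem_nhdsWithin]
      with t a b c d e (ht0 : t ≠ 0)
    rw [b, c, d, e] at a
    field_simp at a
    linear_combination a
  have hd : HasDerivAt (fun t : ℂ => R t + (-2 * t) * R₁ t + t ^ 2 * R₂ t)
      (deriv R 0 + -2 * R₁ 0) 0 := by
    have h1 := ((hasDerivAt_id (0 : ℂ)).const_mul (-2)).mul hR₁.differentiableAt.hasDerivAt
    have h2 := ((hasDerivAt_id (0 : ℂ)).pow 2).mul hR₂.differentiableAt.hasDerivAt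
    have h3 := (hR.differentiableAt.hasDerivAt.add h1).add h2
    refine h3.congr_deriv ?_
    simp
  rw [hRR.deriv_eq, hd.deriv, hr₁]
  ring

end Continuation

end

theorem corollary4p2 {n : ℕ}
    -- a compact complex manifold `X` of dimension `d = n + 1`
    {X : Type*} [TopologicalSpace X] [T2Space X] [CompactSpace X]
    [ChartedSpace (Cn (n + 1)) X] [IsManifold 𝓘(ℂ, Cn (n + 1)) ω X]
    -- a smooth hypersurface `D` in `X`
    {D : Type*} [TopologicalSpace D] [ChartedSpace (Cn n) D] [IsManifold 𝓘(ℂ, Cn n) ω D]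
    (ι : D → X) (hι : Manifold.IsSmoothEmbedding 𝓘(ℂ, Cn n) 𝓘(ℂ, Cn (n + 1)) ω ι)
    -- a holomorphic line bundle `L` with a holomorphic section `s` such that `D = {s = 0}`
    {L : X → Type*} [TopologicalSpace (Bundle.TotalSpace ℂ L)] [∀ x, TopologicalSpace (L x)]
    [∀ x, AddCommGroup (L x)] [∀ x, Module ℂ (L x)] [FiberBundle ℂ L] [VectorBundle ℂ ℂ L]
    [ContMDiffVectorBundle ω ℂ L 𝓘(ℂ, Cn (n + 1))]
    (s : ∀ x, L x)
    (hs : ContMDiff 𝓘(ℂ, Cn (n + 1)) (𝓘(ℂ, Cn (n + 1)).prod 𝓘(ℂ, ℂ)) ω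
      (fun x => (⟨x, s x⟩ : Bundle.TotalSpace ℂ L)))
    (hsD : ∀ x, s x = 0 ↔ x ∈ range ι)
    -- the vanishing order `o = o(s)` of `s` along `D`
    (o : ℕ) (ho : ∀ p : D, HasVanishingOrderAt (n := n) ι s (ι p) o)
    -- semi-meromorphic forms `α`, `β` with poles along `D`, of complementary degrees
    {k l : ℕ} (hkl : k + l = 2 * (n + 1)) (α : Form (n + 1) X k) (β : Form (n + 1) X l)
    (hα : IsSemiMeromorphic ι α) (hβ : IsSemiMeromorphic ι β)
    (Ω : Form (n + 1) X (2 * (n + 1))) (hΩ : Ω = castForm hkl (wedgeForm α (conjForm β))) :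
    ∃ (J : ℂ) (C₀ : LineBundleMetric n L → ℂ),
      HasAeppliResidueIntegral ι Ω J ∧
      (∀ h : LineBundleMetric n L, ∃ F : ℂ → ℂ, IsMeromorphicContinuation h s Ω F ∧
        (fun t : ℂ => F t - (t⁻¹ * (-(2 * (Real.pi : ℂ) * Complex.I / (o : ℂ)) * J) + C₀ h))
          =O[𝓝[≠] 0] (fun t : ℂ => ‖t‖)) ∧
      ∀ φ : X → ℝ, ContMDiff 𝓘(ℝ, Cn (n + 1)) 𝓘(ℝ, ℝ) ∞ φ →
        ∃ Jφ : ℂ, HasAeppliResidueIntegral ι (fun x => (φ x : ℂ) • Ω x) Jφ ∧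
          ∀ h h' : LineBundleMetric n L,
            (∀ x (v : L x), h'.norm x v = Real.exp (-φ x) * h.norm x v) →
            C₀ h' - C₀ h = 4 * (Real.pi : ℂ) * Complex.I / (o : ℂ) * Jφ := by
  subst hΩ
  have hD := isClosed_range_of_zeroLocus hs hsD
  obtain ⟨P⟩ := ResidueData.nonempty hD hkl hα hβ
  -- If `D` is empty, the hypothesis on `o` is vacuous and `o` could be `0`. The argument then runs
  -- with `o' = 1`, and by `hcoef` the coefficient is irrelevant because the residue integral
  -- vanishes.
  obtain ⟨o', ho1, ho', hoo⟩ : ∃ o' : ℕ, 1 ≤ o' ∧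
      (∀ p : D, HasVanishingOrderAt (n := n) ι s (ι p) o') ∧ (o = o' ∨ IsEmpty D) := by
    rcases isEmpty_or_nonempty D with h | ⟨⟨p⟩⟩
    · exact ⟨1, le_rfl, fun p => h.elim p, Or.inr h⟩
    · exact ⟨o, one_le_of_hasVanishingOrderAt ((hsD _).2 (mem_range_self p)) (mem_range_self p)
        (ho p), ho, Or.inl rfl⟩
  have hcoef : ∀ {Ω : Form (n + 1) X (2 * (n + 1))} (P : ResidueData ι Ω) (a : ℂ),
      a / (o' : ℂ) * P.integral = a / (o : ℂ) * P.integral := by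
    intro Ω P a
    rcases hoo with rfl | h
    · rfl
    · rw [(P.hasFormIntegral_form hι).eq_zero_of_isEmpty, mul_zero, mul_zero]
  choose F R hFR using fun h : LineBundleMetric n L =>
    P.exists_isPoleContinuation h hs hsD ho1 ho'
  refine ⟨P.integral, fun h => deriv (R h) 0,
    P.hasAeppliResidueIntegral hι hD fun P' => P'.integral_eq P hs hsD ho1 ho',
    fun h => ⟨F h, (hFR h).2.2.2, ?_⟩, fun φ hφ => ?_⟩
  · rw [neg_mul, ← hcoef P, ← neg_mul]
    exact (hFR h).isBigO
  · have hφc : ContMDiff 𝓘(ℝ, Cn (n + 1)) 𝓘(ℝ, ℂ) ∞ (fun x => (φ x : ℂ)) :=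
      Complex.ofRealCLM.contDiff.contMDiff.comp hφ
    let Pφ := P.smul hφc
    refine ⟨Pφ.integral,
      Pφ.hasAeppliResidueIntegral hι hD fun P' => P'.integral_eq Pφ hs hsD ho1 ho',
      fun h h' hh => ?_⟩
    rw [← hcoef Pφ]
    exact (hFR h).deriv_sub_deriv (hFR h') P hs hsD ho1 ho' hφ Pφ hh
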